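/- Let $(P_\theta)_{\theta\in\Theta}$, $\Theta\subset\mathbb{R}^m$, be a statistical model with densities $p(z|\theta)$ with respect to a common measure $\mu$, and let $\theta_0\in\operatorname{int}(\Theta)$. Assume that the model is differentiable in quadratic mean at $\theta_0$, i.e. there is a score function $s:\mathcal Z\to\mathbb{R}^m$ with $$\int\Big[\sqrt{p(z|\theta_0+h)}-\sqrt{p(z|\theta_0)}-\tfrac12 h's(z)\sqrt{p(z|\theta_0)}\Big]^2\,d\mu(z)=o(\|h\|^2)\quad\text{as }h\to0,$$ and that the Fisher information matrix $J_0=E_{\theta_0}[ss']$ is nonsingular. Let $D\ge 1$, $0<t_1<t_2<\dots<t_D\le 1$ and $I_d=[0,t_d]$. For each $n$ let $z_1,\dots,z_n$ be i.i.d. observations, and let $S_n(t_1),\dots,S_n(t_D)$ be real-valued statistics adapted to the information sets, that is, $S_n(t_d)$ is a measurable function of the observations $z_i$ with $i/n\in I_d$. Suppose that for every $h\in\mathbb{R}^m$ the vector $(S_n(t_1),\dots,S_n(t_D))$ converges weakly, when the observations have distribution $P_{\theta_n(h)}$ with $\theta_n(h)=\theta_0+h/\sqrt n$ and $n\to\infty$,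 to a probability law $\mathcal L_h$ on $\mathbb{R}^D$. Let $B$ be an $m$-dimensional standard Brownian motion on $[0,1]$, let $U\sim\mathrm{Unif}[0,1]$ be independent of $B$, and for $h\in\mathbb{R}^m$ let $W(t)=th+J_0^{-1/2}B(t)$, $t\in[0,1]$. Then: (i) There are measurable functions $T_1,\dots,T_D$, not depending on $h$, such that for every $h\in\mathbb{R}^m$ $$\big(T_1(W(t_1),U),\;T_2(W(t_1),W(t_2),U),\;\dots,\;T_D(W(t_1),\dots,W(t_D),U)\big)\sim\mathcal L_h.$$ (ii) Let $V(t)=B(t)-\frac{t}{t_D}B(t_D)$, $0\le t\le t_D$, be the Brownian bridge built from $B$. There are measurable functions $\tilde T_1,\dots,\tilde T_D$, not depending on $h$, such that for every $h\in\mathbb{R}^m$ the random vector whose first component is $\tilde T_1(W(t_1),U)$, whose $d$-th component for $1<d<D$ is $\tilde T_d(W(t_d),V(t_1),\dots,V(t_d),U)$, and whose $D$-th component is $\tilde T_D(W(t_D),V(t_1),\dots,V(t_{D-1}),U)$ has law $\mathcal L_h$ (for $D=1$ there is the single component $\tilde T_1(W(t_1),U)$). -/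

import Mathlib

open MeasureTheory ProbabilityTheory Filter
open scoped Topology unitInterval

noncomputable section

namespace LimitExperiment

/-! ### The statistical model -/

/-- `p θ`, `θ ∈ Θ`, is a family of probability densities with respect to the measure `μ`. -/
structure IsDensityFamily {m : ℕ} {𝒵 : Type*} [MeasurableSpace 𝒵] (μ : Measure 𝒵)
    (Θ : Set (EuclideanSpace ℝ (Fin m))) (p : EuclideanSpace ℝ (Fin m) → 𝒵 → ℝ) : Prop where
  measurable : ∀ θ ∈ Θ, Measurable (p θ)
  nonneg : ∀ θ ∈ Θ, ∀ z, 0 ≤ p θ z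
  lintegral_eq_one : ∀ θ ∈ Θ, ∫⁻ z, ENNReal.ofReal (p θ z) ∂μ = 1

/-- The distribution `P_θ` of one observation: it has density `p θ` with respect to `μ`. -/
def obsLaw {m : ℕ} {𝒵 : Type*} [MeasurableSpace 𝒵] (μ : Measure 𝒵)
    (p : EuclideanSpace ℝ (Fin m) → 𝒵 → ℝ) (θ : EuclideanSpace ℝ (Fin m)) : Measure 𝒵 :=
  μ.withDensity fun z => ENNReal.ofReal (p θ z)

/-- The joint distribution of `n` i.i.d. observations from `P_θ`. -/
def sampleLaw {m : ℕ} {𝒵 : Type*} [MeasurableSpace 𝒵] (μ : Measure 𝒵)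
    (p : EuclideanSpace ℝ (Fin m) → 𝒵 → ℝ) (θ : EuclideanSpace ℝ (Fin m)) (n : ℕ) :
    Measure (Fin n → 𝒵) :=
  Measure.pi fun _ => obsLaw μ p θ

/-- The remainder in the expansion of the square root density at `θ₀` in the direction `h`,
`√p(θ₀ + h) - √p(θ₀) - (1/2) (h' s) √p(θ₀)`. -/
def dqmRemainder {m : ℕ} {𝒵 : Type*} (p : EuclideanSpace ℝ (Fin m) → 𝒵 → ℝ)
    (θ₀ : EuclideanSpace ℝ (Fin m)) (s : 𝒵 → EuclideanSpace ℝ (Fin m))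
    (h : EuclideanSpace ℝ (Fin m)) (z : 𝒵) : ℝ :=
  √(p (θ₀ + h) z) - √(p θ₀ z) - 1 / 2 * inner ℝ h (s z) * √(p θ₀ z)

/-- Differentiability in quadratic mean at `θ₀` with score function `s`. -/
structure IsDQM {m : ℕ} {𝒵 : Type*} [MeasurableSpace 𝒵] (μ : Measure 𝒵)
    (p : EuclideanSpace ℝ (Fin m) → 𝒵 → ℝ) (θ₀ : EuclideanSpace ℝ (Fin m))
    (s : 𝒵 → EuclideanSpace ℝ (Fin m)) : Prop where
  measurable_score : Measurable s
  integrable : ∀ᶠ h in 𝓝 0, Integrable (fun z => dqmRemainder p θ₀ s h z ^ 2) μ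
  isLittleO : (fun h => ∫ z, dqmRemainder p θ₀ s h z ^ 2 ∂μ) =o[𝓝 0] fun h => ‖h‖ ^ 2

/-- The Fisher information matrix `E_{θ₀}[s s']`. -/
def fisherInfo {m : ℕ} {𝒵 : Type*} [MeasurableSpace 𝒵] (μ : Measure 𝒵)
    (p : EuclideanSpace ℝ (Fin m) → 𝒵 → ℝ) (θ₀ : EuclideanSpace ℝ (Fin m))
    (s : 𝒵 → EuclideanSpace ℝ (Fin m)) : Matrix (Fin m) (Fin m) ℝ :=
  Matrix.of fun i j => ∫ z, s z i * s z j ∂(obsLaw μ p θ₀)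

/-- The local parameter `θ_n(h) = θ₀ + h / √n`. -/
def localParam {m : ℕ} (θ₀ h : EuclideanSpace ℝ (Fin m)) (n : ℕ) : EuclideanSpace ℝ (Fin m) :=
  θ₀ + (√(n : ℝ))⁻¹ • h

/-! ### Statistics and their limits -/

/-- `S n z d` is the value of the `d`-th statistic on the sample `z = (z_1, …, z_n)`.
The statistics are adapted to the information sets `[0, t d]`: they are measurable, and the `d`-th
statistic uses only those observations `z_i` with `i / n ∈ [0, t d]`.
(The index `i : Fin n` stands for the observation number `i + 1`.) -/
structure IsAdapted {D : ℕ} {𝒵 : Type*} [MeasurableSpace 𝒵] (t : Fin D → I)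
    (S : (n : ℕ) → (Fin n → 𝒵) → Fin D → ℝ) : Prop where
  measurable : ∀ n, Measurable (S n)
  dependsOn : ∀ n d, DependsOn (fun z => S n z d)
    {i : Fin n | ((i : ℕ) + 1 : ℝ) / n ∈ Set.Icc (0 : ℝ) (t d)}

/-- Weak convergence of the measures `ν n` to `ν'`: convergence of the integrals of all bounded
continuous functions. -/
def ConvergesWeakly {E : Type*} [TopologicalSpace E] [MeasurableSpace E]
    (ν : ℕ → Measure E) (ν' : Measure E) : Prop :=
  ∀ f : BoundedContinuousFunction E ℝ,
    Tendsto (fun n => ∫ x, f x ∂(ν n)) atTop (𝓝 (∫ x, f x ∂ν'))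

/-! ### The limit experiment -/

/-- `B` is an `m`-dimensional standard Brownian motion on the time interval `[0, 1]`. -/
structure IsStdBrownianMotion {m : ℕ} {Ω : Type*} [MeasurableSpace Ω]
    (B : I → Ω → EuclideanSpace ℝ (Fin m)) (P : Measure Ω) : Prop where
  start_zero : ∀ᵐ ω ∂P, B 0 ω = 0
  indep_increments : HasIndepIncrements B P
  law_increment : ∀ r t : I, r ≤ t →
    HasLaw (fun ω => B t ω - B r ω) (multivariateGaussian 0 (((t : ℝ) - (r : ℝ)) • 1)) P
  continuous_paths : ∀ᵐ ω ∂P, Continuous fun t => B t ω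

open scoped MatrixOrder in
/-- The inverse square root `J^{-1/2}` of a positive definite matrix. -/
def invSqrt {m : ℕ} (J : Matrix (Fin m) (Fin m) ℝ) : Matrix (Fin m) (Fin m) ℝ :=
  (CFC.sqrt J)⁻¹

/-- The drifted Brownian motion `W(t) = t h + J^{-1/2} B(t)`. -/
def driftedBM {m : ℕ} {Ω : Type*} (J : Matrix (Fin m) (Fin m) ℝ)
    (B : I → Ω → EuclideanSpace ℝ (Fin m)) (h : EuclideanSpace ℝ (Fin m)) (t : I) (ω : Ω) :
    EuclideanSpace ℝ (Fin m) :=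
  (t : ℝ) • h + Matrix.toEuclideanCLM (𝕜 := ℝ) (invSqrt J) (B t ω)

/-- The Brownian bridge `V(t) = B(t) - (t / τ) B(τ)` on `[0, τ]` built from `B`. -/
def bridge {m : ℕ} {Ω : Type*} (B : I → Ω → EuclideanSpace ℝ (Fin m)) (τ t : I) (ω : Ω) :
    EuclideanSpace ℝ (Fin m) :=
  B t ω - ((t : ℝ) / (τ : ℝ)) • B τ ω

/-- The indices `c` of the bridge values `V(t_c)` on which the `d`-th function in the bridge
representation may depend: none for the first function, `c ≤ d` for an intermediate function, and
`c < D` (one-based) for the last, `D`-th, function. -/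
def bridgeIndices {D : ℕ} (d : Fin D) : Set (Fin D) :=
  {c | 0 < (d : ℕ) ∧ c ≤ d ∧ (c : ℕ) + 1 < D}

end LimitExperiment

end

/-!
Differentiability in quadratic mean makes the likelihood ratio of `θ₀ + h / √n` against `θ₀` close
in `L¹` to `exp (∑ d, (⟨h, Y d⟩ - (t d - t (d - 1)) ⟨h, J h⟩ / 2))`, where `Y d` is the normalized
sum of truncated scores over the `d`-th block of observations. Under `θ₀` the pairs `(S d, Y d)` are
tight. In a limit point `Q` of their joint laws the `Y d` are Gaussian with covariances
`(t d - t (d - 1)) J`, and because `S` is adapted, each `Y d` is independent of all earlier pairs.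
By Le Cam's third lemma, `L h` is the law of `S` under `Q` tilted by the limiting likelihood ratio.

The independence allows the `S d` to be generated one after the other, as functions of
`Y 0, …, Y d` and of independent uniform variables. The tilt affects only the `Y d`, which become
Gaussian shifts with the joint law of `J (W (t d) - W (t (d - 1)))`. So the same functions, applied
to the increments of `W`, represent every `L h`. For the bridge form, note that `W (t c)` with
`c ≤ d` is recovered from `W (t d)`, `V (t c)` and `V (t d)`, where `V` vanishes at the last time.
-/

namespace LimitExperiment

section ProductDensities

lemma pi_withDensity {ι : Type*} [Fintype ι] {X : ι → Type*} [∀ i, MeasurableSpace (X i)]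
    (μ : ∀ i, Measure (X i)) [∀ i, IsProbabilityMeasure (μ i)] {f : ∀ i, X i → ENNReal}
    (hf : ∀ i, Measurable (f i)) [∀ i, SigmaFinite ((μ i).withDensity (f i))] :
    Measure.pi (fun i => (μ i).withDensity (f i)) =
      (Measure.pi μ).withDensity fun x => ∏ i, f i (x i) := by
  refine Measure.pi_eq fun s hs => ?_
  have hind (x : ∀ i, X i) : (Set.univ.pi s).indicator (fun x => ∏ i, f i (x i)) x =
      ∏ i, (s i).indicator (f i) (x i) := by
    classical simp [Set.indicator_apply, Finset.prod_ite_zero]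
  have hm (i : ι) : Measurable ((s i).indicator (f i)) := (hf i).indicator (hs i)
  have hprod := lintegral_prod_eq_prod_lintegral_of_indepFun (μ := Measure.pi μ) Finset.univ
    (fun i x => (s i).indicator (f i) (x i))
    (iIndepFun_pi (X := fun i => (s i).indicator (f i)) fun i => (hm i).aemeasurable)
    fun i => (hm i).comp (measurable_pi_apply i)
  rw [withDensity_apply _ (MeasurableSet.univ_pi hs),
    ← lintegral_indicator (MeasurableSet.univ_pi hs), lintegral_congr hind, hprod]
  refine Finset.prod_congr rfl fun i _ => ?_
  rw [(measurePreserving_eval μ i).lintegral_comp (hm i), lintegral_indicator (hs i),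
    withDensity_apply _ (hs i)]

lemma map_withDensity {X Y : Type*} [MeasurableSpace X] [MeasurableSpace Y] (μ : Measure X)
    {e : X → Y} (he : Measurable e) {f : Y → ENNReal} (hf : Measurable f) :
    (μ.map e).withDensity f = (μ.withDensity fun x => f (e x)).map e := by
  ext s hs
  rw [withDensity_apply _ hs, Measure.map_apply he hs, withDensity_apply _ (he hs),
    setLIntegral_map hs hf he]

lemma integral_withDensity_ofReal {X : Type*} [MeasurableSpace X] (μ : Measure X) {f : X → ℝ}
    (hf : Measurable f) (hf0 : ∀ x, 0 ≤ f x) (φ : X → ℝ) :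
    ∫ x, φ x ∂μ.withDensity (fun x => ENNReal.ofReal (f x)) = ∫ x, φ x * f x ∂μ := by
  rw [integral_withDensity_eq_integral_toReal_smul hf.ennreal_ofReal (by simp)]
  simp only [ENNReal.toReal_ofReal (hf0 _), smul_eq_mul, mul_comm]

lemma isProbabilityMeasure_withDensity_ofReal {X : Type*} [MeasurableSpace X] {μ : Measure X}
    {f : X → ℝ} (hf0 : ∀ x, 0 ≤ f x) (hf : ∫ x, f x ∂μ = 1) :
    IsProbabilityMeasure (μ.withDensity fun x => ENNReal.ofReal (f x)) := by
  have hfi : Integrable f μ := .of_integral_ne_zero (by simp [hf])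
  exact ⟨by rw [withDensity_apply _ MeasurableSet.univ, Measure.restrict_univ,
    ← ofReal_integral_eq_lintegral_ofReal hfi (ae_of_all _ hf0), hf, ENNReal.ofReal_one]⟩

lemma integral_pi_withDensity_ofReal {ι X : Type*} [Fintype ι] [MeasurableSpace X]
    (μ : Measure X) [IsProbabilityMeasure μ] {f : X → ℝ} (hf : Measurable f) (hf0 : ∀ x, 0 ≤ f x)
    (hf1 : ∫ x, f x ∂μ = 1) (φ : (ι → X) → ℝ) :
    ∫ x, φ x ∂Measure.pi (fun _ : ι => μ.withDensity fun x => ENNReal.ofReal (f x)) =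
      ∫ x, φ x * ∏ i, f (x i) ∂Measure.pi fun _ : ι => μ := by
  have := isProbabilityMeasure_withDensity_ofReal hf0 hf1
  rw [pi_withDensity (fun _ : ι => μ) (f := fun _ x => ENNReal.ofReal (f x))
    fun _ => hf.ennreal_ofReal]
  simp_rw [← ENNReal.ofReal_prod_of_nonneg fun i (_ : i ∈ Finset.univ) => hf0 _]
  exact integral_withDensity_ofReal _ (by fun_prop) (fun x => Finset.prod_nonneg fun i _ => hf0 _) φ

lemma integral_finset_prod_pi {ι 𝕜 Z : Type*} [Fintype ι] [RCLike 𝕜] [MeasurableSpace Z]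
    (P : Measure Z) [IsProbabilityMeasure P] (A : Finset ι) (f : Z → 𝕜) :
    ∫ z : ι → Z, ∏ i ∈ A, f (z i) ∂(Measure.pi fun _ => P) = (∫ z, f z ∂P) ^ A.card := by
  classical
  have h := integral_fintype_prod_eq_prod (μ := fun _ : ι => P)
    fun i z => if i ∈ A then f z else 1
  simp only [Finset.prod_ite_mem, Finset.univ_inter] at h
  rw [h, ← Finset.prod_const, ← Finset.univ_inter A, ← Finset.prod_ite_mem]
  refine Finset.prod_congr rfl fun i _ => ?_
  simp only [Finset.univ_inter]
  split_ifs <;> simp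

lemma integrable_finset_prod_pi {ι 𝕜 Z : Type*} [Fintype ι] [RCLike 𝕜] [MeasurableSpace Z]
    {P : Measure Z} [IsProbabilityMeasure P] (A : Finset ι) {f : Z → 𝕜} (hf : Integrable f P) :
    Integrable (fun z : ι → Z => ∏ i ∈ A, f (z i)) (Measure.pi fun _ => P) := by
  classical
  have h : Integrable (fun z : ι → Z => ∏ i, if i ∈ A then f (z i) else 1)
      (Measure.pi fun _ => P) :=
    Integrable.fintype_prod (f := fun i z => if i ∈ A then f z else 1) fun i => by
      split_ifs
      exacts [hf, integrable_const 1]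
  simpa only [Finset.prod_ite_mem, Finset.univ_inter] using h

end ProductDensities

section Hellinger

lemma integral_abs_mul_le_sqrt_mul_sqrt {Ω : Type*} [MeasurableSpace Ω] {P : Measure Ω}
    {f g : Ω → ℝ} (hf : MemLp f 2 P) (hg : MemLp g 2 P) :
    ∫ ω, |f ω * g ω| ∂P ≤ √(∫ ω, f ω ^ 2 ∂P) * √(∫ ω, g ω ^ 2 ∂P) := by
  have h := integral_mul_norm_le_Lp_mul_Lq (μ := P) (f := f) (g := g)
    Real.HolderConjugate.two_two (by simpa using hf) (by simpa using hg)
  simpa only [Real.norm_eq_abs, Real.rpow_two, sq_abs, ← Real.sqrt_eq_rpow, abs_mul] using h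

lemma integral_abs_le_sqrt_integral_sq {Ω : Type*} [MeasurableSpace Ω] {P : Measure Ω}
    [IsProbabilityMeasure P] {f : Ω → ℝ} (hf : MemLp f 2 P) :
    ∫ ω, |f ω| ∂P ≤ √(∫ ω, f ω ^ 2 ∂P) := by
  simpa using integral_abs_mul_le_sqrt_mul_sqrt hf (memLp_const (1 : ℝ))

lemma memLp_two_sqrt {Ω : Type*} [MeasurableSpace Ω] {ν : Measure Ω} {f : Ω → ℝ}
    (hf0 : ∀ x, 0 ≤ f x) (hf : Integrable f ν) : MemLp (fun x => √(f x)) 2 ν := by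
  rw [memLp_two_iff_integrable_sq
    (Real.continuous_sqrt.comp_aestronglyMeasurable hf.aestronglyMeasurable)]
  simpa only [Real.sq_sqrt (hf0 _)] using hf

lemma two_mul_one_sub_integral_sqrt_mul_sqrt {Ω : Type*} [MeasurableSpace Ω] {ν : Measure Ω}
    {f g : Ω → ℝ} (hf0 : ∀ x, 0 ≤ f x) (hg0 : ∀ x, 0 ≤ g x) (hf : ∫ x, f x ∂ν = 1)
    (hg : ∫ x, g x ∂ν = 1) :
    2 * (1 - ∫ x, √(f x) * √(g x) ∂ν) = ∫ x, (√(f x) - √(g x)) ^ 2 ∂ν := by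
  have hfi : Integrable f ν := .of_integral_ne_zero (by simp [hf])
  have hgi : Integrable g ν := .of_integral_ne_zero (by simp [hg])
  have hfg : Integrable (fun x => √(f x) * √(g x)) ν :=
    (memLp_two_sqrt hf0 hfi).integrable_mul (memLp_two_sqrt hg0 hgi)
  have hsq (x : Ω) : (√(f x) - √(g x)) ^ 2 = f x + g x - 2 * (√(f x) * √(g x)) := by
    rw [sub_sq, Real.sq_sqrt (hf0 x), Real.sq_sqrt (hg0 x)]
    ring
  simp_rw [hsq]
  rw [integral_sub (hfi.fun_add hgi) (hfg.const_mul 2), integral_add hfi hgi, integral_const_mul,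
    hf, hg]
  ring

lemma integral_abs_sub_le_sqrt_affinity {Ω : Type*} [MeasurableSpace Ω] {ν : Measure Ω}
    {f g : Ω → ℝ} (hf0 : ∀ x, 0 ≤ f x) (hg0 : ∀ x, 0 ≤ g x) (hf : ∫ x, f x ∂ν = 1)
    (hg : ∫ x, g x ∂ν = 1) :
    ∫ x, |f x - g x| ∂ν ≤ 2 * √(2 * (1 - ∫ x, √(f x) * √(g x) ∂ν)) := by
  have hfi : Integrable f ν := .of_integral_ne_zero (by simp [hf])
  have hgi : Integrable g ν := .of_integral_ne_zero (by simp [hg])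
  have hsf := memLp_two_sqrt hf0 hfi
  have hsg := memLp_two_sqrt hg0 hgi
  have hadd : ∫ x, (√(f x) + √(g x)) ^ 2 ∂ν ≤ 2 ^ 2 := by
    calc ∫ x, (√(f x) + √(g x)) ^ 2 ∂ν ≤ ∫ x, 2 * (f x + g x) ∂ν := by
          refine integral_mono (hsf.add hsg).integrable_sq ((hfi.fun_add hgi).const_mul 2)
            fun x => ?_
          simpa only [Real.sq_sqrt (hf0 x), Real.sq_sqrt (hg0 x)] using
            add_sq_le (a := √(f x)) (b := √(g x))
      _ = 2 ^ 2 := by rw [integral_const_mul, integral_add hfi hgi, hf, hg]; norm_num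
  have hfactor (x : Ω) : f x - g x = (√(f x) - √(g x)) * (√(f x) + √(g x)) := by
    linear_combination Real.sq_sqrt (hg0 x) - Real.sq_sqrt (hf0 x)
  calc ∫ x, |f x - g x| ∂ν
      ≤ √(∫ x, (√(f x) - √(g x)) ^ 2 ∂ν) * √(∫ x, (√(f x) + √(g x)) ^ 2 ∂ν) := by
        simp_rw [hfactor]
        exact integral_abs_mul_le_sqrt_mul_sqrt (hsf.sub hsg) (hsf.add hsg)
    _ ≤ √(2 * (1 - ∫ x, √(f x) * √(g x) ∂ν)) * 2 := by
        rw [two_mul_one_sub_integral_sqrt_mul_sqrt hf0 hg0 hf hg]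
        gcongr
        exact Real.sqrt_le_iff.2 ⟨zero_le_two, hadd⟩
    _ = _ := mul_comm _ _

lemma integral_sqrt_prod_mul_sqrt_prod {ι X : Type*} [Fintype ι] [MeasurableSpace X]
    (ν : Measure X) [IsProbabilityMeasure ν] {f g : X → ℝ} (hf0 : ∀ x, 0 ≤ f x)
    (hg0 : ∀ x, 0 ≤ g x) :
    ∫ x : ι → X, √(∏ i, f (x i)) * √(∏ i, g (x i)) ∂(Measure.pi fun _ => ν) =
      (∫ x, √(f x) * √(g x) ∂ν) ^ Fintype.card ι := by
  simp_rw [Real.sqrt_prod _ fun i (_ : i ∈ Finset.univ) => hf0 _,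
    Real.sqrt_prod _ fun i (_ : i ∈ Finset.univ) => hg0 _, ← Finset.prod_mul_distrib]
  exact integral_fintype_prod_eq_pow fun x => √(f x) * √(g x)

lemma one_sub_pow_le_mul_one_sub {a : ℝ} (ha : 0 ≤ a) (n : ℕ) : 1 - a ^ n ≤ n * (1 - a) := by
  have h := one_add_mul_le_pow (a := a - 1) (by linarith) n
  rw [add_sub_cancel] at h
  linarith

lemma integral_abs_prod_sub_prod_le {ι X : Type*} [Fintype ι] [MeasurableSpace X]
    (ν : Measure X) [IsProbabilityMeasure ν] {f g : X → ℝ} (hf0 : ∀ x, 0 ≤ f x)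
    (hg0 : ∀ x, 0 ≤ g x) (hf : ∫ x, f x ∂ν = 1) (hg : ∫ x, g x ∂ν = 1) :
    ∫ x : ι → X, |∏ i, f (x i) - ∏ i, g (x i)| ∂(Measure.pi fun _ => ν) ≤
      2 * √(2 * (Fintype.card ι * (1 - ∫ x, √(f x) * √(g x) ∂ν))) := by
  have hprod {u : X → ℝ} (hu : ∫ x, u x ∂ν = 1) :
      ∫ x : ι → X, ∏ i, u (x i) ∂(Measure.pi fun _ => ν) = 1 := by
    rw [integral_fintype_prod_eq_pow u, hu, one_pow]
  refine (integral_abs_sub_le_sqrt_affinity (fun x => Finset.prod_nonneg fun i _ => hf0 _)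
    (fun x => Finset.prod_nonneg fun i _ => hg0 _) (hprod hf) (hprod hg)).trans ?_
  rw [integral_sqrt_prod_mul_sqrt_prod ν hf0 hg0]
  gcongr
  exact one_sub_pow_le_mul_one_sub
    (integral_nonneg fun x => mul_nonneg (Real.sqrt_nonneg _) (Real.sqrt_nonneg _)) _

theorem abs_integral_pi_sub_integral_pi_le {ι X : Type*} [Fintype ι] [MeasurableSpace X]
    (ν : Measure X) [IsProbabilityMeasure ν] {f g : X → ℝ} (hfm : Measurable f)
    (hgm : Measurable g) (hf0 : ∀ x, 0 ≤ f x) (hg0 : ∀ x, 0 ≤ g x) (hf : ∫ x, f x ∂ν = 1)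
    (hg : ∫ x, g x ∂ν = 1) {φ : (ι → X) → ℝ} (hφ : Measurable φ) {C : ℝ} (hC : ∀ x, |φ x| ≤ C) :
    |∫ x, φ x ∂Measure.pi (fun _ : ι => ν.withDensity fun x => ENNReal.ofReal (f x)) -
        ∫ x, φ x ∂Measure.pi (fun _ : ι => ν.withDensity fun x => ENNReal.ofReal (g x))| ≤
      C * (2 * √(2 * (Fintype.card ι * (1 - ∫ x, √(f x) * √(g x) ∂ν)))) := by
  have hprod {u : X → ℝ} (hu : ∫ x, u x ∂ν = 1) :
      Integrable (fun x : ι → X => ∏ i, u (x i)) (Measure.pi fun _ => ν) :=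
    Integrable.fintype_prod fun _ => .of_integral_ne_zero (by simp [hu])
  have hbdd {u : X → ℝ} (hu : ∫ x, u x ∂ν = 1) :
      Integrable (fun x : ι → X => φ x * ∏ i, u (x i)) (Measure.pi fun _ => ν) :=
    (hprod hu).bdd_mul hφ.aestronglyMeasurable (ae_of_all _ hC)
  have hC0 : 0 ≤ C := by
    have : Nonempty X := ν.nonempty_of_neZero
    exact (abs_nonneg _).trans (hC fun _ => Classical.arbitrary X)
  rw [integral_pi_withDensity_ofReal ν hfm hf0 hf, integral_pi_withDensity_ofReal ν hgm hg0 hg,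
    ← integral_sub (hbdd hf) (hbdd hg)]
  refine le_trans ?_
    (mul_le_mul_of_nonneg_left (integral_abs_prod_sub_prod_le ν hf0 hg0 hf hg) hC0)
  rw [← integral_const_mul, ← Real.norm_eq_abs]
  refine norm_integral_le_of_norm_le (((hprod hf).sub (hprod hg)).abs.const_mul C)
    (ae_of_all _ fun x => ?_)
  rw [← mul_sub, norm_mul]
  exact mul_le_mul_of_nonneg_right (hC x) (norm_nonneg _)

lemma withDensity_ofReal_div {X : Type*} [MeasurableSpace X] (μ : Measure X) {a u : X → ℝ}
    (ha : Measurable a) (hu : Measurable u) (ha0 : ∀ x, 0 ≤ a x) (h0 : ∀ x, a x = 0 → u x = 0) :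
    (μ.withDensity fun x => ENNReal.ofReal (a x)).withDensity
      (fun x => ENNReal.ofReal (u x / a x)) = μ.withDensity fun x => ENNReal.ofReal (u x) := by
  refine (withDensity_mul μ ha.ennreal_ofReal (hu.div ha).ennreal_ofReal).symm.trans ?_
  congr 1 with x
  rw [Pi.mul_apply, ← ENNReal.ofReal_mul (ha0 x), Pi.div_apply, mul_div_cancel_of_imp' (h0 x)]

theorem abs_integral_pi_withDensity_sub_le {ι X : Type*} [Fintype ι] [MeasurableSpace X]
    (μ : Measure X) {u v : X → ℝ} (hum : Measurable u) (hvm : Measurable v) (hu0 : ∀ x, 0 ≤ u x)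
    (hv0 : ∀ x, 0 ≤ v x) (hu : ∫ x, u x ∂μ = 1) (hv : ∫ x, v x ∂μ = 1)
    {φ : (ι → X) → ℝ} (hφ : Measurable φ) {C : ℝ} (hC : ∀ x, |φ x| ≤ C) :
    |∫ x, φ x ∂Measure.pi (fun _ : ι => μ.withDensity fun x => ENNReal.ofReal (u x)) -
        ∫ x, φ x ∂Measure.pi (fun _ : ι => μ.withDensity fun x => ENNReal.ofReal (v x))| ≤
      C * (2 * √(2 * (Fintype.card ι * (1 - ∫ x, √(u x) * √(v x) ∂μ)))) := by
  -- `μ` need not be σ-finite, so the densities are taken with respect to the average law.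
  set a : X → ℝ := fun x => (u x + v x) / 2 with ha
  have ha2 (x : X) : a x = (u x + v x) / 2 := rfl
  have ham : Measurable a := (hum.add hvm).div_const 2
  have ha0 (x : X) : 0 ≤ a x := by linarith [hu0 x, hv0 x, ha2 x]
  have hua (x : X) (hx : a x = 0) : u x = 0 := by linarith [hu0 x, hv0 x, ha2 x]
  have hva (x : X) (hx : a x = 0) : v x = 0 := by linarith [hu0 x, hv0 x, ha2 x]
  have ha1 : ∫ x, a x ∂μ = 1 := by
    rw [ha, integral_div, integral_add (.of_integral_ne_zero (by simp [hu]))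
      (.of_integral_ne_zero (by simp [hv])), hu, hv]
    norm_num
  have hν := isProbabilityMeasure_withDensity_ofReal ha0 ha1
  have hint {w : X → ℝ} (hw0 : ∀ x, a x = 0 → w x = 0) (hw : ∫ x, w x ∂μ = 1) :
      ∫ x, w x / a x ∂μ.withDensity (fun x => ENNReal.ofReal (a x)) = 1 := by
    simp_rw [integral_withDensity_ofReal μ ham ha0, div_mul_cancel_of_imp (hw0 _), hw]
  have haff (x : X) : √(u x / a x) * √(v x / a x) * a x = √(u x) * √(v x) := by
    rw [Real.sqrt_div' _ (ha0 x), Real.sqrt_div' _ (ha0 x), div_mul_div_comm,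
      Real.mul_self_sqrt (ha0 x)]
    exact div_mul_cancel_of_imp fun hx => by rw [hua x hx, Real.sqrt_zero, zero_mul]
  have hbound := abs_integral_pi_sub_integral_pi_le (ι := ι) _ (hum.div ham) (hvm.div ham)
    (fun x => div_nonneg (hu0 x) (ha0 x)) (fun x => div_nonneg (hv0 x) (ha0 x))
    (hint hua hu) (hint hva hv) hφ hC
  simp only [Pi.div_apply] at hbound
  rwa [withDensity_ofReal_div μ ham hum ha0 hua, withDensity_ofReal_div μ ham hvm ha0 hva,
    integral_withDensity_ofReal μ ham ha0, integral_congr_ae (ae_of_all _ haff)] at hbound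

end Hellinger

lemma tendsto_one_add_pow_cexp {g : ℕ → ℂ} {c : ℂ} {k : ℕ → ℕ} {τ : ℝ}
    (hg : Tendsto (fun n : ℕ => n * g n) atTop (𝓝 c))
    (hk : Tendsto (fun n : ℕ => (k n : ℝ) / n) atTop (𝓝 τ)) :
    Tendsto (fun n => (1 + g n) ^ k n) atTop (𝓝 (Complex.exp (τ * c))) := by
  have hlog := Complex.tendsto_nat_mul_log_one_add_of_tendsto hg
  have hexp := (((Complex.continuous_ofReal.tendsto τ).comp hk).mul hlog).cexp
  have hg0 : Tendsto g atTop (𝓝 0) := by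
    have h := (tendsto_inv_atTop_nhds_zero_nat (𝕜 := ℂ)).mul hg
    rw [zero_mul] at h
    refine h.congr' ?_
    filter_upwards [eventually_ne_atTop 0] with n hn
    rw [inv_mul_cancel_left₀ (Nat.cast_ne_zero.2 hn)]
  refine hexp.congr' ?_
  filter_upwards [eventually_ne_atTop 0,
    hg0.eventually_ne (show (0 : ℂ) ≠ -1 by simp)] with n hn hne
  have hn' : (n : ℂ) ≠ 0 := Nat.cast_ne_zero.2 hn
  have hne' : 1 + g n ≠ 0 := fun h => hne (by linear_combination h)
  have : (k n : ℂ) / n * (n * Complex.log (1 + g n)) = k n * Complex.log (1 + g n) := by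
    field_simp
  simp only [Function.comp_apply, Complex.ofReal_div, Complex.ofReal_natCast]
  rw [this, Complex.exp_nat_mul, Complex.exp_log hne']

lemma isLittleO_cexp_mul_sub_taylor (w : ℂ) :
    (fun x : ℝ => Complex.exp (w * x) - (1 + w * x + w ^ 2 / 2 * x ^ 2)) =o[𝓝 0]
      fun x => x ^ 2 := by
  have hw : Tendsto (fun x : ℝ => w * x) (𝓝 0) (𝓝 0) :=
    Continuous.tendsto' (by fun_prop) _ _ (by simp)
  have h := (Complex.exp_sub_sum_range_succ_isLittleO_pow 2).comp_tendsto hw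
  have hO : ((fun z : ℂ => z ^ 2) ∘ fun x : ℝ => w * x) =O[𝓝 0] fun x : ℝ => x ^ 2 :=
    .of_bound (‖w‖ ^ 2) (.of_forall fun x => by simp [mul_pow])
  refine (h.trans_isBigO hO).congr_left fun x => ?_
  simp only [Function.comp_apply, Finset.sum_range_succ, Finset.sum_range_zero, Nat.factorial]
  push_cast
  ring

lemma isLittleO_rexp_mul_sub_taylor (w : ℝ) :
    (fun x : ℝ => Real.exp (w * x) - (1 + w * x + w ^ 2 / 2 * x ^ 2)) =o[𝓝 0]
      fun x => x ^ 2 := by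
  rw [← Complex.isLittleO_ofReal_left]
  exact (isLittleO_cexp_mul_sub_taylor w).congr_left fun x => by push_cast; ring

lemma isLittleO_one_add_mul_rexp_sub_taylor :
    (fun x : ℝ => (1 + x) * Real.exp x - (1 + 2 * x + 3 / 2 * x ^ 2)) =o[𝓝 0]
      fun x => x ^ 2 := by
  have hone : (fun x : ℝ => 1 + x) =O[𝓝 0] fun _ => (1 : ℝ) :=
    (Continuous.tendsto (by fun_prop) 0).isBigO_one ℝ
  have hcube : (fun x : ℝ => x ^ 3) =o[𝓝 0] fun x => x ^ 2 :=
    Asymptotics.isLittleO_pow_pow (by norm_num)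
  have hexp := hone.mul_isLittleO (isLittleO_rexp_mul_sub_taylor 1)
  simp only [one_mul] at hexp
  exact (hexp.add (hcube.const_mul_left (1 / 2))).congr_left fun x => by ring

/-- A triangular array of bounded, centred random variables under `P`: the common law of the
`n`-th row is that of `X n`, uniformly bounded by `ε n → 0`, with variance asymptotic to `v / n`. -/
structure IsSmallArray {Z : Type*} [MeasurableSpace Z] (P : Measure Z) (X : ℕ → Z → ℝ)
    (ε : ℕ → ℝ) (v : ℝ) : Prop where
  measurable : ∀ n, Measurable (X n)
  tendsto_bound : Tendsto ε atTop (𝓝 0)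
  abs_le_bound : ∀ n z, |X n z| ≤ ε n
  integral_eq_zero : ∀ n, ∫ z, X n z ∂P = 0
  tendsto_variance : Tendsto (fun n : ℕ => (n : ℝ) * ∫ z, X n z ^ 2 ∂P) atTop (𝓝 v)

namespace IsSmallArray

variable {Z : Type*} [MeasurableSpace Z] {P : Measure Z} [IsProbabilityMeasure P]
  {X : ℕ → Z → ℝ} {ε : ℕ → ℝ} {v : ℝ}

lemma integrable_comp {𝕜 : Type*} [RCLike 𝕜] (hX : IsSmallArray P X ε v) {φ : ℝ → 𝕜}
    (hφ : Continuous φ) (n : ℕ) : Integrable (fun z => φ (X n z)) P := by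
  obtain ⟨C, hC⟩ := (isCompact_Icc (a := -ε n) (b := ε n)).exists_bound_of_continuousOn
    hφ.continuousOn
  exact .of_bound (hφ.measurable.comp (hX.measurable n)).aestronglyMeasurable C
    (ae_of_all _ fun z => hC _ (abs_le.1 (hX.abs_le_bound n z)))

lemma integrable_prod_comp (hX : IsSmallArray P X ε v) {φ : ℝ → ℝ} (hφ : Continuous φ) (n : ℕ)
    {ι : Type*} [Fintype ι] (A : Finset ι) :
    Integrable (fun z : ι → Z => ∏ i ∈ A, φ (X n (z i))) (Measure.pi fun _ => P) :=
  integrable_finset_prod_pi A (hX.integrable_comp hφ n)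

lemma memLp_two_prod_comp (hX : IsSmallArray P X ε v) {φ : ℝ → ℝ} (hφ : Continuous φ) (n : ℕ)
    {ι : Type*} [Fintype ι] (A : Finset ι) :
    MemLp (fun z : ι → Z => ∏ i ∈ A, φ (X n (z i))) 2 (Measure.pi fun _ => P) := by
  rw [memLp_two_iff_integrable_sq (hX.integrable_prod_comp hφ n A).aestronglyMeasurable]
  simp only [← Finset.prod_pow]
  exact hX.integrable_prod_comp (hφ.pow 2) n A

lemma integrable_exp_mul_sum (hX : IsSmallArray P X ε v) (w : ℝ) (n : ℕ) {ι : Type*} [Fintype ι]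
    (A : Finset ι) :
    Integrable (fun z : ι → Z => Real.exp (w * ∑ i ∈ A, X n (z i))) (Measure.pi fun _ => P) := by
  simpa only [Finset.mul_sum, Real.exp_sum] using
    hX.integrable_prod_comp (φ := fun x => Real.exp (w * x)) (by fun_prop) n A

lemma isLittleO_integral_comp_sub (hX : IsSmallArray P X ε v) {φ : ℝ → ℂ} (hφ : Continuous φ)
    {a b : ℂ} (hab : (fun x : ℝ => φ x - (1 + a * x + b * x ^ 2)) =o[𝓝 0] fun x => x ^ 2) :
    (fun n => (∫ z, φ (X n z) ∂P) - 1 - b * (∫ z, X n z ^ 2 ∂P : ℝ)) =o[atTop]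
      fun n => ∫ z, X n z ^ 2 ∂P := by
  have hint (n : ℕ) : (∫ z, φ (X n z) ∂P) - 1 - b * (∫ z, X n z ^ 2 ∂P : ℝ) =
      ∫ z, (φ (X n z) - (1 + a * X n z + b * (X n z : ℂ) ^ 2)) ∂P := by
    have hmean : ∫ z, (X n z : ℂ) ∂P = 0 := by
      rw [integral_complex_ofReal, hX.integral_eq_zero n, Complex.ofReal_zero]
    have hlin := (hX.integrable_comp Complex.continuous_ofReal n).const_mul a
    have hquad := (hX.integrable_comp (φ := fun x => (x : ℂ) ^ 2) (by fun_prop) n).const_mul b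
    rw [integral_sub (hX.integrable_comp hφ n)
        (((integrable_const 1).fun_add hlin).fun_add hquad),
      integral_add ((integrable_const 1).fun_add hlin) hquad,
      integral_add (integrable_const 1) hlin, integral_const_mul, integral_const_mul, hmean,
      ← integral_complex_ofReal]
    simp [sub_sub]
  refine Asymptotics.isLittleO_iff.2 fun c hc => ?_
  obtain ⟨δ, hδ, hball⟩ := Metric.eventually_nhds_iff.1 (Asymptotics.isLittleO_iff.1 hab hc)
  filter_upwards [hX.tendsto_bound.eventually (gt_mem_nhds hδ)] with n hn
  rw [hint n, Real.norm_of_nonneg (integral_nonneg fun z => sq_nonneg _), ← integral_const_mul]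
  refine norm_integral_le_of_norm_le ((hX.integrable_comp (continuous_pow 2) n).const_mul c)
    (ae_of_all _ fun z => ?_)
  have hz := hball (y := X n z) (by simpa using (hX.abs_le_bound n z).trans_lt hn)
  simpa only [norm_pow, Real.norm_eq_abs, sq_abs] using hz

lemma tendsto_mul_integral_comp_sub_one (hX : IsSmallArray P X ε v) {φ : ℝ → ℂ}
    (hφ : Continuous φ) {a b : ℂ}
    (hab : (fun x : ℝ => φ x - (1 + a * x + b * x ^ 2)) =o[𝓝 0] fun x => x ^ 2) :
    Tendsto (fun n : ℕ => n * ((∫ z, φ (X n z) ∂P) - 1)) atTop (𝓝 (b * v)) := by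
  have hrem : Tendsto (fun n : ℕ => (n : ℂ) *
      ((∫ z, φ (X n z) ∂P) - 1 - b * (∫ z, X n z ^ 2 ∂P : ℝ))) atTop (𝓝 0) := by
    have hcast : (fun n : ℕ => (n : ℂ)) =O[atTop] fun n : ℕ => (n : ℝ) :=
      Asymptotics.isBigO_of_le _ fun n => by simp
    exact (Asymptotics.isLittleO_one_iff ℝ).1 ((hcast.mul_isLittleO
      (hX.isLittleO_integral_comp_sub hφ hab)).trans_isBigO (hX.tendsto_variance.isBigO_one ℝ))
  have hmain := ((Complex.continuous_ofReal.tendsto v).comp hX.tendsto_variance).const_mul b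
  refine (zero_add (b * (v : ℂ)) ▸ hrem.add hmain).congr fun n => ?_
  simp only [Function.comp_apply, Complex.ofReal_mul, Complex.ofReal_natCast]
  ring

lemma tendsto_integral_prod_comp (hX : IsSmallArray P X ε v) {φ : ℝ → ℂ} (hφ : Continuous φ)
    {a b : ℂ} (hab : (fun x : ℝ => φ x - (1 + a * x + b * x ^ 2)) =o[𝓝 0] fun x => x ^ 2)
    {A : ∀ n, Finset (Fin n)} {τ : ℝ}
    (hA : Tendsto (fun n : ℕ => ((A n).card : ℝ) / n) atTop (𝓝 τ)) :
    Tendsto (fun n => ∫ z : Fin n → Z, ∏ i ∈ A n, φ (X n (z i)) ∂(Measure.pi fun _ => P)) atTop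
      (𝓝 (Complex.exp (τ * (b * v)))) := by
  refine (tendsto_one_add_pow_cexp (hX.tendsto_mul_integral_comp_sub_one hφ hab) hA).congr
    fun n => ?_
  rw [integral_finset_prod_pi P (A n) fun z => φ (X n z), add_sub_cancel]

lemma tendsto_integral_prod_comp_real (hX : IsSmallArray P X ε v) {φ : ℝ → ℝ}
    (hφ : Continuous φ) {a b : ℝ}
    (hab : (fun x : ℝ => φ x - (1 + a * x + b * x ^ 2)) =o[𝓝 0] fun x => x ^ 2)
    {A : ∀ n, Finset (Fin n)} {τ : ℝ}
    (hA : Tendsto (fun n : ℕ => ((A n).card : ℝ) / n) atTop (𝓝 τ)) :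
    Tendsto (fun n => ∫ z : Fin n → Z, ∏ i ∈ A n, φ (X n (z i)) ∂(Measure.pi fun _ => P)) atTop
      (𝓝 (Real.exp (τ * (b * v)))) := by
  have h := hX.tendsto_integral_prod_comp (φ := fun x => (φ x : ℂ)) (a := a) (b := b)
    (Complex.continuous_ofReal.comp hφ)
    ((Complex.isLittleO_ofReal_left.2 hab).congr_left fun x => by push_cast; ring) hA
  have hre := (Complex.continuous_re.tendsto _).comp h
  simp only [← Complex.ofReal_mul, ← Complex.ofReal_exp, Complex.ofReal_re] at hre
  refine hre.congr fun n => ?_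
  simp only [Function.comp_apply, ← Complex.ofReal_prod]
  rw [integral_complex_ofReal, Complex.ofReal_re]

lemma tendsto_integral_cexp_mul_sum (hX : IsSmallArray P X ε v) (w : ℂ)
    {A : ∀ n, Finset (Fin n)} {τ : ℝ}
    (hA : Tendsto (fun n : ℕ => ((A n).card : ℝ) / n) atTop (𝓝 τ)) :
    Tendsto (fun n => ∫ z : Fin n → Z, Complex.exp (w * (∑ i ∈ A n, X n (z i) : ℝ))
      ∂(Measure.pi fun _ => P)) atTop (𝓝 (Complex.exp (τ * (w ^ 2 / 2 * v)))) := by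
  simpa only [← Complex.exp_sum, ← Finset.mul_sum, ← Complex.ofReal_sum] using
    hX.tendsto_integral_prod_comp (φ := fun x => Complex.exp (w * x)) (by fun_prop)
      (isLittleO_cexp_mul_sub_taylor w) hA

lemma tendsto_integral_rexp_mul_sum (hX : IsSmallArray P X ε v) (w : ℝ)
    {A : ∀ n, Finset (Fin n)} {τ : ℝ}
    (hA : Tendsto (fun n : ℕ => ((A n).card : ℝ) / n) atTop (𝓝 τ)) :
    Tendsto (fun n => ∫ z : Fin n → Z, Real.exp (w * ∑ i ∈ A n, X n (z i))
      ∂(Measure.pi fun _ => P)) atTop (𝓝 (Real.exp (τ * (w ^ 2 / 2 * v)))) := by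
  simpa only [← Real.exp_sum, ← Finset.mul_sum] using
    hX.tendsto_integral_prod_comp_real (φ := fun x => Real.exp (w * x)) (by fun_prop)
      (isLittleO_rexp_mul_sub_taylor w) hA

lemma integral_sq_prod_sub_const_mul_exp_sum (hX : IsSmallArray P X ε v) (n : ℕ)
    (A : Finset (Fin n)) (c : ℝ) :
    ∫ z : Fin n → Z, (∏ i ∈ A, (1 + X n (z i)) - c * Real.exp (∑ i ∈ A, X n (z i))) ^ 2
        ∂(Measure.pi fun _ => P) =
      (∫ z : Fin n → Z, ∏ i ∈ A, (1 + X n (z i)) ^ 2 ∂(Measure.pi fun _ => P)) -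
      2 * c * (∫ z : Fin n → Z, ∏ i ∈ A, ((1 + X n (z i)) * Real.exp (X n (z i)))
        ∂(Measure.pi fun _ => P)) +
      c ^ 2 * ∫ z : Fin n → Z, Real.exp (2 * ∑ i ∈ A, X n (z i)) ∂(Measure.pi fun _ => P) := by
  have hsq := hX.integrable_prod_comp (φ := fun x => (1 + x) ^ 2) (by fun_prop) n A
  have hcross := (hX.integrable_prod_comp (φ := fun x => (1 + x) * Real.exp x)
    (by fun_prop) n A).const_mul (2 * c)
  have hexp := (hX.integrable_exp_mul_sum 2 n A).const_mul (c ^ 2)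
  have hdiff : Integrable (fun z : Fin n → Z => ∏ i ∈ A, (1 + X n (z i)) ^ 2 -
      2 * c * ∏ i ∈ A, ((1 + X n (z i)) * Real.exp (X n (z i)))) (Measure.pi fun _ => P) :=
    hsq.sub hcross
  rw [← integral_const_mul, ← integral_const_mul, ← integral_sub hsq hcross,
    ← integral_add hdiff hexp]
  refine integral_congr_ae (ae_of_all _ fun z => ?_)
  simp only [Finset.prod_mul_distrib, Finset.prod_pow, ← Real.exp_sum, two_mul, Real.exp_add]
  ring

/- Both `∏ (1 + X)` and `exp (∑ X - τ v / 2)` have second moment tending to `exp (τ v)`, and so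
does the integral of their product. -/
lemma tendsto_integral_sq_prod_sub_exp (hX : IsSmallArray P X ε v)
    {A : ∀ n, Finset (Fin n)} {τ : ℝ}
    (hA : Tendsto (fun n : ℕ => ((A n).card : ℝ) / n) atTop (𝓝 τ)) :
    Tendsto (fun n => ∫ z : Fin n → Z, (∏ i ∈ A n, (1 + X n (z i)) -
      Real.exp (∑ i ∈ A n, X n (z i) - τ * v / 2)) ^ 2 ∂(Measure.pi fun _ => P)) atTop (𝓝 0) := by
  set c := Real.exp (-(τ * v / 2)) with hc
  have hsq := hX.tendsto_integral_prod_comp_real (φ := fun x => (1 + x) ^ 2) (a := 2) (b := 1)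
    (by fun_prop) ((Asymptotics.isLittleO_zero _ _).congr_left fun x => by ring) hA
  have hcross := hX.tendsto_integral_prod_comp_real (φ := fun x => (1 + x) * Real.exp x)
    (by fun_prop) isLittleO_one_add_mul_rexp_sub_taylor hA
  have hlim := (hsq.sub (hcross.const_mul (2 * c))).add
    ((hX.tendsto_integral_rexp_mul_sum 2 hA).const_mul (c ^ 2))
  have hzero : Real.exp (τ * (1 * v)) - 2 * c * Real.exp (τ * (3 / 2 * v)) +
      c ^ 2 * Real.exp (τ * (2 ^ 2 / 2 * v)) = 0 := by
    rw [hc, ← Real.exp_nat_mul, mul_assoc, ← Real.exp_add, ← Real.exp_add]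
    ring_nf
  refine (hzero ▸ hlim).congr fun n => ?_
  rw [← hX.integral_sq_prod_sub_const_mul_exp_sum]
  simp only [hc, ← Real.exp_add, sub_eq_neg_add]

theorem tendsto_integral_abs_prod_sub_exp (hX : IsSmallArray P X ε v)
    {A : ∀ n, Finset (Fin n)} {τ : ℝ}
    (hA : Tendsto (fun n : ℕ => ((A n).card : ℝ) / n) atTop (𝓝 τ)) :
    Tendsto (fun n => ∫ z : Fin n → Z, |∏ i ∈ A n, (1 + X n (z i)) -
      Real.exp (∑ i ∈ A n, X n (z i) - τ * v / 2)| ∂(Measure.pi fun _ => P)) atTop (𝓝 0) := by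
  have hsqrt := (hX.tendsto_integral_sq_prod_sub_exp hA).sqrt
  rw [Real.sqrt_zero] at hsqrt
  refine squeeze_zero (fun n => integral_nonneg fun z => abs_nonneg _)
    (fun n => integral_abs_le_sqrt_integral_sq ?_) hsqrt
  have hexp := (hX.memLp_two_prod_comp Real.continuous_exp n (A n)).const_mul
    (Real.exp (-(τ * v / 2)))
  simp only [← Real.exp_sum, ← Real.exp_add, ← sub_eq_neg_add] at hexp
  exact (hX.memLp_two_prod_comp (by fun_prop : Continuous fun x : ℝ => 1 + x) n (A n)).sub hexp

end IsSmallArray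

lemma tendsto_inv_sqrt_nat : Tendsto (fun n : ℕ => (√(n : ℝ))⁻¹) atTop (𝓝 0) :=
  tendsto_inv_atTop_zero.comp (Real.tendsto_sqrt_atTop.comp tendsto_natCast_atTop_atTop)

lemma tendsto_inv_sqrt_nat_smul {E : Type*} [NormedAddCommGroup E] [NormedSpace ℝ E] (h : E) :
    Tendsto (fun n : ℕ => (√(n : ℝ))⁻¹ • h) atTop (𝓝 0) := by
  simpa using tendsto_inv_sqrt_nat.smul_const h

lemma abs_integral_mul_le_of_integral_sq_eq_one {X : Type*} [MeasurableSpace X] {μ : Measure X}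
    {a u r : X → ℝ} (ha : MemLp a 2 μ) (hu : MemLp u 2 μ) (hr : MemLp r 2 μ)
    (ha1 : ∫ x, a x ^ 2 ∂μ = 1) (hs1 : ∫ x, (a x + (u x / 2 + r x)) ^ 2 ∂μ = 1) :
    |∫ x, u x * a x ∂μ| ≤
      (∫ x, u x ^ 2 ∂μ) / 2 + 2 * ∫ x, r x ^ 2 ∂μ + 2 * √(∫ x, r x ^ 2 ∂μ) := by
  have hg : MemLp (fun x => u x / 2 + r x) 2 μ := by
    simp only [div_eq_inv_mul]
    exact (hu.const_mul 2⁻¹).add hr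
  have hua : Integrable (fun x => u x * a x) μ := hu.integrable_mul ha
  have hra : Integrable (fun x => r x * a x) μ := hr.integrable_mul ha
  have hexpand : ∫ x, (u x / 2 + r x) ^ 2 ∂μ + ∫ x, u x * a x ∂μ + 2 * ∫ x, r x * a x ∂μ = 0 := by
    have hsplit (x : X) : (a x + (u x / 2 + r x)) ^ 2 =
        a x ^ 2 + ((u x / 2 + r x) ^ 2 + u x * a x + 2 * (r x * a x)) := by ring
    simp_rw [hsplit] at hs1
    rw [integral_add ha.integrable_sq ((hg.integrable_sq.fun_add hua).fun_add (hra.const_mul 2)),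
      integral_add (hg.integrable_sq.fun_add hua) (hra.const_mul 2),
      integral_add hg.integrable_sq hua, integral_const_mul, ha1] at hs1
    linarith
  have hquad : ∫ x, (u x / 2 + r x) ^ 2 ∂μ ≤ (∫ x, u x ^ 2 ∂μ) / 2 + 2 * ∫ x, r x ^ 2 ∂μ := by
    rw [← integral_div, ← integral_const_mul,
      ← integral_add (hu.integrable_sq.div_const 2) (hr.integrable_sq.const_mul 2)]
    refine integral_mono hg.integrable_sq
      ((hu.integrable_sq.div_const 2).fun_add (hr.integrable_sq.const_mul 2)) fun x => ?_
    linarith [sq_nonneg (u x / 2 - r x)]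
  have hcross : |∫ x, r x * a x ∂μ| ≤ √(∫ x, r x ^ 2 ∂μ) := by
    refine abs_integral_le_integral_abs.trans ((integral_abs_mul_le_sqrt_mul_sqrt hr ha).trans ?_)
    rw [ha1, Real.sqrt_one, mul_one]
  have hquad0 : 0 ≤ ∫ x, (u x / 2 + r x) ^ 2 ∂μ := integral_nonneg fun x => sq_nonneg _
  rw [abs_le] at hcross ⊢
  constructor <;> linarith [hcross.1, hcross.2]

/-- A dominated model that is differentiable in quadratic mean, with score `s`, at the interior
point `θ₀` of the parameter set: the regularity assumptions of the theorem, bundled. -/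
structure IsRegularModel {m : ℕ} {𝒵 : Type*} [MeasurableSpace 𝒵] (μ : Measure 𝒵)
    (Θ : Set (EuclideanSpace ℝ (Fin m))) (p : EuclideanSpace ℝ (Fin m) → 𝒵 → ℝ)
    (θ₀ : EuclideanSpace ℝ (Fin m)) (s : 𝒵 → EuclideanSpace ℝ (Fin m)) : Prop where
  density : IsDensityFamily μ Θ p
  mem_interior : θ₀ ∈ interior Θ
  dqm : IsDQM μ p θ₀ s

section Density

variable {m : ℕ} {𝒵 : Type*} [MeasurableSpace 𝒵] {μ : Measure 𝒵}
  {Θ : Set (EuclideanSpace ℝ (Fin m))} {p : EuclideanSpace ℝ (Fin m) → 𝒵 → ℝ}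
  {θ : EuclideanSpace ℝ (Fin m)}

lemma IsDensityFamily.isProbabilityMeasure (hp : IsDensityFamily μ Θ p) (hθ : θ ∈ Θ) :
    IsProbabilityMeasure (obsLaw μ p θ) :=
  ⟨by rw [obsLaw, withDensity_apply _ MeasurableSet.univ, Measure.restrict_univ,
    hp.lintegral_eq_one θ hθ]⟩

lemma IsDensityFamily.integral_obsLaw (hp : IsDensityFamily μ Θ p) (hθ : θ ∈ Θ) (f : 𝒵 → ℝ) :
    ∫ z, f z ∂(obsLaw μ p θ) = ∫ z, f z * p θ z ∂μ :=
  integral_withDensity_ofReal μ (hp.measurable θ hθ) (hp.nonneg θ hθ) f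

lemma IsDensityFamily.integrable_obsLaw_iff (hp : IsDensityFamily μ Θ p) (hθ : θ ∈ Θ)
    {f : 𝒵 → ℝ} : Integrable f (obsLaw μ p θ) ↔ Integrable (fun z => f z * p θ z) μ := by
  rw [obsLaw, integrable_withDensity_iff_integrable_smul'
    (hp.measurable θ hθ).ennreal_ofReal (by simp)]
  simp only [ENNReal.toReal_ofReal (hp.nonneg θ hθ _), smul_eq_mul, mul_comm]

lemma IsDensityFamily.integrable (hp : IsDensityFamily μ Θ p) (hθ : θ ∈ Θ) :
    Integrable (p θ) μ := by
  refine ⟨(hp.measurable θ hθ).aestronglyMeasurable, ?_⟩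
  rw [hasFiniteIntegral_iff_ofReal (ae_of_all _ (hp.nonneg θ hθ)), hp.lintegral_eq_one θ hθ]
  exact ENNReal.one_lt_top

lemma IsDensityFamily.integral_eq_one (hp : IsDensityFamily μ Θ p) (hθ : θ ∈ Θ) :
    ∫ z, p θ z ∂μ = 1 := by
  rw [integral_eq_lintegral_of_nonneg_ae (ae_of_all _ (hp.nonneg θ hθ))
    (hp.measurable θ hθ).aestronglyMeasurable, hp.lintegral_eq_one θ hθ]
  rfl

lemma IsDensityFamily.memLp_sqrt (hp : IsDensityFamily μ Θ p) (hθ : θ ∈ Θ) :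
    MemLp (fun z => √(p θ z)) 2 μ :=
  memLp_two_sqrt (hp.nonneg θ hθ) (hp.integrable hθ)

end Density

section RegularModel

variable {m : ℕ} {𝒵 : Type*} [MeasurableSpace 𝒵] {μ : Measure 𝒵}
  {Θ : Set (EuclideanSpace ℝ (Fin m))} {p : EuclideanSpace ℝ (Fin m) → 𝒵 → ℝ}
  {θ₀ : EuclideanSpace ℝ (Fin m)} {s : 𝒵 → EuclideanSpace ℝ (Fin m)}

lemma IsRegularModel.mem (hM : IsRegularModel μ Θ p θ₀ s) : θ₀ ∈ Θ :=
  interior_subset hM.mem_interior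

lemma IsRegularModel.measurable_inner (hM : IsRegularModel μ Θ p θ₀ s)
    (h : EuclideanSpace ℝ (Fin m)) : Measurable fun z => inner ℝ h (s z) :=
  (continuous_const.inner continuous_id).measurable.comp hM.dqm.measurable_score

lemma IsRegularModel.measurable_remainder (hM : IsRegularModel μ Θ p θ₀ s)
    {h : EuclideanSpace ℝ (Fin m)} (hh : θ₀ + h ∈ Θ) : Measurable (dqmRemainder p θ₀ s h) := by
  have h1 := hM.density.measurable _ hh
  have h2 := hM.density.measurable _ hM.mem
  have h3 := hM.measurable_inner h
  unfold dqmRemainder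
  fun_prop

lemma IsRegularModel.eventually_mem (hM : IsRegularModel μ Θ p θ₀ s) :
    ∀ᶠ h in 𝓝 0, θ₀ + h ∈ Θ := by
  have : Tendsto (fun h => θ₀ + h) (𝓝 0) (𝓝 θ₀) := by
    simpa using (continuous_const.add continuous_id).tendsto (0 : EuclideanSpace ℝ (Fin m))
      (f := fun h => θ₀ + h)
  exact this.eventually (mem_interior_iff_mem_nhds.1 hM.mem_interior)

lemma IsRegularModel.eventually_memLp (hM : IsRegularModel μ Θ p θ₀ s) :
    ∀ᶠ h in 𝓝 0, θ₀ + h ∈ Θ ∧ MemLp (dqmRemainder p θ₀ s h) 2 μ := by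
  filter_upwards [hM.eventually_mem, hM.dqm.integrable] with h h1 h2
  exact ⟨h1, (memLp_two_iff_integrable_sq (hM.measurable_remainder h1).aestronglyMeasurable).2 h2⟩

lemma IsRegularModel.memLp_inner_mul_sqrt (hM : IsRegularModel μ Θ p θ₀ s)
    (h : EuclideanSpace ℝ (Fin m)) :
    MemLp (fun z => inner ℝ h (s z) * √(p θ₀ z)) 2 μ := by
  have ht : Tendsto (fun c : ℝ => c • h) (𝓝[>] 0) (𝓝 0) := by
    have : Tendsto (fun c : ℝ => c • h) (𝓝 0) (𝓝 ((0 : ℝ) • h)) :=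
      (continuous_id.smul continuous_const).tendsto (0 : ℝ)
    rw [zero_smul] at this
    exact this.mono_left nhdsWithin_le_nhds
  obtain ⟨c, ⟨hc1, hc2⟩, hc0⟩ :=
    ((ht.eventually hM.eventually_memLp).and self_mem_nhdsWithin).exists
  have hc : c ≠ 0 := ne_of_gt hc0
  have h1 := ((hM.density.memLp_sqrt hc1).sub (hM.density.memLp_sqrt hM.mem)).sub hc2
  have h2 := h1.const_mul (2 / c)
  refine h2.congr_norm ?_ (ae_of_all _ fun z => ?_)
  · exact ((hM.measurable_inner h).mul
      (hM.density.measurable _ hM.mem).sqrt).aestronglyMeasurable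
  · congr 1
    simp only [Pi.sub_apply, dqmRemainder, inner_smul_left, RCLike.conj_to_real]
    field_simp
    ring

lemma IsRegularModel.memLp_inner (hM : IsRegularModel μ Θ p θ₀ s)
    (h : EuclideanSpace ℝ (Fin m)) :
    MemLp (fun z => inner ℝ h (s z)) 2 (obsLaw μ p θ₀) := by
  refine (memLp_two_iff_integrable_sq (hM.measurable_inner h).aestronglyMeasurable).2 ?_
  rw [hM.density.integrable_obsLaw_iff hM.mem]
  simpa only [mul_pow, Real.sq_sqrt (hM.density.nonneg _ hM.mem _)] using
    (hM.memLp_inner_mul_sqrt h).integrable_sq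

lemma IsRegularModel.memLp_score (hM : IsRegularModel μ Θ p θ₀ s) :
    MemLp s 2 (obsLaw μ p θ₀) := by
  rw [← memLp_norm_iff hM.dqm.measurable_score.aestronglyMeasurable]
  refine (memLp_two_iff_integrable_sq hM.dqm.measurable_score.norm.aestronglyMeasurable).2 ?_
  simp_rw [EuclideanSpace.real_norm_sq_eq]
  refine integrable_finsetSum _ fun i _ => ?_
  refine (hM.memLp_inner (EuclideanSpace.single i 1)).integrable_sq.congr
    (ae_of_all _ fun z => ?_)
  simp [EuclideanSpace.inner_single_left]

lemma IsRegularModel.tendsto_remainder (hM : IsRegularModel μ Θ p θ₀ s)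
    (h : EuclideanSpace ℝ (Fin m)) :
    Tendsto (fun n : ℕ => (n : ℝ) * ∫ z, dqmRemainder p θ₀ s ((√(n : ℝ))⁻¹ • h) z ^ 2 ∂μ) atTop
      (𝓝 0) := by
  have h1 := hM.dqm.isLittleO.comp_tendsto (tendsto_inv_sqrt_nat_smul h)
  have h2 : (fun n : ℕ => ‖(√(n : ℝ))⁻¹ • h‖ ^ 2) =O[atTop] fun n : ℕ => (n : ℝ)⁻¹ := by
    refine Asymptotics.IsBigO.of_bound (‖h‖ ^ 2) (Eventually.of_forall fun n => ?_)
    rw [Real.norm_of_nonneg (by positivity), Real.norm_of_nonneg (by positivity), norm_smul,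
      mul_pow, norm_inv, inv_pow, Real.norm_eq_abs, sq_abs, Real.sq_sqrt (Nat.cast_nonneg n),
      mul_comm]
  have h3 := h1.trans_isBigO h2
  rw [Asymptotics.isLittleO_iff_tendsto'] at h3
  · refine h3.congr fun n => ?_
    simp only [Function.comp_apply, div_inv_eq_mul, mul_comm]
  · filter_upwards [eventually_ne_atTop 0] with n hn h0
    exact absurd (inv_eq_zero.1 h0) (by exact_mod_cast hn)

lemma IsRegularModel.eventually_memLp_local (hM : IsRegularModel μ Θ p θ₀ s)
    (h : EuclideanSpace ℝ (Fin m)) :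
    ∀ᶠ n : ℕ in atTop, localParam θ₀ h n ∈ Θ ∧
      MemLp (dqmRemainder p θ₀ s ((√(n : ℝ))⁻¹ • h)) 2 μ :=
  (tendsto_inv_sqrt_nat_smul h).eventually hM.eventually_memLp

lemma IsRegularModel.abs_integral_inner_le (hM : IsRegularModel μ Θ p θ₀ s)
    {h : EuclideanSpace ℝ (Fin m)} (hh : θ₀ + h ∈ Θ) (hr : MemLp (dqmRemainder p θ₀ s h) 2 μ) :
    |∫ z, inner ℝ h (s z) ∂(obsLaw μ p θ₀)| ≤
      (∫ z, inner ℝ h (s z) ^ 2 ∂(obsLaw μ p θ₀)) / 2 +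
        2 * ∫ z, dqmRemainder p θ₀ s h z ^ 2 ∂μ + 2 * √(∫ z, dqmRemainder p θ₀ s h z ^ 2 ∂μ) := by
  have hp0 := hM.density.nonneg _ hM.mem
  have hsqrt (z : 𝒵) : √(p θ₀ z) + (inner ℝ h (s z) * √(p θ₀ z) / 2 + dqmRemainder p θ₀ s h z) =
      √(p (θ₀ + h) z) := by
    unfold dqmRemainder
    ring
  have hbound := abs_integral_mul_le_of_integral_sq_eq_one (hM.density.memLp_sqrt hM.mem)
    (hM.memLp_inner_mul_sqrt h) hr
    (by simpa only [Real.sq_sqrt (hp0 _)] using hM.density.integral_eq_one hM.mem)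
    (by simpa only [hsqrt, Real.sq_sqrt (hM.density.nonneg _ hh _)] using
      hM.density.integral_eq_one hh)
  simpa only [hM.density.integral_obsLaw hM.mem, mul_assoc, mul_pow, Real.mul_self_sqrt (hp0 _),
    Real.sq_sqrt (hp0 _)] using hbound

lemma IsRegularModel.integral_inner_eq_zero (hM : IsRegularModel μ Θ p θ₀ s)
    (h : EuclideanSpace ℝ (Fin m)) : ∫ z, inner ℝ h (s z) ∂(obsLaw μ p θ₀) = 0 := by
  set q : ℕ → ℝ := fun n => ∫ z, dqmRemainder p θ₀ s ((√(n : ℝ))⁻¹ • h) z ^ 2 ∂μ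
  set J := ∫ z, inner ℝ h (s z) ^ 2 ∂(obsLaw μ p θ₀)
  set e := ∫ z, inner ℝ h (s z) ∂(obsLaw μ p θ₀)
  have hrem : Tendsto (fun n : ℕ => n * q n) atTop (𝓝 0) := hM.tendsto_remainder h
  have hle : ∀ᶠ n : ℕ in atTop,
      |e| ≤ J / 2 * (√n)⁻¹ + 2 * (n * q n) * (√n)⁻¹ + 2 * √(n * q n) := by
    filter_upwards [hM.eventually_memLp_local h, eventually_gt_atTop 0] with n ⟨hmem, hL2⟩ hn
    have hn' : (0 : ℝ) < √n := Real.sqrt_pos.2 (by exact_mod_cast hn)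
    have hbound := hM.abs_integral_inner_le hmem hL2
    simp only [real_inner_smul_left, mul_pow, integral_const_mul, abs_mul,
      abs_of_pos (inv_pos.2 hn')] at hbound
    rw [inv_mul_le_iff₀ hn'] at hbound
    change |e| ≤ √n * ((√n)⁻¹ ^ 2 * J / 2 + 2 * q n + 2 * √(q n)) at hbound
    refine hbound.trans_eq ?_
    rw [Real.sqrt_mul (Nat.cast_nonneg n)]
    generalize q n = y
    field_simp
    rw [Real.sq_sqrt (Nat.cast_nonneg n)]
    ring
  have hlim := ((tendsto_inv_sqrt_nat.const_mul (J / 2)).add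
    ((hrem.const_mul 2).mul tendsto_inv_sqrt_nat)).add (hrem.sqrt.const_mul 2)
  simp only [mul_zero, add_zero, Real.sqrt_zero] at hlim
  exact abs_nonpos_iff.1 (ge_of_tendsto hlim hle)

end RegularModel

section Truncation

variable {m : ℕ} {Z : Type*}

/-- The score `s`, set to `0` where its norm exceeds `n ^ (1 / 4)`. This level tends to infinity, so
the truncation is asymptotically negligible, but it is of smaller order than `√n`, so
`truncScore s n / √n` is uniformly small. -/
noncomputable def truncScore (s : Z → EuclideanSpace ℝ (Fin m)) (n : ℕ) :
    Z → EuclideanSpace ℝ (Fin m) := {z | ‖s z‖ ≤ √√(n : ℝ)}.indicator s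

variable {s : Z → EuclideanSpace ℝ (Fin m)}

lemma norm_truncScore_le (n : ℕ) (z : Z) : ‖truncScore s n z‖ ≤ √√(n : ℝ) := by
  unfold truncScore
  by_cases h : ‖s z‖ ≤ √√(n : ℝ)
  · rwa [Set.indicator_of_mem (by exact h)]
  · rw [Set.indicator_of_notMem (by exact h), norm_zero]
    positivity

lemma tendsto_sqrt_sqrt_nat : Tendsto (fun n : ℕ => √√(n : ℝ)) atTop atTop :=
  Real.tendsto_sqrt_atTop.comp (Real.tendsto_sqrt_atTop.comp tendsto_natCast_atTop_atTop)

lemma tendsto_truncScore (z : Z) : Tendsto (fun n => truncScore s n z) atTop (𝓝 (s z)) := by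
  refine tendsto_nhds_of_eventually_eq ?_
  filter_upwards [tendsto_sqrt_sqrt_nat.eventually_ge_atTop ‖s z‖] with n hn
  exact Set.indicator_of_mem (s := {z | ‖s z‖ ≤ √√(n : ℝ)}) hn s

variable [MeasurableSpace Z]

lemma measurable_truncScore (hs : Measurable s) (n : ℕ) : Measurable (truncScore s n) :=
  hs.indicator (measurableSet_le hs.norm measurable_const)

/-- The truncated score, centred under `P`. -/
noncomputable def centredScore (P : Measure Z) (s : Z → EuclideanSpace ℝ (Fin m)) (n : ℕ) (z : Z) :
    EuclideanSpace ℝ (Fin m) := truncScore s n z - ∫ w, truncScore s n w ∂P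

lemma measurable_centredScore (P : Measure Z) (hs : Measurable s) (n : ℕ) :
    Measurable (centredScore P s n) := (measurable_truncScore hs n).sub measurable_const

lemma norm_centredScore_le_norm_add {P : Measure Z} (hs : Integrable s P) (n : ℕ) (z : Z) :
    ‖centredScore P s n z‖ ≤ ‖s z‖ + ∫ w, ‖s w‖ ∂P :=
  (norm_sub_le _ _).trans <| add_le_add (norm_indicator_le_norm_self _ _) <|
    norm_integral_le_of_norm_le hs.norm (ae_of_all _ fun _ => norm_indicator_le_norm_self _ _)

lemma tendsto_centredScore {P : Measure Z} (hsm : Measurable s) (hs : Integrable s P)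
    (hs0 : ∫ z, s z ∂P = 0) (z : Z) :
    Tendsto (fun n => centredScore P s n z) atTop (𝓝 (s z)) := by
  have hmean : Tendsto (fun n => ∫ w, truncScore s n w ∂P) atTop (𝓝 (∫ w, s w ∂P)) :=
    tendsto_integral_of_dominated_convergence (fun w => ‖s w‖)
      (fun n => (measurable_truncScore hsm n).aestronglyMeasurable) hs.norm
      (fun n => ae_of_all _ fun _ => norm_indicator_le_norm_self _ _)
      (ae_of_all _ tendsto_truncScore)
  simpa only [centredScore, hs0, sub_zero] using (tendsto_truncScore z).sub hmean

variable {P : Measure Z} [IsProbabilityMeasure P]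

lemma norm_centredScore_le (n : ℕ) (z : Z) : ‖centredScore P s n z‖ ≤ 2 * √√(n : ℝ) := by
  have hmean : ‖∫ w, truncScore s n w ∂P‖ ≤ √√(n : ℝ) := by
    simpa using norm_integral_le_of_norm_le_const (μ := P) (ae_of_all _ (norm_truncScore_le n))
  rw [two_mul]
  exact (norm_sub_le _ _).trans (add_le_add (norm_truncScore_le n z) hmean)

lemma abs_inner_centredScore_le (h : EuclideanSpace ℝ (Fin m)) (n : ℕ) (z : Z) :
    |inner ℝ h (centredScore P s n z)| ≤ ‖h‖ * (2 * √√(n : ℝ)) :=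
  (abs_real_inner_le_norm _ _).trans (by gcongr; exact norm_centredScore_le n z)

lemma integral_inner_centredScore (hs : Measurable s) (h : EuclideanSpace ℝ (Fin m)) (n : ℕ) :
    ∫ z, inner ℝ h (centredScore P s n z) ∂P = 0 := by
  have hmean : ∫ z, centredScore P s n z ∂P = 0 := by
    simpa only [centredScore, average_eq_integral] using integral_sub_average P (truncScore s n)
  rw [integral_inner (.of_bound (measurable_centredScore P hs n).aestronglyMeasurable _
    (ae_of_all _ (norm_centredScore_le n))), hmean, inner_zero_right]

lemma integrable_sq_mul_norm_add (hs : MemLp s 2 P) (c d : ℝ) :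
    Integrable (fun z => (c * (‖s z‖ + d)) ^ 2) P :=
  ((hs.norm.add (memLp_const d)).const_mul c).integrable_sq

lemma tendsto_integral_sq_inner_centredScore (hsm : Measurable s) (hs : MemLp s 2 P)
    (hs0 : ∫ z, s z ∂P = 0) (h : EuclideanSpace ℝ (Fin m)) :
    Tendsto (fun n => ∫ z, inner ℝ h (centredScore P s n z) ^ 2 ∂P) atTop
      (𝓝 (∫ z, inner ℝ h (s z) ^ 2 ∂P)) := by
  have hs1 : Integrable s P := hs.integrable one_le_two
  refine tendsto_integral_of_dominated_convergence
    (fun z => (‖h‖ * (‖s z‖ + ∫ w, ‖s w‖ ∂P)) ^ 2) (fun n => ?_)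
    (integrable_sq_mul_norm_add hs _ _) (fun n => ae_of_all _ fun z => ?_)
    (ae_of_all _ fun z => (tendsto_const_nhds.inner (tendsto_centredScore hsm hs1 hs0 z)).pow 2)
  · have := measurable_centredScore P hsm n
    exact Measurable.aestronglyMeasurable (by fun_prop)
  · rw [norm_pow]
    gcongr
    exact (norm_inner_le_norm _ _).trans (by gcongr; exact norm_centredScore_le_norm_add hs1 n z)

lemma tendsto_integral_sq_inner_sub_centredScore (hsm : Measurable s) (hs : MemLp s 2 P)
    (hs0 : ∫ z, s z ∂P = 0) (h : EuclideanSpace ℝ (Fin m)) :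
    Tendsto (fun n => ∫ z, inner ℝ h (s z - centredScore P s n z) ^ 2 ∂P) atTop (𝓝 0) := by
  have hs1 : Integrable s P := hs.integrable one_le_two
  rw [← integral_zero Z ℝ (μ := P)]
  refine tendsto_integral_of_dominated_convergence
    (fun z => (‖h‖ * 2 * (‖s z‖ + ∫ w, ‖s w‖ ∂P)) ^ 2) (fun n => ?_)
    (integrable_sq_mul_norm_add hs _ _) (fun n => ae_of_all _ fun z => ?_)
    (ae_of_all _ fun z => ?_)
  · have := measurable_centredScore P hsm n
    exact Measurable.aestronglyMeasurable (by fun_prop)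
  · have hK : 0 ≤ ∫ w, ‖s w‖ ∂P := integral_nonneg fun _ => norm_nonneg _
    rw [norm_pow, mul_assoc]
    gcongr
    refine (norm_inner_le_norm _ _).trans ?_
    gcongr
    linarith [norm_sub_le (s z) (centredScore P s n z), norm_centredScore_le_norm_add hs1 n z]
  · have hsub : Tendsto (fun n => s z - centredScore P s n z) atTop (𝓝 (s z - s z)) :=
      tendsto_const_nhds.sub (tendsto_centredScore hsm hs1 hs0 z)
    simpa using (Tendsto.inner (𝕜 := ℝ) (tendsto_const_nhds (x := h)) hsub).pow 2

/-- The contributions `⟨h, s⟩ / √n` of single observations to the local score statistic in the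
direction `h`, with the score truncated and recentred. -/
noncomputable def scoreArray (P : Measure Z) (s : Z → EuclideanSpace ℝ (Fin m))
    (h : EuclideanSpace ℝ (Fin m)) (n : ℕ) (z : Z) : ℝ :=
  (√(n : ℝ))⁻¹ * inner ℝ h (centredScore P s n z)

lemma isSmallArray_scoreArray (hsm : Measurable s) (hs : MemLp s 2 P) (hs0 : ∫ z, s z ∂P = 0)
    (h : EuclideanSpace ℝ (Fin m)) :
    IsSmallArray P (scoreArray P s h) (fun n => 2 * ‖h‖ * (√√(n : ℝ))⁻¹)
      (∫ z, inner ℝ h (s z) ^ 2 ∂P) where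
  measurable n := by
    have := measurable_centredScore P hsm n
    unfold scoreArray
    fun_prop
  tendsto_bound := by
    simpa using (tendsto_inv_atTop_zero.comp tendsto_sqrt_sqrt_nat).const_mul (2 * ‖h‖)
  abs_le_bound n z := by
    have hroot : √√(n : ℝ) / √(n : ℝ) = (√√(n : ℝ))⁻¹ := Real.sqrt_div_self
    rw [scoreArray, abs_mul, abs_of_nonneg (by positivity)]
    calc (√(n : ℝ))⁻¹ * |inner ℝ h (centredScore P s n z)|
        ≤ (√(n : ℝ))⁻¹ * (‖h‖ * (2 * √√(n : ℝ))) := by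
          gcongr
          exact abs_inner_centredScore_le h n z
      _ = 2 * ‖h‖ * (√√(n : ℝ) / √(n : ℝ)) := by ring
      _ = 2 * ‖h‖ * (√√(n : ℝ))⁻¹ := by rw [hroot]
  integral_eq_zero n := by
    simp only [scoreArray, integral_const_mul, integral_inner_centredScore hsm, mul_zero]
  tendsto_variance := by
    refine (tendsto_integral_sq_inner_centredScore hsm hs hs0 h).congr' ?_
    filter_upwards [eventually_gt_atTop 0] with n hn
    have hn' : (n : ℝ) ≠ 0 := by exact_mod_cast hn.ne'
    simp only [scoreArray, mul_pow, integral_const_mul, inv_pow, Real.sq_sqrt (Nat.cast_nonneg n)]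
    rw [mul_inv_cancel_left₀ hn']

end Truncation

section Likelihood

lemma sq_one_add_half_sub_sqrt_le {x : ℝ} (hx : -1 ≤ x) :
    (1 + x / 2 - √(1 + x)) ^ 2 ≤ x ^ 4 := by
  set y := √(1 + x)
  have hy0 : 0 ≤ y := Real.sqrt_nonneg _
  have hy2 : y ^ 2 = 1 + x := Real.sq_sqrt (by linarith)
  have hleft : 1 + x / 2 - y = (y - 1) ^ 2 / 2 := by linear_combination (-1 / 2) * hy2
  have hright : x = (y - 1) * (y + 1) := by linear_combination (-1) * hy2
  have hle : (y - 1) ^ 2 ≤ x ^ 2 := by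
    rw [hright, mul_pow]
    exact le_mul_of_one_le_right (sq_nonneg _) (by nlinarith)
  calc (1 + x / 2 - y) ^ 2 = ((y - 1) ^ 2) ^ 2 / 4 := by rw [hleft]; ring
    _ ≤ ((y - 1) ^ 2) ^ 2 := div_le_self (sq_nonneg _) (by norm_num)
    _ ≤ (x ^ 2) ^ 2 := by gcongr
    _ = x ^ 4 := by ring

variable {m : ℕ} {𝒵 : Type*} [MeasurableSpace 𝒵] {μ : Measure 𝒵}
  {Θ : Set (EuclideanSpace ℝ (Fin m))} {p : EuclideanSpace ℝ (Fin m) → 𝒵 → ℝ}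
  {θ₀ : EuclideanSpace ℝ (Fin m)} {s : 𝒵 → EuclideanSpace ℝ (Fin m)}

omit [MeasurableSpace 𝒵] in
lemma sq_sqrt_sub_sqrt_mul_one_add_le {h : EuclideanSpace ℝ (Fin m)} {z : 𝒵} (hp : 0 ≤ p θ₀ z)
    {x ε : ℝ} (hx : |x| ≤ ε) (hε : ε ≤ 1) :
    (√(p (θ₀ + h) z) - √(p θ₀ z * (1 + x))) ^ 2 ≤
      3 * dqmRemainder p θ₀ s h z ^ 2 + (inner ℝ h (s z) - x) ^ 2 * p θ₀ z +
        3 * ε ^ 2 * (x ^ 2 * p θ₀ z) := by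
  set a := √(p θ₀ z) with ha
  set r := dqmRemainder p θ₀ s h z with hr
  have ha2 : p θ₀ z = a ^ 2 := (Real.sq_sqrt hp).symm
  have hsplit : √(p (θ₀ + h) z) - √(p θ₀ z * (1 + x)) =
      r + a * ((inner ℝ h (s z) - x) / 2) + a * (1 + x / 2 - √(1 + x)) := by
    rw [hr, dqmRemainder, Real.sqrt_mul hp, ← ha]
    ring
  have hthree (b c d : ℝ) : (b + c + d) ^ 2 ≤ 3 * (b ^ 2 + c ^ 2 + d ^ 2) := by
    linarith [sq_nonneg (b - c), sq_nonneg (b - d), sq_nonneg (c - d)]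
  have hsqrt : (1 + x / 2 - √(1 + x)) ^ 2 ≤ ε ^ 2 * x ^ 2 :=
    calc _ ≤ x ^ 4 := sq_one_add_half_sub_sqrt_le (by linarith [(abs_le.1 hx).1])
      _ = x ^ 2 * x ^ 2 := by ring
      _ ≤ ε ^ 2 * x ^ 2 := by
        gcongr ?_ * _
        exact sq_le_sq' (abs_le.1 hx).1 (abs_le.1 hx).2
  rw [hsplit]
  refine (hthree _ _ _).trans ?_
  rw [mul_pow a, mul_pow a, ha2]
  linarith [mul_le_mul_of_nonneg_left hsqrt (sq_nonneg a),
    mul_nonneg (sq_nonneg (inner ℝ h (s z) - x)) (sq_nonneg a)]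

lemma IsRegularModel.isProbabilityMeasure (hM : IsRegularModel μ Θ p θ₀ s) :
    IsProbabilityMeasure (obsLaw μ p θ₀) := hM.density.isProbabilityMeasure hM.mem

lemma IsRegularModel.integral_score (hM : IsRegularModel μ Θ p θ₀ s) :
    ∫ z, s z ∂(obsLaw μ p θ₀) = 0 := by
  have := hM.isProbabilityMeasure
  refine ext_inner_left ℝ fun h => ?_
  rw [← integral_inner (hM.memLp_score.integrable one_le_two), hM.integral_inner_eq_zero,
    inner_zero_right]

lemma IsRegularModel.isSmallArray (hM : IsRegularModel μ Θ p θ₀ s)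
    (h : EuclideanSpace ℝ (Fin m)) :
    IsSmallArray (obsLaw μ p θ₀) (scoreArray (obsLaw μ p θ₀) s h)
      (fun n => 2 * ‖h‖ * (√√(n : ℝ))⁻¹) (∫ z, inner ℝ h (s z) ^ 2 ∂(obsLaw μ p θ₀)) := by
  have := hM.isProbabilityMeasure
  exact isSmallArray_scoreArray hM.dqm.measurable_score hM.memLp_score hM.integral_score h

lemma IsRegularModel.integral_mul_one_add (hM : IsRegularModel μ Θ p θ₀ s) {X : 𝒵 → ℝ}
    (hX : Integrable X (obsLaw μ p θ₀)) (hX0 : ∫ z, X z ∂(obsLaw μ p θ₀) = 0) :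
    ∫ z, p θ₀ z * (1 + X z) ∂μ = 1 := by
  have := hM.isProbabilityMeasure
  simp_rw [mul_comm (p θ₀ _)]
  rw [← hM.density.integral_obsLaw hM.mem, integral_add (integrable_const 1) hX, hX0]
  simp

lemma IsRegularModel.two_mul_one_sub_affinity_le (hM : IsRegularModel μ Θ p θ₀ s)
    {h : EuclideanSpace ℝ (Fin m)} (hh : θ₀ + h ∈ Θ) (hr : MemLp (dqmRemainder p θ₀ s h) 2 μ)
    {X : 𝒵 → ℝ} (hXm : Measurable X) {ε : ℝ} (hX : ∀ z, |X z| ≤ ε) (hε : ε ≤ 1)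
    (hX0 : ∫ z, X z ∂(obsLaw μ p θ₀) = 0) :
    2 * (1 - ∫ z, √(p (θ₀ + h) z) * √(p θ₀ z * (1 + X z)) ∂μ) ≤
      3 * ∫ z, dqmRemainder p θ₀ s h z ^ 2 ∂μ +
        ∫ z, (inner ℝ h (s z) - X z) ^ 2 ∂(obsLaw μ p θ₀) +
        3 * ε ^ 2 * ∫ z, X z ^ 2 ∂(obsLaw μ p θ₀) := by
  have := hM.isProbabilityMeasure
  have hp0 := hM.density.nonneg _ hM.mem
  have hXL : MemLp X 2 (obsLaw μ p θ₀) := .of_bound hXm.aestronglyMeasurable ε (ae_of_all _ hX)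
  have hX1 (z : 𝒵) : 0 ≤ 1 + X z := by linarith [(abs_le.1 (hX z)).1]
  have hr2 := hr.integrable_sq.const_mul 3
  have hD2 := (hM.density.integrable_obsLaw_iff hM.mem).1 ((hM.memLp_inner h).sub hXL).integrable_sq
  have hX2 := ((hM.density.integrable_obsLaw_iff hM.mem).1 hXL.integrable_sq).const_mul (3 * ε ^ 2)
  rw [two_mul_one_sub_integral_sqrt_mul_sqrt (hM.density.nonneg _ hh)
    (fun z => mul_nonneg (hp0 z) (hX1 z)) (hM.density.integral_eq_one hh)
    (hM.integral_mul_one_add (hXL.integrable one_le_two) hX0)]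
  simp only [hM.density.integral_obsLaw hM.mem, ← integral_const_mul]
  simp only [Pi.sub_apply] at hD2
  rw [← integral_add hr2 hD2, ← integral_add (hr2.fun_add hD2) hX2]
  exact integral_mono_of_nonneg (ae_of_all _ fun z => sq_nonneg _) ((hr2.fun_add hD2).fun_add hX2)
    (ae_of_all _ fun z => sq_sqrt_sub_sqrt_mul_one_add_le (hp0 z) (hX z) hε)

lemma IsRegularModel.abs_integral_sampleLaw_sub_le (hM : IsRegularModel μ Θ p θ₀ s)
    {θ : EuclideanSpace ℝ (Fin m)} (hθ : θ ∈ Θ) {X : 𝒵 → ℝ} (hXm : Measurable X)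
    (hX : ∀ z, |X z| ≤ 1) (hX0 : ∫ z, X z ∂(obsLaw μ p θ₀) = 0) {n : ℕ} {φ : (Fin n → 𝒵) → ℝ}
    (hφm : Measurable φ) {C : ℝ} (hφ : ∀ z, |φ z| ≤ C) :
    |∫ z, φ z ∂(sampleLaw μ p θ n) - ∫ z, φ z * ∏ i, (1 + X (z i)) ∂(sampleLaw μ p θ₀ n)| ≤
      C * (2 * √(n * (2 * (1 - ∫ z, √(p θ z) * √(p θ₀ z * (1 + X z)) ∂μ)))) := by
  have := hM.isProbabilityMeasure
  have hp0 := hM.density.nonneg _ hM.mem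
  have hp0m := hM.density.measurable _ hM.mem
  have hXi : Integrable X (obsLaw μ p θ₀) :=
    .of_bound hXm.aestronglyMeasurable 1 (ae_of_all _ hX)
  have hX1 (z : 𝒵) : 0 ≤ 1 + X z := by linarith [(abs_le.1 (hX z)).1]
  have h1X : ∫ z, (1 + X z) ∂(obsLaw μ p θ₀) = 1 := by
    rw [integral_add (integrable_const 1) hXi, hX0]
    simp
  have htilt : (obsLaw μ p θ₀).withDensity (fun z => ENNReal.ofReal (1 + X z)) =
      μ.withDensity fun z => ENNReal.ofReal (p θ₀ z * (1 + X z)) := by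
    simp only [ENNReal.ofReal_mul (hp0 _)]
    exact (withDensity_mul μ hp0m.ennreal_ofReal (by fun_prop)).symm
  have hbound := abs_integral_pi_withDensity_sub_le (ι := Fin n) μ (hM.density.measurable _ hθ)
    (hp0m.mul (hXm.const_add 1)) (hM.density.nonneg _ hθ)
    (fun z => mul_nonneg (hp0 z) (hX1 z)) (hM.density.integral_eq_one hθ)
    (hM.integral_mul_one_add hXi hX0) hφm hφ
  simp only [Pi.mul_apply] at hbound
  rw [← htilt, integral_pi_withDensity_ofReal _ (hXm.const_add 1) hX1 h1X, Fintype.card_fin,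
    mul_left_comm (2 : ℝ)] at hbound
  exact hbound

theorem IsRegularModel.tendsto_integral_sub (hM : IsRegularModel μ Θ p θ₀ s)
    (h : EuclideanSpace ℝ (Fin m)) {φ : ∀ n : ℕ, (Fin n → 𝒵) → ℝ} (hφm : ∀ n, Measurable (φ n))
    {C : ℝ} (hφ : ∀ n z, |φ n z| ≤ C) :
    Tendsto (fun n : ℕ => ∫ z, φ n z ∂(sampleLaw μ p (localParam θ₀ h n) n) -
      ∫ z, φ n z * ∏ i, (1 + scoreArray (obsLaw μ p θ₀) s h n (z i)) ∂(sampleLaw μ p θ₀ n))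
      atTop (𝓝 0) := by
  have hP := hM.isProbabilityMeasure
  have hA := hM.isSmallArray h
  set P := obsLaw μ p θ₀
  set ε : ℕ → ℝ := fun n => 2 * ‖h‖ * (√√(n : ℝ))⁻¹
  set b : ℕ → ℝ := fun n =>
    3 * (n * ∫ z, dqmRemainder p θ₀ s ((√(n : ℝ))⁻¹ • h) z ^ 2 ∂μ) +
      (∫ z, inner ℝ h (s z - centredScore P s n z) ^ 2 ∂P) +
      3 * ε n ^ 2 * (n * ∫ z, scoreArray P s h n z ^ 2 ∂P) with hb
  have hb0 : Tendsto b atTop (𝓝 0) := by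
    simpa using (((hM.tendsto_remainder h).const_mul 3).add
      (tendsto_integral_sq_inner_sub_centredScore hM.dqm.measurable_score hM.memLp_score
        hM.integral_score h)).add
      (((hA.tendsto_bound.pow 2).const_mul 3).mul hA.tendsto_variance)
  have hlim : Tendsto (fun n => C * (2 * √(b n))) atTop (𝓝 0) := by
    simpa using (hb0.sqrt.const_mul 2).const_mul C
  refine squeeze_zero_norm' ?_ hlim
  filter_upwards [hA.tendsto_bound.eventually (gt_mem_nhds one_pos), hM.eventually_memLp_local h,
    eventually_gt_atTop 0] with n hε ⟨hmem, hr⟩ hn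
  have hn' : (n : ℝ) ≠ 0 := by exact_mod_cast hn.ne'
  have hC0 : 0 ≤ C := by
    have : Nonempty 𝒵 := P.nonempty_of_neZero
    exact (abs_nonneg _).trans (hφ n fun _ => Classical.arbitrary 𝒵)
  have hX := hA.abs_le_bound n
  refine (hM.abs_integral_sampleLaw_sub_le hmem (hA.measurable n)
    (fun z => (hX z).trans hε.le) (hA.integral_eq_zero n) (hφm n) (hφ n)).trans ?_
  gcongr
  have haff := mul_le_mul_of_nonneg_left (hM.two_mul_one_sub_affinity_le hmem hr (hA.measurable n)
    hX hε.le (hA.integral_eq_zero n)) (Nat.cast_nonneg n)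
  refine haff.trans_eq ?_
  have hdiff (z : 𝒵) : inner ℝ ((√(n : ℝ))⁻¹ • h) (s z) - scoreArray P s h n z =
      (√(n : ℝ))⁻¹ * inner ℝ h (s z - centredScore P s n z) := by
    rw [scoreArray, real_inner_smul_left, inner_sub_right, mul_sub]
  simp only [hdiff, mul_pow, integral_const_mul, inv_pow, Real.sq_sqrt (Nat.cast_nonneg n), hb]
  field_simp
  rfl

end Likelihood

section TiltedLimit

lemma abs_exp_sub_min_le {y M : ℝ} (hM : 0 < M) :
    |Real.exp y - min (Real.exp y) M| ≤ Real.exp (2 * y) / M := by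
  rcases le_total (Real.exp y) M with h | h
  · rw [min_eq_left h, sub_self, abs_zero]
    positivity
  · rw [min_eq_right h, abs_of_nonneg (by linarith), le_div_iff₀ hM, two_mul, Real.exp_add]
    nlinarith [Real.exp_pos y]

lemma integrable_exp_of_integrable_exp_two_mul {X : Type*} [MeasurableSpace X] {ν : Measure X}
    [IsFiniteMeasure ν] {y : X → ℝ} (hy : Measurable y)
    (hi : Integrable (fun x => Real.exp (2 * y x)) ν) : Integrable (fun x => Real.exp (y x)) ν := by
  refine ((integrable_const (1 : ℝ)).add hi).mono' hy.exp.aestronglyMeasurable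
    (ae_of_all _ fun x => ?_)
  rw [Real.norm_eq_abs, Real.abs_exp]
  simp only [Pi.add_apply, two_mul, Real.exp_add]
  nlinarith [sq_nonneg (Real.exp (y x) - 1), Real.exp_pos (y x)]

lemma abs_integral_mul_exp_sub_le {X : Type*} [MeasurableSpace X] {ν : Measure X}
    [IsProbabilityMeasure ν] {y f : X → ℝ} (hy : Measurable y) (hf : Measurable f) {K C M : ℝ}
    (hfK : ∀ x, |f x| ≤ K) (hi : Integrable (fun x => Real.exp (2 * y x)) ν)
    (hC : ∫ x, Real.exp (2 * y x) ∂ν ≤ C) (hM : 0 < M) :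
    |∫ x, f x * Real.exp (y x) ∂ν - ∫ x, f x * min (Real.exp (y x)) M ∂ν| ≤ K * (C / M) := by
  have hK : 0 ≤ K := by
    have : Nonempty X := ν.nonempty_of_neZero
    exact (abs_nonneg _).trans (hfK (Classical.arbitrary X))
  have hexp := integrable_exp_of_integrable_exp_two_mul hy hi
  have hmin : Integrable (fun x => min (Real.exp (y x)) M) ν := hexp.inf (integrable_const M)
  rw [← integral_sub (hexp.bdd_mul hf.aestronglyMeasurable (ae_of_all _ hfK))
    (hmin.bdd_mul hf.aestronglyMeasurable (ae_of_all _ hfK)), ← Real.norm_eq_abs]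
  calc _ ≤ ∫ x, K * (Real.exp (2 * y x) / M) ∂ν := by
        refine norm_integral_le_of_norm_le ((hi.div_const M).const_mul K)
          (ae_of_all _ fun x => ?_)
        rw [← mul_sub, norm_mul]
        exact mul_le_mul (hfK x) (abs_exp_sub_min_le hM) (norm_nonneg _) hK
    _ = K * ((∫ x, Real.exp (2 * y x) ∂ν) / M) := by rw [integral_const_mul, integral_div]
    _ ≤ _ := by gcongr

lemma integrable_and_integral_le_of_forall_integral_min_le {X : Type*} [MeasurableSpace X]
    {ν : Measure X} [IsFiniteMeasure ν] {f : X → ℝ} (hf : Measurable f) (hf0 : ∀ x, 0 ≤ f x)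
    {C : ℝ} (hC : ∀ k : ℕ, ∫ x, min (f x) k ∂ν ≤ C) :
    Integrable f ν ∧ ∫ x, f x ∂ν ≤ C := by
  have hpos (k : ℕ) (x : X) : 0 ≤ min (f x) k := le_min (hf0 x) (Nat.cast_nonneg k)
  have hC0 : 0 ≤ C := (integral_nonneg (hpos 0)).trans (hC 0)
  have hint (k : ℕ) : Integrable (fun x => min (f x) k) ν :=
    .of_bound (by fun_prop) k (ae_of_all _ fun x => by
      rw [Real.norm_eq_abs, abs_of_nonneg (hpos k x)]; exact min_le_right _ _)
  have hlim : Tendsto (fun k : ℕ => ∫⁻ x, ENNReal.ofReal (min (f x) k) ∂ν) atTop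
      (𝓝 (∫⁻ x, ENNReal.ofReal (f x) ∂ν)) := by
    refine lintegral_tendsto_of_tendsto_of_monotone (fun k => by fun_prop)
      (ae_of_all _ fun x k l hkl => ENNReal.ofReal_le_ofReal <|
        min_le_min_left _ (Nat.cast_le.2 hkl)) (ae_of_all _ fun x => ?_)
    refine tendsto_nhds_of_eventually_eq ?_
    filter_upwards [(tendsto_natCast_atTop_atTop (R := ℝ)).eventually_ge_atTop (f x)] with k hk
    rw [min_eq_left hk]
  have hle : ∫⁻ x, ENNReal.ofReal (f x) ∂ν ≤ ENNReal.ofReal C := by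
    refine le_of_tendsto' hlim fun k => ?_
    rw [← ofReal_integral_eq_lintegral_ofReal (hint k) (ae_of_all _ (hpos k))]
    exact ENNReal.ofReal_le_ofReal (hC k)
  have hfi : Integrable f ν := by
    refine ⟨hf.aestronglyMeasurable, ?_⟩
    rw [hasFiniteIntegral_iff_ofReal (ae_of_all _ hf0)]
    exact hle.trans_lt ENNReal.ofReal_lt_top
  refine ⟨hfi, ?_⟩
  rwa [← ENNReal.ofReal_le_ofReal_iff hC0,
    ofReal_integral_eq_lintegral_ofReal hfi (ae_of_all _ hf0)]

lemma tendsto_integral_of_tendsto_probabilityMeasure {X ι : Type*} [TopologicalSpace X]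
    [MeasurableSpace X] [OpensMeasurableSpace X] {𝓕 : Filter ι} {ν : ι → ProbabilityMeasure X}
    {ν' : ProbabilityMeasure X} (h : Tendsto ν 𝓕 (𝓝 ν')) {f : X → ℝ} (hf : Continuous f) {K : ℝ}
    (hK : ∀ x, |f x| ≤ K) :
    Tendsto (fun n => ∫ x, f x ∂(ν n : Measure X)) 𝓕 (𝓝 (∫ x, f x ∂(ν' : Measure X))) :=
  ProbabilityMeasure.tendsto_iff_forall_integral_tendsto.1 h
    (BoundedContinuousFunction.ofNormedAddCommGroup f hf K hK)

variable {X ι : Type*} [TopologicalSpace X] [MeasurableSpace X] [BorelSpace X] {𝓕 : Filter ι}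
  [𝓕.NeBot] {ν : ι → ProbabilityMeasure X} {ν' : ProbabilityMeasure X} {y : X → ℝ} {C : ℝ}

lemma integrable_exp_of_tendsto (h : Tendsto ν 𝓕 (𝓝 ν')) (hy : Continuous y)
    (hi : ∀ᶠ n in 𝓕, Integrable (fun x => Real.exp (y x)) (ν n : Measure X) ∧
      ∫ x, Real.exp (y x) ∂(ν n : Measure X) ≤ C) :
    Integrable (fun x => Real.exp (y x)) (ν' : Measure X) ∧
      ∫ x, Real.exp (y x) ∂(ν' : Measure X) ≤ C := by
  refine integrable_and_integral_le_of_forall_integral_min_le hy.measurable.exp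
    (fun x => (Real.exp_pos _).le) fun k => ?_
  have hlim := tendsto_integral_of_tendsto_probabilityMeasure h
    (f := fun x => min (Real.exp (y x)) k) (by fun_prop) (K := k) fun x => by
      rw [abs_of_nonneg (le_min (Real.exp_pos _).le k.cast_nonneg)]
      exact min_le_right _ _
  refine le_of_tendsto hlim ?_
  filter_upwards [hi] with n hn
  exact (integral_mono (hn.1.inf (integrable_const _)) hn.1 fun x => min_le_left _ _).trans hn.2

theorem tendsto_integral_mul_exp_of_tendsto (h : Tendsto ν 𝓕 (𝓝 ν')) (hy : Continuous y)
    (hi : ∀ᶠ n in 𝓕, Integrable (fun x => Real.exp (2 * y x)) (ν n : Measure X) ∧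
      ∫ x, Real.exp (2 * y x) ∂(ν n : Measure X) ≤ C) {f : X → ℝ} (hf : Continuous f) {K : ℝ}
    (hfK : ∀ x, |f x| ≤ K) :
    Tendsto (fun n => ∫ x, f x * Real.exp (y x) ∂(ν n : Measure X)) 𝓕
      (𝓝 (∫ x, f x * Real.exp (y x) ∂(ν' : Measure X))) := by
  obtain ⟨hi', hC'⟩ := integrable_exp_of_tendsto h (hy.const_mul 2) hi
  have hlim : Tendsto (fun M : ℝ => K * (C / M)) atTop (𝓝 0) := by
    simpa using (tendsto_const_nhds.div_atTop tendsto_id (a := C)).const_mul K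
  rw [Metric.tendsto_nhds]
  intro ε hε
  obtain ⟨M, hMε, hM⟩ := ((hlim.eventually (gt_mem_nhds (show (0 : ℝ) < ε / 3 by positivity))).and
    (eventually_gt_atTop 0)).exists
  have hbd (x : X) : |f x * min (Real.exp (y x)) M| ≤ K * M := by
    rw [abs_mul, abs_of_nonneg (le_min (Real.exp_pos (y x)).le hM.le)]
    exact mul_le_mul (hfK x) (min_le_right _ _) (le_min (Real.exp_pos _).le hM.le)
      ((abs_nonneg _).trans (hfK x))
  have htrunc := tendsto_integral_of_tendsto_probabilityMeasure h
    (f := fun x => f x * min (Real.exp (y x)) M) (by fun_prop) hbd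
  filter_upwards [hi, (Metric.tendsto_nhds.1 htrunc) (ε / 3) (by positivity)] with n ⟨hn, hnC⟩ hdist
  have hleft := abs_integral_mul_exp_sub_le hy.measurable hf.measurable hfK hn hnC hM
  have hright := abs_integral_mul_exp_sub_le hy.measurable hf.measurable hfK hi' hC' hM
  rw [Real.dist_eq, abs_lt] at hdist ⊢
  rw [abs_le] at hleft hright
  constructor <;> linarith [hleft.1, hleft.2, hright.1, hright.2, hdist.1, hdist.2]

end TiltedLimit

section Tightness

lemma isTightMeasureSet_pi {κ X : Type*} [Finite κ] [TopologicalSpace X] [MeasurableSpace X]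
    {S : Set (Measure (κ → X))}
    (h : ∀ k, IsTightMeasureSet ((fun μ => Measure.map (fun x : κ → X => x k) μ) '' S)) :
    IsTightMeasureSet S := by
  have := Fintype.ofFinite κ
  simp_rw [isTightMeasureSet_iff_exists_isCompact_measure_compl_le] at h ⊢
  intro ε hε
  have hε' : 0 < ε / (Fintype.card κ + 1) := ENNReal.div_pos hε.ne' (by finiteness)
  choose K hKc hK using fun k => h k _ hε'
  refine ⟨Set.univ.pi K, isCompact_univ_pi hKc, fun μ hμ => ?_⟩
  have hsub : (Set.univ.pi K)ᶜ ⊆ ⋃ k, (fun x : κ → X => x k) ⁻¹' (K k)ᶜ := fun x hx => by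
    simpa [Set.mem_pi] using hx
  calc μ (Set.univ.pi K)ᶜ ≤ μ (⋃ k, (fun x : κ → X => x k) ⁻¹' (K k)ᶜ) := measure_mono hsub
    _ ≤ ∑ k, μ ((fun x : κ → X => x k) ⁻¹' (K k)ᶜ) := measure_iUnion_fintype_le _ _
    _ ≤ ∑ _k : κ, ε / (Fintype.card κ + 1) := Finset.sum_le_sum fun k _ =>
        (Measure.le_map_apply (measurable_pi_apply k).aemeasurable _).trans
          (hK k _ ⟨μ, hμ, rfl⟩)
    _ = Fintype.card κ * (ε / (Fintype.card κ + 1)) := by simp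
    _ ≤ (Fintype.card κ + 1) * (ε / (Fintype.card κ + 1)) := by gcongr; exact le_self_add
    _ ≤ ε := ENNReal.mul_div_le

lemma isTightMeasureSet_range_of_tendsto {X : Type*} [MetricSpace X] [CompleteSpace X]
    [SecondCountableTopology X] [MeasurableSpace X] [BorelSpace X] {ν : ℕ → ProbabilityMeasure X}
    {ν' : ProbabilityMeasure X} (h : Tendsto ν atTop (𝓝 ν')) :
    IsTightMeasureSet (Set.range fun n => (ν n : Measure X)) := by
  refine (isTightMeasureSet_of_isCompact_closure h.isCompact_insert_range.closure).subset ?_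
  rintro _ ⟨n, rfl⟩
  exact ⟨ν n, Set.mem_insert_of_mem _ ⟨n, rfl⟩, rfl⟩

lemma exists_tendsto_hyperfilter {X : Type*} [TopologicalSpace X] [T2Space X] [MeasurableSpace X]
    [BorelSpace X] {ν : ℕ → ProbabilityMeasure X}
    (h : IsTightMeasureSet (Set.range fun n => (ν n : Measure X))) :
    ∃ ν' : ProbabilityMeasure X, Tendsto ν (hyperfilter ℕ) (𝓝 ν') := by
  have hc : IsCompact (closure (Set.range ν)) := by
    refine isCompact_closure_of_isTightMeasureSet (h.subset ?_)
    rintro _ ⟨_, ⟨n, rfl⟩, rfl⟩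
    exact ⟨n, rfl⟩
  obtain ⟨ν', -, hν'⟩ := hc.ultrafilter_le_nhds' ((hyperfilter ℕ).map ν)
    (mem_of_superset range_mem_map subset_closure)
  exact ⟨ν', hν'⟩

variable {κ X Y : Type*} [Finite κ] [MetricSpace X] [CompleteSpace X] [SecondCountableTopology X]
  [MeasurableSpace X] [BorelSpace X] [MetricSpace Y] [CompleteSpace Y] [SecondCountableTopology Y]
  [MeasurableSpace Y] [BorelSpace Y]

lemma exists_tendsto_hyperfilter_of_tendsto_map {ν : ℕ → ProbabilityMeasure (κ → X × Y)}
    {α : ProbabilityMeasure (κ → X)} {β : κ → ProbabilityMeasure Y}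
    (hα : Tendsto (fun n => (ν n).map (f := fun x k => (x k).1)
      (Measurable.aemeasurable (by fun_prop))) atTop (𝓝 α))
    (hβ : ∀ k, Tendsto (fun n => (ν n).map (f := fun x => (x k).2)
      (Measurable.aemeasurable (by fun_prop))) atTop (𝓝 (β k))) :
    ∃ ν' : ProbabilityMeasure (κ → X × Y), Tendsto ν (hyperfilter ℕ) (𝓝 ν') := by
  refine exists_tendsto_hyperfilter (isTightMeasureSet_pi fun k =>
    IsTightMeasureSet.prodMk ?_ ?_)
  · have hcoord := ProbabilityMeasure.tendsto_map_of_tendsto_of_continuous _ _ hα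
      (continuous_apply k)
    refine (isTightMeasureSet_range_of_tendsto hcoord).subset ?_
    rintro _ ⟨_, ⟨_, ⟨n, rfl⟩, rfl⟩, rfl⟩
    refine ⟨n, ?_⟩
    simp only [ProbabilityMeasure.toMeasure_map, Measure.fst]
    rw [Measure.map_map (by fun_prop) (by fun_prop), Measure.map_map (by fun_prop) (by fun_prop)]
    rfl
  · refine (isTightMeasureSet_range_of_tendsto (hβ k)).subset ?_
    rintro _ ⟨_, ⟨_, ⟨n, rfl⟩, rfl⟩, rfl⟩
    refine ⟨n, ?_⟩
    simp only [ProbabilityMeasure.toMeasure_map, Measure.snd]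
    rw [Measure.map_map (by fun_prop) (by fun_prop)]
    rfl

end Tightness

section Independence

lemma indepFun_of_tendsto {Ω X Y ι : Type*} [TopologicalSpace Ω] [MeasurableSpace Ω]
    [BorelSpace Ω] [TopologicalSpace X] [MeasurableSpace X] [BorelSpace X] [HasOuterApproxClosed X]
    [TopologicalSpace Y] [MeasurableSpace Y] [BorelSpace Y] [HasOuterApproxClosed Y]
    {𝓕 : Filter ι} [𝓕.NeBot] {ν : ι → ProbabilityMeasure Ω} {ν' : ProbabilityMeasure Ω}
    (h : Tendsto ν 𝓕 (𝓝 ν')) {f : Ω → X} {g : Ω → Y} (hf : Continuous f) (hg : Continuous g)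
    (hfg : ∀ n, IndepFun f g (ν n : Measure Ω)) : IndepFun f g (ν' : Measure Ω) := by
  refine indepFun_of_bcf hf.measurable.aemeasurable hg.measurable.aemeasurable fun φ ψ => ?_
  have hmul := tendsto_integral_of_tendsto_probabilityMeasure h
    (f := fun x => φ (f x) * ψ (g x)) (by fun_prop) (K := ‖φ‖ * ‖ψ‖) fun x => by
      rw [abs_mul]
      exact mul_le_mul (φ.norm_coe_le_norm _) (ψ.norm_coe_le_norm _) (abs_nonneg _)
        (norm_nonneg _)
  have hφ := tendsto_integral_of_tendsto_probabilityMeasure h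
    (φ.continuous.comp hf) fun x => φ.norm_coe_le_norm _
  have hψ := tendsto_integral_of_tendsto_probabilityMeasure h
    (ψ.continuous.comp hg) fun x => ψ.norm_coe_le_norm _
  refine tendsto_nhds_unique hmul ((hφ.mul hψ).congr fun n => ?_)
  exact (((hfg n).comp φ.continuous.measurable
    ψ.continuous.measurable).integral_fun_mul_eq_mul_integral
      (φ.continuous.comp hf).aestronglyMeasurable (ψ.continuous.comp hg).aestronglyMeasurable).symm

lemma indepFun_pi_of_dependsOn {ι Z α β : Type*} [Fintype ι] [MeasurableSpace Z]
    [MeasurableSpace α] [MeasurableSpace β] (P : Measure Z) [IsProbabilityMeasure P]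
    {A B : Finset ι} (hAB : Disjoint A B) {F : (ι → Z) → α} {G : (ι → Z) → β}
    (hF : Measurable F) (hG : Measurable G) (hFA : DependsOn F A) (hGB : DependsOn G B) :
    IndepFun F G (Measure.pi fun _ : ι => P) := by
  classical
  have : Nonempty Z := P.nonempty_of_neZero
  have hcoord := (iIndepFun_pi (μ := fun _ : ι => P) (X := fun _ => id)
    fun _ => aemeasurable_id).indepFun_finset A B hAB fun i => measurable_pi_apply i
  let extend (C : Finset ι) (w : C → Z) (i : ι) : Z :=
    if hi : i ∈ C then w ⟨i, hi⟩ else Classical.arbitrary Z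
  have hextend (C : Finset ι) : Measurable (extend C) := by
    refine measurable_pi_lambda _ fun i => ?_
    by_cases hi : i ∈ C
    · simp only [extend, hi, dite_true]; exact measurable_pi_apply _
    · simp only [extend, hi, dite_false]; exact measurable_const
  have hcomp := hcoord.comp (hF.comp (hextend A)) (hG.comp (hextend B))
  have hFeq : (F ∘ extend A) ∘ (fun (z : ι → Z) (i : A) => id (z i)) = F := funext fun z =>
    hFA fun i hi => by simp [extend, Finset.mem_coe.1 hi]
  have hGeq : (G ∘ extend B) ∘ (fun (z : ι → Z) (i : B) => id (z i)) = G := funext fun z =>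
    hGB fun i hi => by simp [extend, Finset.mem_coe.1 hi]
  rwa [hFeq, hGeq] at hcomp

/-- The second coordinates of the random pairs with joint law `Q` are innovations: each of them is
independent of all earlier pairs. This is what remains of adaptedness in a weak limit. -/
def HasInnovations {D : ℕ} {X Y : Type*} [MeasurableSpace X] [MeasurableSpace Y]
    (Q : Measure (Fin D → X × Y)) : Prop :=
  ∀ d, IndepFun (fun x (c : Set.Iio d) => x c) (fun x => (x d).2) Q

end Independence

section Representation

lemma map_prod_volume_eq_compProd {X Y : Type*} [MeasurableSpace X] [MeasurableSpace Y]
    (μ : Measure X) [IsFiniteMeasure μ] (κ : Kernel X Y) [IsMarkovKernel κ] {f : X → I → Y}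
    (hf : Measurable (Function.uncurry f)) (hκ : ∀ a, volume.map (f a) = κ a) :
    (μ.prod (volume : Measure I)).map (fun p => (p.1, f p.1 p.2)) = μ.compProd κ := by
  have hm : Measurable fun p : X × I => (p.1, f p.1 p.2) := measurable_fst.prodMk hf
  ext s hs
  rw [Measure.map_apply hm hs, Measure.prod_apply (hm hs), Measure.compProd_apply hs]
  refine lintegral_congr fun a => ?_
  rw [← hκ a, Measure.map_apply (hf.of_uncurry_left) (measurable_prodMk_left hs)]
  rfl

lemma exists_measurePreserving_prod_volume {Ω X Y : Type*} [MeasurableSpace Ω] [MeasurableSpace X]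
    [MeasurableSpace Y] [StandardBorelSpace Y] [Nonempty Y] {P : Measure Ω} [IsFiniteMeasure P]
    (H : Ω → X) {S : Ω → Y} (hS : Measurable S) :
    ∃ f : X → I → Y, MeasurePreserving (fun p => (p.1, f p.1 p.2))
      ((P.map H).prod volume) (P.map fun ω => (H ω, S ω)) := by
  obtain ⟨f, hf, hfκ⟩ := Kernel.exists_measurable_map_eq_unitInterval (condDistrib S H P)
  refine ⟨f, measurable_fst.prodMk hf, ?_⟩
  rw [map_prod_volume_eq_compProd _ _ hf hfκ, compProd_map_condDistrib hS.aemeasurable]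

lemma measurable_fin_snoc {n : ℕ} {X : Type*} [MeasurableSpace X] :
    Measurable fun p : (Fin n → X) × X => (Fin.snoc p.1 p.2 : Fin (n + 1) → X) := by
  refine measurable_pi_lambda _ fun d => ?_
  refine Fin.lastCases ?_ (fun d => ?_) d
  · simpa using measurable_snd
  · simp only [Fin.snoc_castSucc]
    fun_prop

lemma measurable_fin_init {n : ℕ} {X : Type*} [MeasurableSpace X] :
    Measurable (Fin.init : (Fin (n + 1) → X) → Fin n → X) :=
  measurable_pi_lambda _ fun _ => measurable_pi_apply _

lemma measurePreserving_init_last {n : ℕ} {X : Type*} [MeasurableSpace X]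
    (ν : Fin (n + 1) → Measure X) [∀ i, SigmaFinite (ν i)] :
    MeasurePreserving (fun w : Fin (n + 1) → X => ((Fin.init w : Fin n → X), w (Fin.last n)))
      (Measure.pi ν) ((Measure.pi fun d : Fin n => ν d.castSucc).prod (ν (Fin.last n))) := by
  have h := Measure.measurePreserving_swap.comp (measurePreserving_piFinSuccAbove ν (Fin.last n))
  simp only [Fin.succAbove_last] at h
  convert h using 1
  funext w
  simp [MeasurableEquiv.piFinSuccAbove, Fin.insertNthEquiv]

variable {n : ℕ} {X Y : Type*} [MeasurableSpace X] [MeasurableSpace Y]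

lemma HasInnovations.init {Q : Measure (Fin (n + 1) → X × Y)} (hQ : HasInnovations Q) :
    HasInnovations (Q.map (Fin.init : _ → Fin n → X × Y)) := by
  intro d
  have hpast : Measurable fun (x : Set.Iio d.castSucc → X × Y) (c : Set.Iio d) =>
      x ⟨(c : Fin n).castSucc, Fin.castSucc_lt_castSucc_iff.2 c.2⟩ := by fun_prop
  have h := (hQ d.castSucc).comp hpast measurable_id
  rw [indepFun_iff_measure_inter_preimage_eq_mul] at h ⊢
  intro A B hA hB
  have hA' := (show Measurable fun (x : Fin n → X × Y) (c : Set.Iio d) => x c by fun_prop) hA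
  have hB' := (show Measurable fun x : Fin n → X × Y => (x d).2 by fun_prop) hB
  rw [Measure.map_apply measurable_fin_init (hA'.inter hB'), Measure.map_apply measurable_fin_init
    hA', Measure.map_apply measurable_fin_init hB']
  exact h A B hA hB

lemma HasInnovations.map_init_last {Q : Measure (Fin (n + 1) → X × Y)} [IsProbabilityMeasure Q]
    (hQ : HasInnovations Q) :
    Q.map (fun x => ((Fin.init x : Fin n → X × Y), (x (Fin.last n)).2)) =
      (Q.map Fin.init).prod (Q.map fun x => (x (Fin.last n)).2) := by
  refine (indepFun_iff_map_prod_eq_prod_map_map measurable_fin_init.aemeasurable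
    (Measurable.aemeasurable (by fun_prop))).1 ?_
  exact (hQ (Fin.last n)).comp
    (φ := fun (x : Set.Iio (Fin.last n) → X × Y) (c : Fin n) =>
      x ⟨c.castSucc, Fin.castSucc_lt_last c⟩) (by fun_prop) measurable_id

lemma measurePreserving_map_snoc (Q : Measure (Fin (n + 1) → X × Y)) :
    MeasurePreserving
      (fun p : ((Fin n → X × Y) × Y) × X => (Fin.snoc p.1.1 (p.2, p.1.2) : Fin (n + 1) → X × Y))
      (Q.map fun x => ((Fin.init x, (x (Fin.last n)).2), (x (Fin.last n)).1)) Q := by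
  have hsnoc : Measurable fun p : ((Fin n → X × Y) × Y) × X =>
      (Fin.snoc p.1.1 (p.2, p.1.2) : Fin (n + 1) → X × Y) :=
    (measurable_fin_snoc (X := X × Y)).comp
      (show Measurable fun p : ((Fin n → X × Y) × Y) × X => (p.1.1, (p.2, p.1.2)) by fun_prop)
  have hsplit : Measurable fun x : Fin (n + 1) → X × Y =>
      (((Fin.init x : Fin n → X × Y), (x (Fin.last n)).2), (x (Fin.last n)).1) :=
    (measurable_fin_init.prodMk (by fun_prop)).prodMk (by fun_prop)
  refine ⟨hsnoc, ?_⟩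
  rw [Measure.map_map hsnoc hsplit]
  convert Measure.map_id
  funext x
  simp

lemma HasInnovations.exists_measurePreserving_last [StandardBorelSpace X] [Nonempty X]
    {Q : Measure (Fin (n + 1) → X × Y)} [IsProbabilityMeasure Q] (hQ : HasInnovations Q) :
    ∃ f : (Fin n → X × Y) × Y → I → X, MeasurePreserving
      (fun p : (Fin n → X × Y) × (Y × I) => (Fin.snoc p.1 (f (p.1, p.2.1) p.2.2, p.2.1) :
        Fin (n + 1) → X × Y))
      ((Q.map Fin.init).prod ((Q.map fun x => (x (Fin.last n)).2).prod volume)) Q := by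
  have : IsProbabilityMeasure (Q.map fun x => (x (Fin.last n)).2) :=
    Measure.isProbabilityMeasure_map (Measurable.aemeasurable (by fun_prop))
  obtain ⟨f, hf⟩ := exists_measurePreserving_prod_volume (P := Q)
    (fun x => ((Fin.init x : Fin n → X × Y), (x (Fin.last n)).2))
    (S := fun x => (x (Fin.last n)).1) (by fun_prop)
  rw [hQ.map_init_last] at hf
  exact ⟨f, (measurePreserving_map_snoc Q).comp (hf.comp (measurePreserving_prodAssoc _ _ _).symm)⟩

lemma measurePreserving_of_subsingleton {Ω Ω' : Type*} [MeasurableSpace Ω] [MeasurableSpace Ω']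
    [Subsingleton Ω'] {P : Measure Ω} {Q : Measure Ω'} [IsProbabilityMeasure P]
    [IsProbabilityMeasure Q] {f : Ω → Ω'} (hf : Measurable f) : MeasurePreserving f P Q := by
  have : IsProbabilityMeasure (P.map f) := Measure.isProbabilityMeasure_map hf.aemeasurable
  refine ⟨hf, Measure.ext fun s _ => ?_⟩
  rcases Set.eq_empty_or_nonempty s with rfl | hs
  · simp
  · simp [Subsingleton.eq_univ_of_nonempty hs]

theorem HasInnovations.exists_measurePreserving [StandardBorelSpace X] [Nonempty X]
    {Q : Measure (Fin n → X × Y)} [IsProbabilityMeasure Q] (hQ : HasInnovations Q) :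
    ∃ Φ : (Fin n → Y × I) → Fin n → X × Y,
      MeasurePreserving Φ (Measure.pi fun d => (Q.map fun x => (x d).2).prod volume) Q ∧
      (∀ w d, (Φ w d).2 = (w d).1) ∧ ∀ d, DependsOn (fun w => Φ w d) (Set.Iic d) := by
  induction n with
  | zero =>
    have (d : Fin 0) : IsProbabilityMeasure (Q.map fun x => (x d).2) := d.elim0
    exact ⟨fun _ => finZeroElim, measurePreserving_of_subsingleton measurable_const,
      fun _ d => d.elim0, fun d => d.elim0⟩
  | succ n ih =>
    have : IsProbabilityMeasure (Q.map (Fin.init : _ → Fin n → X × Y)) :=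
      Measure.isProbabilityMeasure_map measurable_fin_init.aemeasurable
    have (d : Fin (n + 1)) : IsProbabilityMeasure (Q.map fun x => (x d).2) :=
      Measure.isProbabilityMeasure_map (Measurable.aemeasurable (by fun_prop))
    obtain ⟨Φ, hΦ, hΦsnd, hΦdep⟩ := ih hQ.init
    obtain ⟨f, hf⟩ := hQ.exists_measurePreserving_last
    have hmarg (d : Fin n) : (Q.map Fin.init).map (fun x => (x d).2) =
        Q.map fun x => (x d.castSucc).2 :=
      Measure.map_map (by fun_prop) measurable_fin_init
    simp only [hmarg] at hΦ
    refine ⟨fun w => Fin.snoc (Φ (Fin.init w))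
      (f (Φ (Fin.init w), (w (Fin.last n)).1) (w (Fin.last n)).2, (w (Fin.last n)).1),
      hf.comp ((hΦ.prod (.id _)).comp (measurePreserving_init_last
        fun d => (Q.map fun x => (x d).2).prod volume)), fun w d => ?_, fun d => ?_⟩
    · refine Fin.lastCases ?_ (fun d => ?_) d
      · simp
      · simp [hΦsnd, Fin.init]
    · refine Fin.lastCases ?_ (fun d => ?_) d
      · intro w w' hw
        rw [funext fun i => hw i (Fin.le_last i)]
      · intro w w' hw
        simp only [Fin.snoc_castSucc]
        exact hΦdep d fun i hi => hw _ (by simpa using hi)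

lemma map_projIcc_volume :
    ((volume : Measure ℝ).restrict (Set.Icc 0 1)).map
      (Set.projIcc (0 : ℝ) 1 zero_le_one) = (volume : Measure I) := by
  have h : Measurable (Set.projIcc (0 : ℝ) 1 zero_le_one) := continuous_projIcc.measurable
  have hid : Set.projIcc (0 : ℝ) 1 zero_le_one ∘ (Subtype.val : Set.Icc (0 : ℝ) 1 → ℝ) = id :=
    funext fun x => Set.projIcc_val zero_le_one x
  rw [← map_comap_subtype_coe (measurableSet_Icc (a := (0 : ℝ)) (b := 1)) volume,
    Measure.map_map h measurable_subtype_coe, hid, Measure.map_id]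
  rfl

lemma exists_measurePreserving_pi_volume (n : ℕ) :
    ∃ g : ℝ → Fin n → I, MeasurePreserving g ((volume : Measure ℝ).restrict (Set.Icc 0 1))
      (Measure.pi fun _ => (volume : Measure I)) := by
  obtain ⟨g, hg, hgl⟩ := Measure.exists_measurable_map_eq
    (Measure.pi fun _ : Fin n => (volume : Measure I))
  exact ⟨_, MeasurePreserving.comp ⟨hg, hgl⟩ ⟨continuous_projIcc.measurable, map_projIcc_volume⟩⟩

end Representation

section Gaussian

lemma gaussianReal_withDensity_exp (a : ℝ) :
    (gaussianReal 0 1).withDensity (fun x => ENNReal.ofReal (Real.exp (a * x - a ^ 2 / 2))) =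
      gaussianReal a 1 := by
  rw [gaussianReal_of_var_ne_zero 0 one_ne_zero, gaussianReal_of_var_ne_zero a one_ne_zero,
    ← withDensity_mul _ (measurable_gaussianPDF 0 1) (by fun_prop)]
  congr 1
  funext x
  simp only [Pi.mul_apply, gaussianPDF]
  rw [← ENNReal.ofReal_mul (gaussianPDFReal_nonneg _ _ _)]
  congr 1
  simp only [gaussianPDFReal, mul_assoc, ← Real.exp_add]
  congr 2
  push_cast
  ring

variable {ι : Type*} [Fintype ι]

lemma stdGaussian_withDensity_exp (a : EuclideanSpace ℝ ι) :
    (stdGaussian (EuclideanSpace ℝ ι)).withDensity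
        (fun x => ENNReal.ofReal (Real.exp (inner ℝ a x - ‖a‖ ^ 2 / 2))) =
      (stdGaussian (EuclideanSpace ℝ ι)).map (· + a) := by
  have hL : Measurable (WithLp.toLp 2 : (ι → ℝ) → EuclideanSpace ℝ ι) := by fun_prop
  have (i : ι) : SigmaFinite ((gaussianReal 0 1).withDensity
      (fun x => ENNReal.ofReal (Real.exp (a i * x - a i ^ 2 / 2)))) := by
    rw [gaussianReal_withDensity_exp]
    infer_instance
  have hdensity (x : ι → ℝ) : ENNReal.ofReal
        (Real.exp (inner ℝ a (WithLp.toLp 2 x) - ‖a‖ ^ 2 / 2)) =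
      ∏ i, ENNReal.ofReal (Real.exp (a i * x i - a i ^ 2 / 2)) := by
    rw [← ENNReal.ofReal_prod_of_nonneg fun i _ => (Real.exp_pos _).le, ← Real.exp_sum,
      EuclideanSpace.real_norm_sq_eq, Finset.sum_sub_distrib, Finset.sum_div]
    simp [PiLp.inner_apply, mul_comm]
  have hshift : Measure.pi (fun i => gaussianReal (a i) 1) =
      (Measure.pi fun _ : ι => gaussianReal 0 1).map (fun x i => x i + a i) := by
    rw [Measure.pi_map_pi (f := fun i x => x + a i) fun i => by fun_prop]
    simp_rw [gaussianReal_map_add_const, zero_add]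
  rw [← map_pi_eq_stdGaussian, map_withDensity _ hL (by fun_prop), Measure.map_map (by fun_prop) hL]
  simp_rw [Function.comp_def, hdensity]
  rw [← pi_withDensity (fun _ : ι => gaussianReal 0 1)
    (f := fun i x => ENNReal.ofReal (Real.exp (a i * x - a i ^ 2 / 2))) fun i => by fun_prop]
  simp_rw [gaussianReal_withDensity_exp]
  rw [hshift, Measure.map_map hL (by fun_prop)]
  rfl

open Matrix

variable [DecidableEq ι]

open scoped MatrixOrder in
lemma inner_toEuclideanCLM_sqrt (S : Matrix ι ι ℝ) (x y : EuclideanSpace ℝ ι) :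
    inner ℝ (toEuclideanCLM (𝕜 := ℝ) (CFC.sqrt S) x) y =
      inner ℝ x (toEuclideanCLM (𝕜 := ℝ) (CFC.sqrt S) y) := by
  have hadj : IsSelfAdjoint (toEuclideanCLM (𝕜 := ℝ) (CFC.sqrt S)) :=
    (CFC.sqrt_nonneg S).isSelfAdjoint.map _
  conv_lhs => rw [← hadj.adjoint_eq, ContinuousLinearMap.adjoint_inner_left]

open scoped MatrixOrder in
lemma toEuclideanCLM_sqrt_sqrt {S : Matrix ι ι ℝ} (hS : S.PosSemidef) (x : EuclideanSpace ℝ ι) :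
    toEuclideanCLM (𝕜 := ℝ) (CFC.sqrt S) (toEuclideanCLM (𝕜 := ℝ) (CFC.sqrt S) x) =
      toEuclideanCLM (𝕜 := ℝ) S x := by
  rw [← mul_apply_eq_comp, ← map_mul, CFC.sqrt_mul_sqrt_self S hS.nonneg]

open scoped MatrixOrder in
theorem multivariateGaussian_withDensity_exp {S : Matrix ι ι ℝ} (hS : S.PosSemidef)
    (h : EuclideanSpace ℝ ι) :
    (multivariateGaussian 0 S).withDensity (fun x => ENNReal.ofReal (Real.exp
        (inner ℝ h x - inner ℝ h (toEuclideanCLM (𝕜 := ℝ) S h) / 2))) =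
      multivariateGaussian (toEuclideanCLM (𝕜 := ℝ) S h) S := by
  set R := toEuclideanCLM (𝕜 := ℝ) (CFC.sqrt S)
  have hdensity (x : EuclideanSpace ℝ ι) :
      inner ℝ h (0 + R x) - inner ℝ h (R (R h)) / 2 = inner ℝ (R h) x - ‖R h‖ ^ 2 / 2 := by
    rw [zero_add, ← inner_toEuclideanCLM_sqrt, ← inner_toEuclideanCLM_sqrt,
      real_inner_self_eq_norm_sq]
  rw [multivariateGaussian, map_withDensity _ (by fun_prop) (by fun_prop),
    ← toEuclideanCLM_sqrt_sqrt hS]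
  simp only [R, hdensity]
  rw [stdGaussian_withDensity_exp, Measure.map_map (by fun_prop) (by fun_prop),
    multivariateGaussian]
  congr 1
  funext x
  simp [add_comm]

end Gaussian

section GaussianShift

open Matrix

variable {ι κ : Type*} [Fintype ι] [DecidableEq ι]

/-- The law `N(S h, S)` of the score statistic in the Gaussian shift experiment with information
matrix `S` and parameter `h`. -/
noncomputable def gaussianShift (S : Matrix ι ι ℝ) (h : EuclideanSpace ℝ ι) :
    Measure (EuclideanSpace ℝ ι) :=
  multivariateGaussian (toEuclideanCLM (𝕜 := ℝ) S h) S

instance (S : Matrix ι ι ℝ) (h : EuclideanSpace ℝ ι) : IsProbabilityMeasure (gaussianShift S h) :=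
  inferInstanceAs (IsProbabilityMeasure (multivariateGaussian _ _))

lemma charFun_gaussianShift_zero {S : Matrix ι ι ℝ} (hS : S.PosSemidef) (u : EuclideanSpace ℝ ι) :
    charFun (gaussianShift S 0) u =
      Complex.exp (-(inner ℝ u (toEuclideanCLM (𝕜 := ℝ) S u) : ℝ) / 2) := by
  rw [gaussianShift, map_zero, charFun_multivariateGaussian hS, inner_toEuclideanCLM]
  simp [neg_div]

variable [Fintype κ]

/-- The log-likelihood ratio of the parameters `h` and `0` in the product over `k` of the Gaussian
shift experiments with information matrices `S k`. -/
noncomputable def shiftLogLikelihood (S : κ → Matrix ι ι ℝ) (h : EuclideanSpace ℝ ι)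
    (y : κ → EuclideanSpace ℝ ι) : ℝ :=
  ∑ k, (inner ℝ h (y k) - inner ℝ h (toEuclideanCLM (𝕜 := ℝ) (S k) h) / 2)

lemma continuous_shiftLogLikelihood (S : κ → Matrix ι ι ℝ) (h : EuclideanSpace ℝ ι) :
    Continuous (shiftLogLikelihood S h) := by
  unfold shiftLogLikelihood
  fun_prop

lemma gaussianShift_prod_withDensity {X : Type*} [MeasurableSpace X] (ν : Measure X)
    [IsProbabilityMeasure ν] {S : Matrix ι ι ℝ} (hS : S.PosSemidef) (h : EuclideanSpace ℝ ι) :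
    ((gaussianShift S 0).prod ν).withDensity (fun x => ENNReal.ofReal (Real.exp
        (inner ℝ h x.1 - inner ℝ h (toEuclideanCLM (𝕜 := ℝ) S h) / 2))) =
      (gaussianShift S h).prod ν := by
  rw [gaussianShift, gaussianShift, map_zero, ← multivariateGaussian_withDensity_exp hS,
    prod_withDensity_left (by fun_prop)]

theorem pi_gaussianShift_prod_withDensity {X : Type*} [MeasurableSpace X] (ν : Measure X)
    [IsProbabilityMeasure ν] {S : κ → Matrix ι ι ℝ} (hS : ∀ k, (S k).PosSemidef)
    (h : EuclideanSpace ℝ ι) :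
    (Measure.pi fun k => (gaussianShift (S k) 0).prod ν).withDensity
        (fun x => ENNReal.ofReal (Real.exp (shiftLogLikelihood S h fun k => (x k).1))) =
      Measure.pi fun k => (gaussianShift (S k) h).prod ν := by
  have (k : κ) : SigmaFinite (((gaussianShift (S k) 0).prod ν).withDensity fun x =>
      ENNReal.ofReal (Real.exp
        (inner ℝ h x.1 - inner ℝ h (toEuclideanCLM (𝕜 := ℝ) (S k) h) / 2))) := by
    rw [gaussianShift_prod_withDensity ν (hS k)]
    infer_instance
  simp_rw [← gaussianShift_prod_withDensity ν (hS _) h, shiftLogLikelihood, Real.exp_sum,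
    ENNReal.ofReal_prod_of_nonneg fun _ _ => (Real.exp_pos _).le]
  rw [pi_withDensity (f := fun k (x : EuclideanSpace ℝ ι × X) => ENNReal.ofReal (Real.exp
    (inner ℝ h x.1 - inner ℝ h (toEuclideanCLM (𝕜 := ℝ) (S k) h) / 2))) _ fun k => by fun_prop]

theorem HasInnovations.exists_forall_measurePreserving {D : ℕ}
    {Q : Measure (Fin D → ℝ × EuclideanSpace ℝ ι)} [IsProbabilityMeasure Q]
    (hQ : HasInnovations Q) {S : Fin D → Matrix ι ι ℝ} (hS : ∀ d, (S d).PosSemidef)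
    (hQS : ∀ d, (Q.map fun x => (x d).2) = gaussianShift (S d) 0) :
    ∃ Φ : (Fin D → EuclideanSpace ℝ ι × I) → Fin D → ℝ,
      (∀ d, DependsOn (fun w => Φ w d) (Set.Iic d)) ∧
      ∀ h, MeasurePreserving Φ (Measure.pi fun d => (gaussianShift (S d) h).prod volume)
        ((Q.withDensity fun x => ENNReal.ofReal
          (Real.exp (shiftLogLikelihood S h fun d => (x d).2))).map fun x d => (x d).1) := by
  obtain ⟨Φ, hΦ, hΦsnd, hΦdep⟩ := hQ.exists_measurePreserving
  simp only [hQS] at hΦ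
  refine ⟨fun w d => (Φ w d).1, fun d w w' hw => congrArg Prod.fst (hΦdep d hw), fun h => ?_⟩
  have hmeas : Measurable fun x : Fin D → ℝ × EuclideanSpace ℝ ι =>
      ENNReal.ofReal (Real.exp (shiftLogLikelihood S h fun d => (x d).2)) :=
    (((continuous_shiftLogLikelihood S h).comp (by fun_prop)).rexp).measurable.ennreal_ofReal
  have hfst : Measurable fun (x : Fin D → ℝ × EuclideanSpace ℝ ι) d => (x d).1 := by fun_prop
  have htilt : MeasurePreserving Φ (Measure.pi fun d => (gaussianShift (S d) h).prod volume)
      (Q.withDensity fun x => ENNReal.ofReal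
        (Real.exp (shiftLogLikelihood S h fun d => (x d).2))) := by
    refine ⟨hΦ.measurable, ?_⟩
    rw [← hΦ.map_eq, map_withDensity _ hΦ.measurable hmeas]
    simp only [hΦsnd, pi_gaussianShift_prod_withDensity volume hS h]
  exact (hfst.measurePreserving _).comp htilt

end GaussianShift

section Fisher

open Matrix

variable {m : ℕ} {𝒵 : Type*} [MeasurableSpace 𝒵] {μ : Measure 𝒵}
  {Θ : Set (EuclideanSpace ℝ (Fin m))} {p : EuclideanSpace ℝ (Fin m) → 𝒵 → ℝ}
  {θ₀ : EuclideanSpace ℝ (Fin m)} {s : 𝒵 → EuclideanSpace ℝ (Fin m)}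

lemma IsRegularModel.memLp_score_apply (hM : IsRegularModel μ Θ p θ₀ s) (i : Fin m) :
    MemLp (fun z => s z i) 2 (obsLaw μ p θ₀) := by
  simpa [EuclideanSpace.inner_single_left] using hM.memLp_inner (EuclideanSpace.single i 1)

theorem IsRegularModel.integral_inner_sq (hM : IsRegularModel μ Θ p θ₀ s)
    (h : EuclideanSpace ℝ (Fin m)) :
    ∫ z, inner ℝ h (s z) ^ 2 ∂(obsLaw μ p θ₀) =
      inner ℝ h (toEuclideanCLM (𝕜 := ℝ) (fisherInfo μ p θ₀ s) h) := by
  have hint (i j : Fin m) : Integrable (fun z => s z i * s z j) (obsLaw μ p θ₀) :=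
    (hM.memLp_score_apply i).integrable_mul (hM.memLp_score_apply j)
  have hexpand (z : 𝒵) : inner ℝ h (s z) ^ 2 = ∑ i, ∑ j, h i * h j * (s z i * s z j) := by
    rw [sq, PiLp.inner_apply, Finset.sum_mul_sum]
    refine Finset.sum_congr rfl fun i _ => Finset.sum_congr rfl fun j _ => ?_
    simp only [RCLike.inner_apply, conj_trivial]
    ring
  simp_rw [hexpand, inner_toEuclideanCLM]
  rw [integral_finsetSum _ fun i _ => integrable_finsetSum _ fun j _ => (hint i j).const_mul _]
  simp_rw [dotProduct, mulVec, dotProduct, Finset.mul_sum, fisherInfo, Matrix.of_apply]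
  refine Finset.sum_congr rfl fun i _ => ?_
  rw [integral_finsetSum _ fun j _ => (hint i j).const_mul _]
  refine Finset.sum_congr rfl fun j _ => ?_
  rw [integral_const_mul]
  ring

theorem IsRegularModel.posSemidef_fisherInfo (hM : IsRegularModel μ Θ p θ₀ s) :
    (fisherInfo μ p θ₀ s).PosSemidef := by
  refine Matrix.PosSemidef.of_dotProduct_mulVec_nonneg ?_ fun x => ?_
  · ext i j
    simp [fisherInfo, mul_comm]
  · have h := hM.integral_inner_sq (WithLp.toLp 2 x)
    rw [inner_toEuclideanCLM] at h
    rw [star_trivial, ← h]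
    exact integral_nonneg fun z => sq_nonneg _

end Fisher

section Blocks

open Classical in
/-- The indices of the observations with relative index at most `a`. -/
noncomputable def upto (n : ℕ) (a : ℝ) : Finset (Fin n) :=
  Finset.univ.filter fun i => ((i : ℕ) + 1 : ℝ) / n ≤ a

lemma mem_upto {n : ℕ} {a : ℝ} {i : Fin n} : i ∈ upto n a ↔ ((i : ℕ) + 1 : ℝ) / n ≤ a := by
  simp [upto]

lemma upto_mono (n : ℕ) {a b : ℝ} (h : a ≤ b) : upto n a ⊆ upto n b := fun _ hi =>
  mem_upto.2 ((mem_upto.1 hi).trans h)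

lemma card_upto (n : ℕ) {a : ℝ} (ha : a ≤ 1) : (upto n a).card = ⌊a * n⌋₊ := by
  rcases n.eq_zero_or_pos with rfl | hn
  · simp [Finset.eq_empty_of_isEmpty]
  have hfloor : ⌊a * n⌋₊ ≤ n := Nat.floor_le_of_le (mul_le_of_le_one_left n.cast_nonneg ha)
  have hmem (i : Fin n) : i ∈ upto n a ↔ (i : ℕ) < ⌊a * n⌋₊ := by
    rw [mem_upto, div_le_iff₀ (by exact_mod_cast hn), Nat.lt_iff_add_one_le,
      Nat.le_floor_iff' (Nat.succ_ne_zero _)]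
    push_cast
    rfl
  have hfilter : upto n a = Finset.univ.filter fun i : Fin n => (i : ℕ) < ⌊a * n⌋₊ := by
    ext i
    simp [hmem]
  rw [hfilter, Fin.card_filter_val_lt, min_eq_right hfloor]

lemma tendsto_card_upto {a : ℝ} (ha0 : 0 ≤ a) (ha1 : a ≤ 1) :
    Tendsto (fun n : ℕ => ((upto n a).card : ℝ) / n) atTop (𝓝 a) := by
  simp_rw [card_upto _ ha1]
  exact (tendsto_nat_floor_mul_div_atTop ha0).comp tendsto_natCast_atTop_atTop

variable {D : ℕ} {t : Fin D → I}

/-- The time that precedes `t d`, which is `0` for the first index. -/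
noncomputable def prevTime (t : Fin D → I) (d : Fin D) : I :=
  if 0 < (d : ℕ) then t ⟨d - 1, by omega⟩ else 0

/-- The length of the `d`-th time interval. -/
noncomputable def timeStep (t : Fin D → I) (d : Fin D) : ℝ :=
  t d - prevTime t d

/-- The indices of the observations with relative index in the `d`-th time interval. -/
noncomputable def block (t : Fin D → I) (n : ℕ) (d : Fin D) : Finset (Fin n) :=
  upto n (t d) \ upto n (prevTime t d)

lemma prevTime_le (ht : StrictMono t) (d : Fin D) : prevTime t d ≤ t d := by
  unfold prevTime
  split_ifs
  · exact ht.monotone (Fin.le_def.2 (by simp))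
  · exact (t d).2.1

lemma timeStep_nonneg (ht : StrictMono t) (d : Fin D) : 0 ≤ timeStep t d :=
  sub_nonneg.2 (prevTime_le ht d)

lemma le_prevTime (ht : StrictMono t) {c d : Fin D} (hcd : c < d) : t c ≤ prevTime t d := by
  rw [prevTime, if_pos (Nat.zero_lt_of_lt (Fin.lt_def.1 hcd))]
  exact ht.monotone (Fin.le_def.2 (Nat.le_sub_one_of_lt (Fin.lt_def.1 hcd)))

lemma mem_block (ht : StrictMono t) {n : ℕ} {d : Fin D} {i : Fin n} :
    i ∈ block t n d ↔ i ∈ upto n (t d) ∧ ∀ c < d, i ∉ upto n (t c) := by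
  rw [block, Finset.mem_sdiff]
  refine and_congr_right fun _ => ⟨fun h c hc hi => h (upto_mono n (le_prevTime ht hc) hi),
    fun h hi => ?_⟩
  unfold prevTime at hi
  split_ifs at hi with hd
  · exact h _ (Fin.lt_def.2 (by simp; omega)) hi
  · have hn : (0 : ℝ) < n := by exact_mod_cast i.pos
    exact absurd (mem_upto.1 hi) (not_le.2 (by simp only [Set.Icc.coe_zero]; positivity))

lemma pairwiseDisjoint_block (ht : StrictMono t) (n : ℕ) :
    (Set.univ : Set (Fin D)).PairwiseDisjoint (block t n) := by
  have hlt {d e : Fin D} (hde : d < e) : Disjoint (block t n d) (block t n e) :=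
    Finset.disjoint_left.2 fun i hd he =>
      ((mem_block ht).1 he).2 d hde ((mem_block ht).1 hd).1
  intro d _ e _ hne
  rcases lt_or_gt_of_ne hne with h | h
  · exact hlt h
  · exact (hlt h).symm

lemma tendsto_card_block (ht : StrictMono t) (d : Fin D) :
    Tendsto (fun n : ℕ => ((block t n d).card : ℝ) / n) atTop (𝓝 (timeStep t d)) := by
  refine ((tendsto_card_upto (t d).2.1 (t d).2.2).sub
    (tendsto_card_upto (prevTime t d).2.1 (prevTime t d).2.2)).congr fun n => ?_
  have hsub := upto_mono n (Subtype.coe_le_coe.2 (prevTime_le ht d))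
  rw [block, Finset.card_sdiff_of_subset hsub, Nat.cast_sub (Finset.card_le_card hsub), sub_div]

/-- The indices of the observations that belong to some block. -/
noncomputable def blocks (t : Fin D → I) (n : ℕ) : Finset (Fin n) :=
  Finset.univ.biUnion (block t n)

lemma upto_subset_blocks (ht : StrictMono t) (n : ℕ) (d : Fin D) :
    upto n (t d) ⊆ blocks t n := by
  intro i hi
  obtain ⟨c, hc, hmin⟩ := WellFounded.has_min (wellFounded_lt (α := Fin D))
    {c | i ∈ upto n (t c)} ⟨d, hi⟩
  exact Finset.mem_biUnion.2 ⟨c, Finset.mem_univ c,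
    (mem_block ht).2 ⟨hc, fun b hb hib => hmin b hib hb⟩⟩

lemma sum_blocks {M : Type*} [AddCommMonoid M] (ht : StrictMono t) (n : ℕ) (f : Fin n → M) :
    ∑ i ∈ blocks t n, f i = ∑ d, ∑ i ∈ block t n d, f i :=
  Finset.sum_biUnion ((pairwiseDisjoint_block ht n).subset (Set.subset_univ _))

lemma tendsto_card_blocks (ht : StrictMono t) :
    Tendsto (fun n : ℕ => ((blocks t n).card : ℝ) / n) atTop (𝓝 (∑ d, timeStep t d)) := by
  refine (tendsto_finsetSum Finset.univ fun d _ => tendsto_card_block ht d).congr fun n => ?_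
  rw [← Finset.sum_div, Finset.card_eq_sum_ones, sum_blocks ht]
  simp

end Blocks

lemma indepFun_map {Ω Ω' α β : Type*} [MeasurableSpace Ω] [MeasurableSpace Ω'] [MeasurableSpace α]
    [MeasurableSpace β] {ν : Measure Ω} {φ : Ω → Ω'} {f : Ω' → α} {g : Ω' → β} (hφ : Measurable φ)
    (hf : Measurable f) (hg : Measurable g) (h : IndepFun (f ∘ φ) (g ∘ φ) ν) :
    IndepFun f g (ν.map φ) := by
  rw [indepFun_iff_measure_inter_preimage_eq_mul] at h ⊢
  intro s t hs ht
  rw [Measure.map_apply hφ ((hf hs).inter (hg ht)), Measure.map_apply hφ (hf hs),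
    Measure.map_apply hφ (hg ht)]
  exact h s t hs ht

section SmallArray

variable {𝒵 : Type*} [MeasurableSpace 𝒵] {P : Measure 𝒵} [IsProbabilityMeasure P] {X : ℕ → 𝒵 → ℝ}
  {ε : ℕ → ℝ} {v : ℝ}

lemma IsSmallArray.integral_mul_prod_eq (hX : IsSmallArray P X ε v) {n : ℕ} {A : Finset (Fin n)}
    {φ : (Fin n → 𝒵) → ℝ} (hφ : Measurable φ) (hφA : DependsOn φ A) :
    ∫ z, φ z * ∏ i, (1 + X n (z i)) ∂(Measure.pi fun _ => P) =
      ∫ z, φ z * ∏ i ∈ A, (1 + X n (z i)) ∂(Measure.pi fun _ => P) := by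
  have hXm := hX.measurable n
  have hprod (B : Finset (Fin n)) :
      DependsOn (fun z : Fin n → 𝒵 => ∏ i ∈ B, (1 + X n (z i))) B := fun x y hxy =>
    Finset.prod_congr rfl fun i hi => by rw [hxy i hi]
  have hind : IndepFun (fun z => φ z * ∏ i ∈ A, (1 + X n (z i)))
      (fun z => ∏ i ∈ Aᶜ, (1 + X n (z i))) (Measure.pi fun _ => P) :=
    indepFun_pi_of_dependsOn P disjoint_compl_right (hφ.mul (by fun_prop)) (by fun_prop)
      (fun x y hxy => congrArg₂ (· * ·) (hφA hxy) (hprod A hxy)) (hprod Aᶜ)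
  have hone : ∫ z, (1 + X n z) ∂P = 1 := by
    have hint : Integrable (X n) P := hX.integrable_comp continuous_id n
    rw [integral_add (integrable_const 1) hint, hX.integral_eq_zero n]
    simp
  have hmul := hind.integral_fun_mul_eq_mul_integral
    (hφ.mul (by fun_prop)).aestronglyMeasurable (Measurable.aestronglyMeasurable (by fun_prop))
  rw [integral_finset_prod_pi P _ fun z => 1 + X n z, hone, one_pow, mul_one] at hmul
  rw [← hmul]
  simp only [mul_assoc, Finset.prod_mul_prod_compl]

lemma IsSmallArray.tendsto_integral_mul_prod_sub (hX : IsSmallArray P X ε v)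
    {A : ∀ n, Finset (Fin n)} {τ : ℝ}
    (hA : Tendsto (fun n : ℕ => ((A n).card : ℝ) / n) atTop (𝓝 τ))
    {φ : ∀ n : ℕ, (Fin n → 𝒵) → ℝ} (hφm : ∀ n, Measurable (φ n)) {C : ℝ}
    (hφ : ∀ n z, |φ n z| ≤ C) :
    Tendsto (fun n => ∫ z, φ n z * ∏ i ∈ A n, (1 + X n (z i)) ∂(Measure.pi fun _ => P) -
      ∫ z, φ n z * Real.exp (∑ i ∈ A n, X n (z i) - τ * v / 2) ∂(Measure.pi fun _ => P))
      atTop (𝓝 0) := by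
  have hlim : Tendsto (fun n => C * ∫ z : Fin n → 𝒵, |∏ i ∈ A n, (1 + X n (z i)) -
      Real.exp (∑ i ∈ A n, X n (z i) - τ * v / 2)| ∂(Measure.pi fun _ => P)) atTop (𝓝 0) := by
    simpa using (hX.tendsto_integral_abs_prod_sub_exp hA).const_mul C
  refine squeeze_zero_norm (fun n => ?_) hlim
  have hprod : Integrable (fun z : Fin n → 𝒵 => ∏ i ∈ A n, (1 + X n (z i)))
      (Measure.pi fun _ => P) :=
    hX.integrable_prod_comp (φ := fun x => 1 + x) (by fun_prop) n (A n)
  have hexp : Integrable (fun z : Fin n → 𝒵 => Real.exp (∑ i ∈ A n, X n (z i) - τ * v / 2))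
      (Measure.pi fun _ => P) := by
    simpa only [one_mul, Real.exp_sub] using (hX.integrable_exp_mul_sum 1 n (A n)).div_const _
  have hφae := ae_of_all (Measure.pi fun _ : Fin n => P) (hφ n)
  rw [← integral_sub (hprod.bdd_mul (hφm n).aestronglyMeasurable hφae)
    (hexp.bdd_mul (hφm n).aestronglyMeasurable hφae), ← integral_const_mul]
  refine norm_integral_le_of_norm_le ((hprod.sub hexp).abs.const_mul C)
    (ae_of_all _ fun z => ?_)
  rw [← mul_sub, norm_mul]
  exact mul_le_mul_of_nonneg_right (hφ n z) (norm_nonneg _)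

lemma IsSmallArray.exists_eventually_integral_exp_le (hX : IsSmallArray P X ε v)
    {A : ∀ n, Finset (Fin n)} {τ : ℝ}
    (hA : Tendsto (fun n : ℕ => ((A n).card : ℝ) / n) atTop (𝓝 τ)) (w c : ℝ) :
    ∃ C, ∀ᶠ n in atTop,
      Integrable (fun z : Fin n → 𝒵 => Real.exp (w * (∑ i ∈ A n, X n (z i) - c)))
        (Measure.pi fun _ => P) ∧
      ∫ z, Real.exp (w * (∑ i ∈ A n, X n (z i) - c)) ∂(Measure.pi fun _ => P) ≤ C := by
  obtain ⟨C, hC⟩ := ((hX.tendsto_integral_rexp_mul_sum w hA).div_const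
    (Real.exp (w * c))).isBoundedUnder_le
  refine ⟨C, (eventually_map.1 hC).mono fun n hn => ?_⟩
  simp only [mul_sub, Real.exp_sub, integral_div]
  exact ⟨(hX.integrable_exp_mul_sum w n (A n)).div_const _, hn⟩

end SmallArray

section Limit

variable {m D : ℕ} {𝒵 : Type*} [MeasurableSpace 𝒵] {μ : Measure 𝒵}
  {Θ : Set (EuclideanSpace ℝ (Fin m))} {p : EuclideanSpace ℝ (Fin m) → 𝒵 → ℝ}
  {θ₀ : EuclideanSpace ℝ (Fin m)} {s : 𝒵 → EuclideanSpace ℝ (Fin m)} {t : Fin D → I}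
  {S : (n : ℕ) → (Fin n → 𝒵) → Fin D → ℝ}

theorem IsRegularModel.tendsto_integral_sub_integral_mul_exp (hM : IsRegularModel μ Θ p θ₀ s)
    (h : EuclideanSpace ℝ (Fin m)) {A : ∀ n, Finset (Fin n)} {τ : ℝ}
    (hA : Tendsto (fun n : ℕ => ((A n).card : ℝ) / n) atTop (𝓝 τ))
    {φ : ∀ n : ℕ, (Fin n → 𝒵) → ℝ} (hφm : ∀ n, Measurable (φ n))
    (hφA : ∀ n, DependsOn (φ n) (A n)) {C : ℝ} (hφ : ∀ n z, |φ n z| ≤ C) :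
    Tendsto (fun n : ℕ => ∫ z, φ n z ∂(sampleLaw μ p (localParam θ₀ h n) n) -
      ∫ z, φ n z * Real.exp (∑ i ∈ A n, scoreArray (obsLaw μ p θ₀) s h n (z i) -
        τ * (∫ z, inner ℝ h (s z) ^ 2 ∂(obsLaw μ p θ₀)) / 2) ∂(sampleLaw μ p θ₀ n))
      atTop (𝓝 0) := by
  have := hM.isProbabilityMeasure
  have hX := hM.isSmallArray h
  have hsum := (hM.tendsto_integral_sub h hφm hφ).add (hX.tendsto_integral_mul_prod_sub hA hφm hφ)
  rw [add_zero] at hsum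
  refine hsum.congr fun n => ?_
  rw [sampleLaw, sampleLaw, hX.integral_mul_prod_eq (hφm n) (hφA n), sub_add_sub_cancel]

lemma IsAdapted.dependsOn_upto (hS : IsAdapted t S) (n : ℕ) (d : Fin D) :
    DependsOn (fun z => S n z d) (upto n (t d)) := fun _ _ hxy =>
  hS.dependsOn n d fun i hi => hxy i (Finset.mem_coe.2 (mem_upto.2 hi.2))

lemma IsAdapted.dependsOn_blocks (hS : IsAdapted t S) (ht : StrictMono t) (n : ℕ) :
    DependsOn (S n) (blocks t n) := fun _ _ hxy => funext fun d =>
  hS.dependsOn_upto n d fun i hi => hxy i (upto_subset_blocks ht n d hi)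

/-- The normalized sums of the centred scores over the blocks of observations. -/
noncomputable def blockScore (P : Measure 𝒵) (s : 𝒵 → EuclideanSpace ℝ (Fin m)) (t : Fin D → I)
    (n : ℕ) (z : Fin n → 𝒵) (d : Fin D) : EuclideanSpace ℝ (Fin m) :=
  ∑ i ∈ block t n d, (√(n : ℝ))⁻¹ • centredScore P s n (z i)

lemma measurable_blockScore (P : Measure 𝒵) (hs : Measurable s) (n : ℕ) :
    Measurable (blockScore P s t n) := by
  have := measurable_centredScore P hs n
  unfold blockScore
  fun_prop

lemma dependsOn_blockScore (P : Measure 𝒵) (n : ℕ) (d : Fin D) :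
    DependsOn (fun z => blockScore P s t n z d) (block t n d) := fun _ _ hxy =>
  Finset.sum_congr rfl fun i hi => by rw [hxy i hi]

lemma inner_blockScore (P : Measure 𝒵) (h : EuclideanSpace ℝ (Fin m)) (n : ℕ) (z : Fin n → 𝒵)
    (d : Fin D) :
    inner ℝ h (blockScore P s t n z d) = ∑ i ∈ block t n d, scoreArray P s h n (z i) := by
  simp only [blockScore, inner_sum, inner_smul_right, scoreArray]

lemma IsAdapted.indepFun_blockScore {P : Measure 𝒵} [IsProbabilityMeasure P]
    (hs : Measurable s) (ht : StrictMono t) (hS : IsAdapted t S) (n : ℕ) (d : Fin D) :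
    IndepFun (fun z (c : Set.Iio d) => (S n z c, blockScore P s t n z c))
      (fun z => blockScore P s t n z d) (Measure.pi fun _ : Fin n => P) := by
  have hSm := hS.measurable n
  have hb := measurable_blockScore (t := t) P hs n
  refine indepFun_pi_of_dependsOn P (A := upto n (prevTime t d)) (B := block t n d)
    Finset.disjoint_sdiff (by fun_prop) (by fun_prop) (fun x y hxy => funext fun ⟨c, hc⟩ => ?_)
    (dependsOn_blockScore P n d)
  have hcd : upto n (t c) ⊆ upto n (prevTime t d) := upto_mono n (le_prevTime ht hc)
  exact Prod.ext (hS.dependsOn_upto n c fun i hi => hxy i (hcd hi))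
    (dependsOn_blockScore P n c fun i hi => hxy i (hcd (Finset.mem_sdiff.1 hi).1))

lemma IsRegularModel.shiftLogLikelihood_blockScore (hM : IsRegularModel μ Θ p θ₀ s)
    (ht : StrictMono t) (h : EuclideanSpace ℝ (Fin m)) (n : ℕ) (z : Fin n → 𝒵) :
    shiftLogLikelihood (fun d => timeStep t d • fisherInfo μ p θ₀ s) h
        (blockScore (obsLaw μ p θ₀) s t n z) =
      ∑ i ∈ blocks t n, scoreArray (obsLaw μ p θ₀) s h n (z i) -
        (∑ d, timeStep t d) * (∫ z, inner ℝ h (s z) ^ 2 ∂(obsLaw μ p θ₀)) / 2 := by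
  rw [shiftLogLikelihood, sum_blocks ht, hM.integral_inner_sq, Finset.sum_sub_distrib,
    Finset.sum_mul, Finset.sum_div]
  simp only [inner_blockScore, map_smul, smul_apply, real_inner_smul_right]

lemma IsRegularModel.measurable_joint (hM : IsRegularModel μ Θ p θ₀ s) (hS : IsAdapted t S)
    (n : ℕ) : Measurable fun z d => (S n z d, blockScore (obsLaw μ p θ₀) s t n z d) := by
  have hSm := hS.measurable n
  have hb := measurable_blockScore (t := t) (obsLaw μ p θ₀) hM.dqm.measurable_score n
  fun_prop

/-- The joint law under `P_θ₀` of the statistics and the block scores. -/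
noncomputable def IsRegularModel.jointLaw (hM : IsRegularModel μ Θ p θ₀ s) (hS : IsAdapted t S)
    (n : ℕ) : ProbabilityMeasure (Fin D → ℝ × EuclideanSpace ℝ (Fin m)) :=
  ⟨(sampleLaw μ p θ₀ n).map fun z d => (S n z d, blockScore (obsLaw μ p θ₀) s t n z d),
    have := hM.isProbabilityMeasure
    have : IsProbabilityMeasure (sampleLaw μ p θ₀ n) := by unfold sampleLaw; infer_instance
    Measure.isProbabilityMeasure_map (hM.measurable_joint hS n).aemeasurable⟩

lemma IsRegularModel.coe_jointLaw (hM : IsRegularModel μ Θ p θ₀ s) (hS : IsAdapted t S) (n : ℕ) :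
    (hM.jointLaw hS n : Measure (Fin D → ℝ × EuclideanSpace ℝ (Fin m))) =
      (sampleLaw μ p θ₀ n).map fun z d => (S n z d, blockScore (obsLaw μ p θ₀) s t n z d) := rfl

lemma IsRegularModel.hasInnovations_jointLaw (hM : IsRegularModel μ Θ p θ₀ s)
    (hS : IsAdapted t S) (ht : StrictMono t) (n : ℕ) :
    HasInnovations (hM.jointLaw hS n : Measure (Fin D → ℝ × EuclideanSpace ℝ (Fin m))) := by
  intro d
  have := hM.isProbabilityMeasure
  exact indepFun_map (hM.measurable_joint hS n) (by fun_prop) (by fun_prop)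
    (hS.indepFun_blockScore hM.dqm.measurable_score ht n d)

lemma IsRegularModel.tendsto_jointLaw_map_fst (hM : IsRegularModel μ Θ p θ₀ s)
    (hS : IsAdapted t S) {L : ProbabilityMeasure (Fin D → ℝ)}
    (hL : ConvergesWeakly (fun n => (sampleLaw μ p θ₀ n).map (S n)) (L : Measure (Fin D → ℝ))) :
    Tendsto (fun n => (hM.jointLaw hS n).map (f := fun x d => (x d).1)
      (Measurable.aemeasurable (by fun_prop))) atTop (𝓝 L) := by
  refine ProbabilityMeasure.tendsto_iff_forall_integral_tendsto.2 fun f => (hL f).congr fun n => ?_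
  rw [ProbabilityMeasure.toMeasure_map, hM.coe_jointLaw,
    Measure.map_map (by fun_prop) (hM.measurable_joint hS n)]
  rfl

lemma IsRegularModel.tendsto_jointLaw_map_snd (hM : IsRegularModel μ Θ p θ₀ s)
    (hS : IsAdapted t S) (ht : StrictMono t) (d : Fin D) :
    Tendsto (fun n => (hM.jointLaw hS n).map (f := fun x => (x d).2)
      (Measurable.aemeasurable (by fun_prop))) atTop
      (𝓝 ⟨gaussianShift (timeStep t d • fisherInfo μ p θ₀ s) 0, inferInstance⟩) := by
  have := hM.isProbabilityMeasure
  refine ProbabilityMeasure.tendsto_iff_tendsto_charFun.2 fun u => ?_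
  have hlim := (hM.isSmallArray u).tendsto_integral_cexp_mul_sum Complex.I (tendsto_card_block ht d)
  rw [hM.integral_inner_sq] at hlim
  have hexp : charFun (gaussianShift (timeStep t d • fisherInfo μ p θ₀ s) 0) u =
      Complex.exp (timeStep t d * (Complex.I ^ 2 / 2 *
        (inner ℝ u (Matrix.toEuclideanCLM (𝕜 := ℝ) (fisherInfo μ p θ₀ s) u) : ℝ))) := by
    rw [charFun_gaussianShift_zero (hM.posSemidef_fisherInfo.smul (timeStep_nonneg ht d)), map_smul,
      smul_apply, real_inner_smul_right, Complex.I_sq]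
    push_cast
    ring_nf
  rw [ProbabilityMeasure.coe_mk, hexp]
  refine hlim.congr fun n => ?_
  rw [ProbabilityMeasure.toMeasure_map, hM.coe_jointLaw,
    Measure.map_map (by fun_prop) (hM.measurable_joint hS n), charFun_apply,
    integral_map (Measurable.comp (by fun_prop) (hM.measurable_joint hS n)).aemeasurable
      (by fun_prop)]
  simp only [Function.comp_apply, real_inner_comm, inner_blockScore, mul_comm, sampleLaw]

lemma IsRegularModel.exists_eventually_integral_exp_shiftLogLikelihood_le
    (hM : IsRegularModel μ Θ p θ₀ s) (hS : IsAdapted t S) (ht : StrictMono t)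
    (h : EuclideanSpace ℝ (Fin m)) :
    ∃ C, ∀ᶠ n in atTop,
      Integrable (fun x => Real.exp (2 *
          shiftLogLikelihood (fun d => timeStep t d • fisherInfo μ p θ₀ s) h fun d => (x d).2))
        (hM.jointLaw hS n : Measure (Fin D → ℝ × EuclideanSpace ℝ (Fin m))) ∧
      ∫ x, Real.exp (2 *
          shiftLogLikelihood (fun d => timeStep t d • fisherInfo μ p θ₀ s) h fun d => (x d).2)
        ∂(hM.jointLaw hS n : Measure (Fin D → ℝ × EuclideanSpace ℝ (Fin m))) ≤ C := by
  have := hM.isProbabilityMeasure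
  obtain ⟨C, hC⟩ := (hM.isSmallArray h).exists_eventually_integral_exp_le (tendsto_card_blocks ht)
    2 ((∑ d, timeStep t d) * (∫ z, inner ℝ h (s z) ^ 2 ∂(obsLaw μ p θ₀)) / 2)
  refine ⟨C, hC.mono fun n hn => ?_⟩
  have hcont : Continuous fun x : Fin D → ℝ × EuclideanSpace ℝ (Fin m) => Real.exp (2 *
      shiftLogLikelihood (fun d => timeStep t d • fisherInfo μ p θ₀ s) h fun d => (x d).2) := by
    have := continuous_shiftLogLikelihood (fun d => timeStep t d • fisherInfo μ p θ₀ s) h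
    fun_prop
  have hmeas := (hM.measurable_joint hS n).aemeasurable (μ := sampleLaw μ p θ₀ n)
  rw [hM.coe_jointLaw, integrable_map_measure hcont.aestronglyMeasurable hmeas,
    integral_map hmeas hcont.aestronglyMeasurable]
  simpa only [Function.comp_def, hM.shiftLogLikelihood_blockScore ht, sampleLaw] using hn

lemma IsRegularModel.tendsto_integral_jointLaw_mul_exp
    (hM : IsRegularModel μ Θ p θ₀ s) (hS : IsAdapted t S) (ht : StrictMono t)
    (h : EuclideanSpace ℝ (Fin m)) {ν : Measure (Fin D → ℝ)}
    (hν : ConvergesWeakly (fun n => (sampleLaw μ p (localParam θ₀ h n) n).map (S n)) ν)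
    (f : BoundedContinuousFunction (Fin D → ℝ) ℝ) :
    Tendsto (fun n => ∫ x, f (fun d => (x d).1) * Real.exp
        (shiftLogLikelihood (fun d => timeStep t d • fisherInfo μ p θ₀ s) h fun d => (x d).2)
        ∂(hM.jointLaw hS n : Measure (Fin D → ℝ × EuclideanSpace ℝ (Fin m))))
      atTop (𝓝 (∫ x, f x ∂ν)) := by
  have hfS (n : ℕ) : Measurable fun z => f (S n z) :=
    f.continuous.measurable.comp (hS.measurable n)
  have hsub := hM.tendsto_integral_sub_integral_mul_exp h (tendsto_card_blocks ht) hfS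
    (fun n x y hxy => congrArg f (hS.dependsOn_blocks ht n hxy)) fun n z => f.norm_coe_le_norm _
  have hlim := (hν f).sub hsub
  rw [sub_zero] at hlim
  refine hlim.congr fun n => ?_
  have hcont : Continuous fun x : Fin D → ℝ × EuclideanSpace ℝ (Fin m) =>
      f (fun d => (x d).1) * Real.exp
        (shiftLogLikelihood (fun d => timeStep t d • fisherInfo μ p θ₀ s) h fun d => (x d).2) := by
    have := continuous_shiftLogLikelihood (fun d => timeStep t d • fisherInfo μ p θ₀ s) h
    fun_prop
  rw [hM.coe_jointLaw, integral_map (hM.measurable_joint hS n).aemeasurable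
    hcont.aestronglyMeasurable, integral_map (hS.measurable n).aemeasurable
    f.continuous.aestronglyMeasurable, sub_sub_cancel]
  simp only [hM.shiftLogLikelihood_blockScore ht]

lemma IsRegularModel.exists_limit (hM : IsRegularModel μ Θ p θ₀ s) (hS : IsAdapted t S)
    (ht : StrictMono t) {L : EuclideanSpace ℝ (Fin m) → Measure (Fin D → ℝ)}
    [hL0 : ∀ h, IsProbabilityMeasure (L h)]
    (hL : ∀ h, ConvergesWeakly (fun n => (sampleLaw μ p (localParam θ₀ h n) n).map (S n)) (L h)) :
    ∃ Q : ProbabilityMeasure (Fin D → ℝ × EuclideanSpace ℝ (Fin m)),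
      Tendsto (hM.jointLaw hS) (hyperfilter ℕ) (𝓝 Q) := by
  refine exists_tendsto_hyperfilter_of_tendsto_map (α := ⟨L 0, hL0 0⟩)
    (hM.tendsto_jointLaw_map_fst hS ?_) fun d => hM.tendsto_jointLaw_map_snd hS ht d
  simpa [localParam] using hL 0

lemma IsRegularModel.map_snd_eq_gaussianShift (hM : IsRegularModel μ Θ p θ₀ s)
    (hS : IsAdapted t S) (ht : StrictMono t)
    {Q : ProbabilityMeasure (Fin D → ℝ × EuclideanSpace ℝ (Fin m))}
    (hQ : Tendsto (hM.jointLaw hS) (hyperfilter ℕ) (𝓝 Q)) (d : Fin D) :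
    ((Q : Measure (Fin D → ℝ × EuclideanSpace ℝ (Fin m))).map fun x => (x d).2) =
      gaussianShift (timeStep t d • fisherInfo μ p θ₀ s) 0 :=
  congrArg ProbabilityMeasure.toMeasure <| tendsto_nhds_unique
    (ProbabilityMeasure.tendsto_map_of_tendsto_of_continuous _ _ hQ (by fun_prop))
    ((hM.tendsto_jointLaw_map_snd hS ht d).mono_left Nat.hyperfilter_le_atTop)

lemma IsRegularModel.hasInnovations_of_tendsto (hM : IsRegularModel μ Θ p θ₀ s)
    (hS : IsAdapted t S) (ht : StrictMono t)
    {Q : ProbabilityMeasure (Fin D → ℝ × EuclideanSpace ℝ (Fin m))}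
    (hQ : Tendsto (hM.jointLaw hS) (hyperfilter ℕ) (𝓝 Q)) :
    HasInnovations (Q : Measure (Fin D → ℝ × EuclideanSpace ℝ (Fin m))) := fun d =>
  indepFun_of_tendsto hQ (by fun_prop) (by fun_prop) fun n => hM.hasInnovations_jointLaw hS ht n d

/- Le Cam's third lemma: the law of the statistics under the local alternative `h` is the tilted law
under `θ₀`, and the uniform second-moment bound on the likelihood ratios lets the tilt pass to the
limit. -/
lemma IsRegularModel.map_fst_withDensity_eq (hM : IsRegularModel μ Θ p θ₀ s)
    (hS : IsAdapted t S) (ht : StrictMono t) {h : EuclideanSpace ℝ (Fin m)}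
    {ν : Measure (Fin D → ℝ)} [IsProbabilityMeasure ν]
    (hν : ConvergesWeakly (fun n => (sampleLaw μ p (localParam θ₀ h n) n).map (S n)) ν)
    {Q : ProbabilityMeasure (Fin D → ℝ × EuclideanSpace ℝ (Fin m))}
    (hQ : Tendsto (hM.jointLaw hS) (hyperfilter ℕ) (𝓝 Q)) :
    ((Q : Measure (Fin D → ℝ × EuclideanSpace ℝ (Fin m))).withDensity fun x => ENNReal.ofReal
      (Real.exp (shiftLogLikelihood (fun d => timeStep t d • fisherInfo μ p θ₀ s) h
        fun d => (x d).2))).map (fun x d => (x d).1) = ν := by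
  have hcont : Continuous fun x : Fin D → ℝ × EuclideanSpace ℝ (Fin m) =>
      shiftLogLikelihood (fun d => timeStep t d • fisherInfo μ p θ₀ s) h fun d => (x d).2 :=
    (continuous_shiftLogLikelihood _ h).comp (by fun_prop)
  have hexp0 (x : Fin D → ℝ × EuclideanSpace ℝ (Fin m)) := (Real.exp_pos
    (shiftLogLikelihood (fun d => timeStep t d • fisherInfo μ p θ₀ s) h fun d => (x d).2)).le
  have hint (f : BoundedContinuousFunction (Fin D → ℝ) ℝ) :
      ∫ x, f (fun d => (x d).1) * Real.exp (shiftLogLikelihood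
        (fun d => timeStep t d • fisherInfo μ p θ₀ s) h fun d => (x d).2)
        ∂(Q : Measure (Fin D → ℝ × EuclideanSpace ℝ (Fin m))) = ∫ x, f x ∂ν := by
    obtain ⟨C, hC⟩ := hM.exists_eventually_integral_exp_shiftLogLikelihood_le hS ht h
    exact tendsto_nhds_unique
      (tendsto_integral_mul_exp_of_tendsto hQ hcont (hC.filter_mono Nat.hyperfilter_le_atTop)
        (f := fun x => f fun d => (x d).1) (by fun_prop) fun x => f.norm_coe_le_norm _)
      ((hM.tendsto_integral_jointLaw_mul_exp hS ht h hν f).mono_left Nat.hyperfilter_le_atTop)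
  have := isProbabilityMeasure_withDensity_ofReal hexp0 (by
    simpa using hint (BoundedContinuousFunction.const _ 1))
  refine ext_of_forall_integral_eq_of_IsFiniteMeasure fun f => ?_
  rw [integral_map (Measurable.aemeasurable (by fun_prop)) f.continuous.aestronglyMeasurable,
    integral_withDensity_ofReal _ hcont.rexp.measurable hexp0, hint]

theorem IsRegularModel.exists_forall_measurePreserving (hM : IsRegularModel μ Θ p θ₀ s)
    (hS : IsAdapted t S) (ht : StrictMono t)
    {L : EuclideanSpace ℝ (Fin m) → Measure (Fin D → ℝ)} [∀ h, IsProbabilityMeasure (L h)]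
    (hL : ∀ h, ConvergesWeakly (fun n => (sampleLaw μ p (localParam θ₀ h n) n).map (S n)) (L h)) :
    ∃ Φ : (Fin D → EuclideanSpace ℝ (Fin m) × I) → Fin D → ℝ,
      (∀ d, DependsOn (fun w => Φ w d) (Set.Iic d)) ∧
      ∀ h, MeasurePreserving Φ (Measure.pi fun d =>
        (gaussianShift (timeStep t d • fisherInfo μ p θ₀ s) h).prod volume) (L h) := by
  obtain ⟨Q, hQ⟩ := hM.exists_limit hS ht hL
  obtain ⟨Φ, hΦdep, hΦ⟩ := (hM.hasInnovations_of_tendsto hS ht hQ).exists_forall_measurePreserving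
    (fun d => hM.posSemidef_fisherInfo.smul (timeStep_nonneg ht d))
    (hM.map_snd_eq_gaussianShift hS ht hQ)
  simp only [hM.map_fst_withDensity_eq hS ht (hL _) hQ] at hΦ
  exact ⟨Φ, hΦdep, hΦ⟩

end Limit

/-- The increments of a finite sequence that is preceded by zero. -/
noncomputable def increment {D : ℕ} {E : Type*} [AddGroup E] (w : Fin D → E) (d : Fin D) : E :=
  w d - if 0 < (d : ℕ) then w ⟨d - 1, by omega⟩ else 0

lemma increment_congr {D : ℕ} {E : Type*} [AddGroup E] {v w : Fin D → E} {c d : Fin D}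
    (hvw : ∀ i ≤ d, v i = w i) (hc : c ≤ d) : increment v c = increment w c := by
  unfold increment
  rw [hvw c hc, hvw ⟨c - 1, by omega⟩ ((Fin.le_def.2 (Nat.sub_le _ _)).trans hc)]

lemma measurable_increment {D : ℕ} {E : Type*} [AddGroup E] [MeasurableSpace E]
    [MeasurableSub₂ E] : Measurable (increment : (Fin D → E) → Fin D → E) := by
  refine measurable_pi_lambda _ fun d => ?_
  unfold increment
  split_ifs <;> fun_prop

lemma increment_comp_eq_sub {D : ℕ} {E : Type*} [AddGroup E] {f : I → E} (hf : f 0 = 0)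
    (t : Fin D → I) (d : Fin D) : increment (fun c => f (t c)) d = f (t d) - f (prevTime t d) := by
  unfold increment prevTime
  split_ifs
  · rfl
  · rw [hf]

section GaussianImage

open Matrix
open scoped MatrixOrder

variable {ι : Type*} [Fintype ι] [DecidableEq ι] {J : Matrix ι ι ℝ}

lemma toEuclideanCLM_invSqrt {m : ℕ} {J : Matrix (Fin m) (Fin m) ℝ} (hJ : J.PosSemidef)
    (hJu : IsUnit J.det) (x : EuclideanSpace ℝ (Fin m)) :
    toEuclideanCLM (𝕜 := ℝ) J (toEuclideanCLM (𝕜 := ℝ) (invSqrt J) x) =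
      toEuclideanCLM (𝕜 := ℝ) (CFC.sqrt J) x := by
  have hsq : CFC.sqrt J * CFC.sqrt J = J := CFC.sqrt_mul_sqrt_self J hJ.nonneg
  have hu : IsUnit (CFC.sqrt J).det := by
    rw [← hsq, det_mul] at hJu
    exact isUnit_of_mul_isUnit_left hJu
  have hmul : J * invSqrt J = CFC.sqrt J := by
    nth_rewrite 1 [← hsq]
    rw [invSqrt, mul_assoc, mul_nonsing_inv _ hu, mul_one]
  rw [← mul_apply_eq_comp, ← map_mul, hmul]

lemma toEuclideanCLM_increment_driftedBM {m D : ℕ} {Ω : Type*}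
    {B : I → Ω → EuclideanSpace ℝ (Fin m)} {t : Fin D → I} {J : Matrix (Fin m) (Fin m) ℝ}
    (hJ : J.PosSemidef) (hJu : IsUnit J.det) (h : EuclideanSpace ℝ (Fin m)) {ω : Ω}
    (hω : B 0 ω = 0) (d : Fin D) :
    toEuclideanCLM (𝕜 := ℝ) J (increment (fun c => driftedBM J B h (t c) ω) d) =
      toEuclideanCLM (𝕜 := ℝ) (timeStep t d • J) h +
        toEuclideanCLM (𝕜 := ℝ) (CFC.sqrt J) (B (t d) ω - B (prevTime t d) ω) := by
  rw [increment_comp_eq_sub (f := fun r => driftedBM J B h r ω) (by simp [driftedBM, hω])]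
  simp only [driftedBM, map_sub, map_add, map_smul, _root_.smul_apply,
    toEuclideanCLM_invSqrt hJ hJu, timeStep]
  module

lemma hasLaw_gaussianShift {Ω : Type*} [MeasurableSpace Ω] {P : Measure Ω}
    {X : Ω → EuclideanSpace ℝ ι} (hJ : J.PosSemidef) {δ : ℝ} (hδ : 0 ≤ δ)
    (hX : HasLaw X (multivariateGaussian 0 (δ • 1)) P) (h : EuclideanSpace ℝ ι) :
    HasLaw (fun ω => toEuclideanCLM (𝕜 := ℝ) (δ • J) h + toEuclideanCLM (𝕜 := ℝ) (CFC.sqrt J) (X ω))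
      (gaussianShift (δ • J) h) P := by
  have hquad (u : EuclideanSpace ℝ ι) :
      inner ℝ (toEuclideanCLM (𝕜 := ℝ) (CFC.sqrt J) u) (toEuclideanCLM (𝕜 := ℝ)
        (δ • (1 : Matrix ι ι ℝ)) (toEuclideanCLM (𝕜 := ℝ) (CFC.sqrt J) u)) =
      inner ℝ u (toEuclideanCLM (𝕜 := ℝ) (δ • J) u) := by
    rw [map_smul, map_smul, map_one, _root_.smul_apply, _root_.smul_apply, one_apply_eq_self,
      real_inner_smul_right, real_inner_smul_right, inner_toEuclideanCLM_sqrt,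
      toEuclideanCLM_sqrt_sqrt hJ]
  have hmap : (multivariateGaussian 0 (δ • 1)).map ((toEuclideanCLM (𝕜 := ℝ) (δ • J) h + ·) ∘
      toEuclideanCLM (𝕜 := ℝ) (CFC.sqrt J)) = gaussianShift (δ • J) h := by
    refine Measure.ext_of_charFun (funext fun u => ?_)
    rw [← Measure.map_map (by fun_prop) (by fun_prop), charFun_map_const_add, charFun_apply,
      integral_map (by fun_prop) (by fun_prop)]
    simp_rw [inner_toEuclideanCLM_sqrt]
    rw [← charFun_apply, charFun_multivariateGaussian (PosSemidef.one.smul hδ), gaussianShift,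
      charFun_multivariateGaussian (hJ.smul hδ), ← inner_toEuclideanCLM, ← inner_toEuclideanCLM,
      hquad, inner_zero_right, ← Complex.exp_add, real_inner_comm u, Complex.ofReal_zero, zero_mul,
      zero_sub, neg_add_eq_sub]
  exact (MeasurePreserving.mk (by fun_prop) hmap).comp_hasLaw hX

end GaussianImage

lemma hasLaw_pi_prod {Ω ι α β : Type*} [MeasurableSpace Ω] [Fintype ι] [MeasurableSpace α]
    [MeasurableSpace β] {P : Measure Ω} [IsFiniteMeasure P] {X : Ω → ι → α} {Y : Ω → ι → β}
    {μ : ι → Measure α} [∀ i, SigmaFinite (μ i)] {ν : ι → Measure β} [∀ i, SigmaFinite (ν i)]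
    (hX : HasLaw X (Measure.pi μ) P) (hY : HasLaw Y (Measure.pi ν) P) (hXY : IndepFun X Y P) :
    HasLaw (fun ω i => (X ω i, Y ω i)) (Measure.pi fun i => (μ i).prod (ν i)) P :=
  ((measurePreserving_arrowProdEquivProdArrow α β ι μ ν).symm _).comp_hasLaw
    (hXY.hasLaw_prod hX hY)

section Brownian

open scoped MatrixOrder

variable {m D : ℕ} {Ω : Type*} [MeasurableSpace Ω] {P : Measure Ω}
  {B : I → Ω → EuclideanSpace ℝ (Fin m)} {t : Fin D → I} {J : Matrix (Fin m) (Fin m) ℝ}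

lemma cons_zero_castSucc (t : Fin D → I) (d : Fin D) :
    (Fin.cons 0 t : Fin (D + 1) → I) d.castSucc = prevTime t d := by
  obtain ⟨k, hk⟩ := d
  cases k with
  | zero => rfl
  | succ k => rfl

lemma IsStdBrownianMotion.iIndepFun_sub_prevTime (hB : IsStdBrownianMotion B P)
    (ht : StrictMono t) : iIndepFun (fun d ω => B (t d) ω - B (prevTime t d) ω) P := by
  have hind := hB.indep_increments D (Fin.cons 0 t) <| Fin.monotone_iff_le_succ.2 fun i => by
    simpa only [cons_zero_castSucc, Fin.cons_succ] using prevTime_le ht i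
  simpa only [cons_zero_castSucc, Fin.cons_succ] using hind

theorem IsStdBrownianMotion.hasLaw_increment_driftedBM_prod [IsProbabilityMeasure P]
    (hB : IsStdBrownianMotion B P) {X : Type*} [MeasurableSpace X] {ν : Measure X}
    [IsProbabilityMeasure ν] {V : Ω → Fin D → X} (hV : HasLaw V (Measure.pi fun _ => ν) P)
    (hBV : IndepFun (fun ω r => B r ω) V P) (ht : StrictMono t) (hJ : J.PosSemidef)
    (hJu : IsUnit J.det) (h : EuclideanSpace ℝ (Fin m)) :
    HasLaw (fun ω d => (Matrix.toEuclideanCLM (𝕜 := ℝ) J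
        (increment (fun c => driftedBM J B h (t c) ω) d), V ω d))
      (Measure.pi fun d => (gaussianShift (timeStep t d • J) h).prod ν) P := by
  let a (d : Fin D) (x : EuclideanSpace ℝ (Fin m)) := Matrix.toEuclideanCLM (𝕜 := ℝ)
    (timeStep t d • J) h + Matrix.toEuclideanCLM (𝕜 := ℝ) (CFC.sqrt J) x
  have ha (d : Fin D) : Measurable (a d) := by fun_prop
  have hincr : HasLaw (fun ω d => a d (B (t d) ω - B (prevTime t d) ω))
      (Measure.pi fun d => gaussianShift (timeStep t d • J) h) P :=
    iIndepFun.hasLaw_pi (fun d => hasLaw_gaussianShift hJ (timeStep_nonneg ht d)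
      (hB.law_increment _ _ (prevTime_le ht d)) h)
      ((hB.iIndepFun_sub_prevTime ht).comp a ha)
  have hφ : Measurable fun (b : I → EuclideanSpace ℝ (Fin m)) d =>
      a d (b (t d) - b (prevTime t d)) :=
    measurable_pi_lambda _ fun d => (ha d).comp
      ((measurable_pi_apply (t d)).sub (measurable_pi_apply (prevTime t d)))
  have hind : IndepFun (fun ω d => a d (B (t d) ω - B (prevTime t d) ω)) V P :=
    hBV.comp hφ measurable_id
  refine (hasLaw_pi_prod hincr hV hind).congr ?_
  filter_upwards [hB.start_zero] with ω hω
  funext d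
  rw [toEuclideanCLM_increment_driftedBM hJ hJu h hω d]

end Brownian

/-- The extension by zero of a family indexed by a subset, which turns a path observed up to some
index into a full one. -/
noncomputable def extendZero {ι E : Type*} [Zero E] (A : Set ι) (w : A → E) (i : ι) : E :=
  open scoped Classical in if hi : i ∈ A then w ⟨i, hi⟩ else 0

lemma extendZero_of_mem {ι E : Type*} [Zero E] {A : Set ι} (w : A → E) {i : ι} (hi : i ∈ A) :
    extendZero A w i = w ⟨i, hi⟩ := dif_pos hi

lemma extendZero_of_notMem {ι E : Type*} [Zero E] {A : Set ι} (w : A → E) {i : ι} (hi : i ∉ A) :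
    extendZero A w i = 0 := dif_neg hi

lemma measurable_extendZero {ι E : Type*} [Zero E] [MeasurableSpace E] (A : Set ι) :
    Measurable (extendZero A : (A → E) → ι → E) := by
  refine measurable_pi_lambda _ fun i => ?_
  by_cases hi : i ∈ A
  · simpa only [extendZero_of_mem _ hi] using measurable_pi_apply _
  · simpa only [extendZero_of_notMem _ hi] using measurable_const

section Statistics

variable {m D : ℕ} {Ω : Type*} {B : I → Ω → EuclideanSpace ℝ (Fin m)} {t : Fin D → I}
  {J : Matrix (Fin m) (Fin m) ℝ} {g : ℝ → Fin D → I}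
  {Φ : (Fin D → EuclideanSpace ℝ (Fin m) × I) → Fin D → ℝ}

/-- The `d`-th component of `Φ` as a function of a path observed up to index `d` and of a uniform
variable: `Φ` is evaluated at the increments of the path, scaled by the Fisher information `J`, and
at the uniform variables that `g` generates. -/
noncomputable def pathStatistic (J : Matrix (Fin m) (Fin m) ℝ) (g : ℝ → Fin D → I)
    (Φ : (Fin D → EuclideanSpace ℝ (Fin m) × I) → Fin D → ℝ) (d : Fin D)
    (x : (Set.Iic d → EuclideanSpace ℝ (Fin m)) × ℝ) : ℝ :=
  Φ (fun c => (Matrix.toEuclideanCLM (𝕜 := ℝ) J (increment (extendZero (Set.Iic d) x.1) c),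
    g x.2 c)) d

lemma measurable_pathStatistic (hg : Measurable g) (hΦ : Measurable Φ) (d : Fin D) :
    Measurable (pathStatistic J g Φ d) := by
  have hincr : Measurable fun x : (Set.Iic d → EuclideanSpace ℝ (Fin m)) × ℝ =>
      increment (extendZero (Set.Iic d) x.1) :=
    measurable_increment.comp ((measurable_extendZero _).comp measurable_fst)
  refine ((measurable_pi_apply d).comp hΦ).comp (measurable_pi_lambda _ fun c => ?_)
  exact ((ContinuousLinearMap.measurable _).comp ((measurable_pi_apply c).comp hincr)).prodMk
    ((measurable_pi_apply c).comp (hg.comp measurable_snd))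

lemma pathStatistic_apply (hΦ : ∀ d, DependsOn (fun w => Φ w d) (Set.Iic d))
    (w : Fin D → EuclideanSpace ℝ (Fin m)) (u : ℝ) (d : Fin D) :
    pathStatistic J g Φ d (fun c => w c, u) =
      Φ (fun c => (Matrix.toEuclideanCLM (𝕜 := ℝ) J (increment w c), g u c)) d := by
  refine hΦ d fun c hc => ?_
  have hincr : increment (extendZero (Set.Iic d) fun c => w c) c = increment w c :=
    increment_congr (fun i hi => extendZero_of_mem _ (Set.mem_Iic.2 hi)) hc
  simp only [hincr]

open scoped MatrixOrder in
theorem IsStdBrownianMotion.hasLaw_pathStatistic [MeasurableSpace Ω] {P : Measure Ω}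
    [IsProbabilityMeasure P] (hB : IsStdBrownianMotion B P) {U : Ω → ℝ}
    (hU : HasLaw U (volume.restrict (Set.Icc (0 : ℝ) 1)) P)
    (hBU : IndepFun (fun ω r => B r ω) U P) (ht : StrictMono t) (hJ : J.PosSemidef)
    (hJu : IsUnit J.det)
    (hg : MeasurePreserving g (volume.restrict (Set.Icc 0 1)) (Measure.pi fun _ => volume))
    (hΦ : ∀ d, DependsOn (fun w => Φ w d) (Set.Iic d)) {h : EuclideanSpace ℝ (Fin m)}
    {ν : Measure (Fin D → ℝ)} (hΦν : MeasurePreserving Φ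
      (Measure.pi fun d => (gaussianShift (timeStep t d • J) h).prod volume) ν) :
    HasLaw (fun ω d => pathStatistic J g Φ d (fun c => driftedBM J B h (t c) ω, U ω)) ν P := by
  have hind : IndepFun (fun ω r => B r ω) (fun ω => g (U ω)) P :=
    hBU.comp measurable_id hg.measurable
  have hlaw := hΦν.comp_hasLaw
    (hB.hasLaw_increment_driftedBM_prod (hg.comp_hasLaw hU) hind ht hJ hJu h)
  refine hlaw.congr (.of_forall fun ω => funext fun d => ?_)
  exact pathStatistic_apply hΦ (fun c => driftedBM J B h (t c) ω) (U ω) d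

lemma driftedBM_eq_smul_add_bridge (τ : I) {r t : I} (ht : 0 < t)
    (h : EuclideanSpace ℝ (Fin m)) (ω : Ω) :
    driftedBM J B h r ω = ((r : ℝ) / t) • driftedBM J B h t ω +
      Matrix.toEuclideanCLM (𝕜 := ℝ) (invSqrt J)
        (bridge B τ r ω - ((r : ℝ) / t) • bridge B τ t ω) := by
  have hr : (r : ℝ) / t * t = r := div_mul_cancel₀ _ (Subtype.coe_lt_coe.2 ht).ne'
  have hrτ : (r : ℝ) / t * ((t : ℝ) / τ) = r / τ := by rw [← mul_div_assoc, hr]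
  simp only [driftedBM, bridge, map_sub, map_smul, smul_add, smul_sub, smul_smul, hr, hrτ]
  abel

lemma bridge_self {τ : I} (hτ : 0 < τ) (ω : Ω) : bridge B τ τ ω = 0 := by
  rw [bridge, div_self (Subtype.coe_lt_coe.2 hτ).ne', one_smul, sub_self]

lemma extendZero_bridge (ht_pos : ∀ d, 0 < t d) {e c d : Fin D} (he : (e : ℕ) + 1 = D)
    (hd : 0 < (d : ℕ)) (hc : c ≤ d) (ω : Ω) :
    extendZero (bridgeIndices d) (fun c => bridge B (t e) (t c) ω) c = bridge B (t e) (t c) ω := by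
  by_cases hmem : c ∈ bridgeIndices d
  · exact extendZero_of_mem _ hmem
  · have hce : c = e := by
      have : ¬ (c : ℕ) + 1 < D := fun hcD => hmem ⟨hd, hc, hcD⟩
      exact Fin.ext (by omega)
    rw [extendZero_of_notMem _ hmem, hce, bridge_self (ht_pos _)]

/-- The path up to index `d`, rebuilt from its value at `t d` and the bridge values at the indices
in `bridgeIndices d`. The zero that stands for the other bridge values is correct at the last index,
where the bridge is pinned, and cancels for `d = 0`. -/
noncomputable def pathOfBridge (J : Matrix (Fin m) (Fin m) ℝ) (t : Fin D → I) (d : Fin D)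
    (w : EuclideanSpace ℝ (Fin m)) (v : bridgeIndices d → EuclideanSpace ℝ (Fin m))
    (c : Set.Iic d) : EuclideanSpace ℝ (Fin m) :=
  ((t c : ℝ) / t d) • w + Matrix.toEuclideanCLM (𝕜 := ℝ) (invSqrt J)
    (extendZero _ v c - ((t c : ℝ) / t d) • extendZero _ v d)

lemma measurable_pathOfBridge (d : Fin D) :
    Measurable fun x : EuclideanSpace ℝ (Fin m) ×
      (bridgeIndices d → EuclideanSpace ℝ (Fin m)) × ℝ => pathOfBridge J t d x.1 x.2.1 := by
  have (c : Fin D) : Measurable fun x : EuclideanSpace ℝ (Fin m) ×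
      (bridgeIndices d → EuclideanSpace ℝ (Fin m)) × ℝ => extendZero (bridgeIndices d) x.2.1 c :=
    (measurable_pi_apply c).comp ((measurable_extendZero _).comp measurable_snd.fst)
  unfold pathOfBridge
  fun_prop

theorem pathOfBridge_bridge (ht_pos : ∀ d, 0 < t d) {e : Fin D} (he : (e : ℕ) + 1 = D)
    (d : Fin D) (h : EuclideanSpace ℝ (Fin m)) (ω : Ω) :
    pathOfBridge J t d (driftedBM J B h (t d) ω) (fun c => bridge B (t e) (t c) ω) =
      fun c : Set.Iic d => driftedBM J B h (t c) ω := by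
  funext ⟨c, hc⟩
  unfold pathOfBridge
  rcases Nat.eq_zero_or_pos d with hd | hd
  · have hcd : c = d := Fin.ext (by have := Fin.le_def.1 (Set.mem_Iic.1 hc); omega)
    have hdiv : (t d : ℝ) / t d = 1 := div_self (Subtype.coe_lt_coe.2 (ht_pos d)).ne'
    simp only [hcd, hdiv, one_smul, sub_self, map_zero, add_zero]
  · rw [extendZero_bridge ht_pos he hd hc, extendZero_bridge ht_pos he hd le_rfl,
      ← driftedBM_eq_smul_add_bridge _ (ht_pos d)]

end Statistics

end LimitExperiment

theorem corollary1 {m D : ℕ} (hD : 0 < D) {𝒵 : Type*} [MeasurableSpace 𝒵]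
    (μ : Measure 𝒵) (Θ : Set (EuclideanSpace ℝ (Fin m)))
    (p : EuclideanSpace ℝ (Fin m) → 𝒵 → ℝ) (hp : LimitExperiment.IsDensityFamily μ Θ p)
    (θ₀ : EuclideanSpace ℝ (Fin m)) (hθ₀ : θ₀ ∈ interior Θ)
    (s : 𝒵 → EuclideanSpace ℝ (Fin m)) (hdqm : LimitExperiment.IsDQM μ p θ₀ s)
    (J₀ : Matrix (Fin m) (Fin m) ℝ) (hJ₀ : J₀ = LimitExperiment.fisherInfo μ p θ₀ s)
    (hns : IsUnit J₀.det)
    (t : Fin D → I) (ht_pos : ∀ d, 0 < t d) (ht : StrictMono t)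
    (S : (n : ℕ) → (Fin n → 𝒵) → Fin D → ℝ) (hS : LimitExperiment.IsAdapted t S)
    (L : EuclideanSpace ℝ (Fin m) → ProbabilityMeasure (Fin D → ℝ))
    (hL : ∀ h : EuclideanSpace ℝ (Fin m),
      LimitExperiment.ConvergesWeakly
        (fun n => (LimitExperiment.sampleLaw μ p (LimitExperiment.localParam θ₀ h n) n).map (S n))
        (L h : Measure (Fin D → ℝ))) :
    (∃ T : (d : Fin D) → (Set.Iic d → EuclideanSpace ℝ (Fin m)) × ℝ → ℝ,
      (∀ d, Measurable (T d)) ∧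
      ∀ {Ω : Type*} [MeasurableSpace Ω] (P : Measure Ω) [IsProbabilityMeasure P]
        (B : I → Ω → EuclideanSpace ℝ (Fin m)) (U : Ω → ℝ),
        LimitExperiment.IsStdBrownianMotion B P →
        HasLaw U (volume.restrict (Set.Icc (0 : ℝ) 1)) P →
        IndepFun (fun ω r => B r ω) U P →
        ∀ h : EuclideanSpace ℝ (Fin m),
          HasLaw
            (fun ω d => T d (fun c => LimitExperiment.driftedBM J₀ B h (t c) ω, U ω))
            (L h : Measure (Fin D → ℝ)) P) ∧
    (∃ T' : (d : Fin D) → EuclideanSpace ℝ (Fin m) ×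
        (LimitExperiment.bridgeIndices d → EuclideanSpace ℝ (Fin m)) × ℝ → ℝ,
      (∀ d, Measurable (T' d)) ∧
      ∀ {Ω : Type*} [MeasurableSpace Ω] (P : Measure Ω) [IsProbabilityMeasure P]
        (B : I → Ω → EuclideanSpace ℝ (Fin m)) (U : Ω → ℝ),
        LimitExperiment.IsStdBrownianMotion B P →
        HasLaw U (volume.restrict (Set.Icc (0 : ℝ) 1)) P →
        IndepFun (fun ω r => B r ω) U P →
        ∀ h : EuclideanSpace ℝ (Fin m),
          HasLaw
            (fun ω d => T' d (LimitExperiment.driftedBM J₀ B h (t d) ω,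
              fun c => LimitExperiment.bridge B (t ⟨D - 1, by omega⟩) (t c) ω, U ω))
            (L h : Measure (Fin D → ℝ)) P) := by
  subst hJ₀
  have hM : LimitExperiment.IsRegularModel μ Θ p θ₀ s := ⟨hp, hθ₀, hdqm⟩
  obtain ⟨Φ, hΦ, hΦL⟩ := hM.exists_forall_measurePreserving hS ht hL
  obtain ⟨g, hg⟩ := LimitExperiment.exists_measurePreserving_pi_volume D
  have hT := LimitExperiment.measurable_pathStatistic
    (J := LimitExperiment.fisherInfo μ p θ₀ s) hg.measurable (hΦL 0).measurable
  refine ⟨⟨LimitExperiment.pathStatistic _ g Φ, hT, fun P _ B U hB hU hBU h =>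
    hB.hasLaw_pathStatistic hU hBU ht hM.posSemidef_fisherInfo hns hg hΦ (hΦL h)⟩, ?_⟩
  refine ⟨fun d x => LimitExperiment.pathStatistic _ g Φ d
      (LimitExperiment.pathOfBridge (LimitExperiment.fisherInfo μ p θ₀ s) t d x.1 x.2.1, x.2.2),
    fun d => (hT d).comp ((LimitExperiment.measurable_pathOfBridge d).prodMk measurable_snd.snd),
    fun P _ B U hB hU hBU h => ?_⟩
  have hlast : ((⟨D - 1, Nat.sub_one_lt_of_lt hD⟩ : Fin D) : ℕ) + 1 = D := Nat.sub_add_cancel hD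
  simp only [LimitExperiment.pathOfBridge_bridge ht_pos hlast]
  exact hB.hasLaw_pathStatistic hU hBU ht hM.posSemidef_fisherInfo hns hg hΦ (hΦL h)
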